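/- **Coefficients.** A function $g:[0,1]\to\mathbb R$ with $g(0)=0$ and $g>0$ on $(0,1]$ is *weakly degenerate* (WD) if $g\in C^0[0,1]\cap C^1(0,1]$ and $K_g:=\sup_{x\in(0,1]}\frac{x|g'(x)|}{g(x)}\in(0,1)$; it is *strongly degenerate* (SD) if $g\in C^1[0,1]$ and $K_g\in[1,2)$. Let $a,b,d\in C^0[0,1]$ and $\lambda\in\mathbb R$ be such that $\frac ba\in L^1(0,1)$, each of $a$ and $d$ is (WD) or (SD), and $K_a+2K_d\le 2$. Put $$\eta(x)=\exp\Big(\int_{1/2}^x\frac{b(s)}{a(s)}\,ds\Big),\qquad \sigma=\frac a\eta,\qquad M=\frac{\|b\|_{L^\infty(0,1)}}{a(1)},\qquad M_\infty=\Big\|\frac{xb}{a}\Big\|_{L^\infty(0,1)}.$$ **Spaces.** $L^2_{1/\sigma}(0,1)$ is the space of (real) $u$ with $\int_0^1 u^2/\sigma\,dx<\infty$, with inner product $\int_0^1 uv/\sigma\,dx$; $H^1_{1/\sigma}(0,1)=L^2_{1/\sigma}(0,1)\cap H^1_0(0,1)$ with norm $\|u\|^2=\int_0^1 u^2/\sigma\,dx+\int_0^1\eta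 (u')^2dx$; $H^{-1}_{1/\sigma}(0,1)$ is its dual with pivot space $L^2_{1/\sigma}(0,1)$. Let $C_{HP}$ be the best constant $C>0$ in $\int_0^1\frac{u^2}{\sigma d}dx\le C\int_0^1\eta(u')^2dx$ for $u\in H^1_{1/\sigma}(0,1)$, and assume $\lambda<1/C_{HP}$. **Solutions.** Let $A_\lambda y=\sigma(\eta y')'+\frac\lambda d y$ (so $A_\lambda y=ay''+by'+\frac\lambda dy$) in the sense of distributions, with $D(A_\lambda)=\{y\in H^1_{1/\sigma}:A_\lambda y\in L^2_{1/\sigma}\}$. For $(v_T^0,v_T^1)\in H^1_{1/\sigma}\times L^2_{1/\sigma}$ let $v$ be the mild solution on $[0,\infty)$ of $$v_{tt}=A_\lambda v,\qquad v(t,0)=v(t,1)=0,\qquad v(T)=v_T^0,\quad v_t(T)=v_T^1,$$ i.e. $V=(v,v_t)\in C([0,\infty);H^1_{1/\sigma}\times L^2_{1/\sigma})$ and $V(t)=V(T)+\mathcal A\int_T^tV\,ds$ for all $t\ge0$, where $\mathcal A(y,z)=(z,A_\lambda y)$ on $D(A_\lambda)\times H^1_{1/\sigma}$; its normal derivative $v_x(\cdot,1)\in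 L^2(0,T)$ is the limit of the normal derivatives of classical solutions whose data at time $T$ converge to $(v_T^0,v_T^1)$. Given $f\in L^2_{loc}[0,\infty)$ and $(u_0,u_1)\in L^2_{1/\sigma}\times H^{-1}_{1/\sigma}$, a *solution by transposition* of $$\begin{cases}u_{tt}-a u_{xx}-\frac{\lambda}{d}u-bu_x=0,\\ u(t,0)=0,\quad u(t,1)=f(t),\\ u(0,x)=u_0(x),\quad u_t(0,x)=u_1(x)\end{cases}\tag{1}$$ is a function $u\in C^1([0,\infty);H^{-1}_{1/\sigma})\cap C([0,\infty);L^2_{1/\sigma})$ such that, for all $T>0$ and all $(v_T^0,v_T^1)$, with $v$ as above, $$\langle u_t(T),v_T^0\rangle-\int_0^1\frac{u(T)v_T^1}{\sigma}dx=\langle u_1,v(0)\rangle-\int_0^1\frac{u_0\,v_t(0,x)}{\sigma}dx-\eta(1)\int_0^Tf(t)\,v_x(t,1)\,dt .$$ **Hypothesis and time $T_0$.** Suppose that either $K_a\le1$, and put $m:=M$; or $K_a>1$ and $\frac{xb}a\in L^\infty(0,1)$, and put $m:=M_\infty$. Suppose moreover that one of the following holds, and define $T_0$ accordingly: 1. $K_a<2-2m$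 and $-\dfrac{2-K_a-2m}{C_{HP}\left(1+\frac{3K_a}2+K_d+m\right)}<\lambda<0$, with $$T_0=\frac{4\max\{1,\frac1{a(1)}\}+K_a\max\{1,C_{HP}\max_{[0,1]}d\}}{2\left(1-\frac{K_a}2-m\right)-|\lambda|C_{HP}\left(1+\frac{3K_a}2+K_d+m\right)};$$ 2. $\lambda\ge0$ and $K_a+2K_d\le2-2m$, with $$T_0=\frac{4\max\{1,\frac1{a(1)}\}+K_a\max\{1,C_{HP}\max_{[0,1]}d\}}{1-\frac{K_a}2-m}.$$ **Theorem.** Under these assumptions, for every $T>T_0$ and every $(u_0,u_1)\in L^2_{1/\sigma}(0,1)\times H^{-1}_{1/\sigma}(0,1)$ there is a control $f\in L^2(0,T)$ (extended by $0$ to $[0,\infty)$) such that (1) has a solution by transposition, and every solution by transposition $u$ of (1) satisfies $u(T)=0$ and $u_t(T)=0$. -/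

import Mathlib

open MeasureTheory Set Filter Topology
open scoped ContDiff

namespace DegWave

noncomputable section

/-! ### Degenerate coefficients -/

/-- `K_g = sup_{x ∈ (0,1]} x |g'(x)| / g(x)`; at `x = 1` the derivative is one-sided. -/
def degExp (g : ℝ → ℝ) : ℝ :=
  sSup ((fun x => x * |derivWithin g (Icc 0 1) x| / g x) '' Ioc 0 1)

/-- The supremum that defines `K_g` is finite. -/
def DegBdd (g : ℝ → ℝ) : Prop :=
  BddAbove ((fun x => x * |derivWithin g (Icc 0 1) x| / g x) '' Ioc 0 1)

/-- `g` is weakly degenerate at `0`. -/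
structure IsWD (g : ℝ → ℝ) : Prop where
  cont : ContinuousOn g (Icc 0 1)
  smooth : ContDiffOn ℝ 1 g (Ioc 0 1)
  zero : g 0 = 0
  pos : ∀ x ∈ Ioc (0 : ℝ) 1, 0 < g x
  bdd : DegBdd g
  exp_mem : degExp g ∈ Ioo (0 : ℝ) 1

/-- `g` is strongly degenerate at `0`. -/
structure IsSD (g : ℝ → ℝ) : Prop where
  smooth : ContDiffOn ℝ 1 g (Icc 0 1)
  zero : g 0 = 0
  pos : ∀ x ∈ Ioc (0 : ℝ) 1, 0 < g x
  bdd : DegBdd g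
  exp_mem : degExp g ∈ Ico (1 : ℝ) 2

/-- The norm of `L^∞(0,1)`. -/
def linftyNorm (g : ℝ → ℝ) : ℝ :=
  (eLpNorm g ⊤ (volume.restrict (Ioo (0 : ℝ) 1))).toReal

/-! ### Weights and function spaces -/

/-- `η(x) = exp (∫_{1/2}^x b/a)`. -/
def eta (a b : ℝ → ℝ) (x : ℝ) : ℝ :=
  Real.exp (∫ s in (1 / 2 : ℝ)..x, b s / a s)

/-- `σ = a / η`. -/
def sigma (a b : ℝ → ℝ) (x : ℝ) : ℝ := a x * (eta a b x)⁻¹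

/-- The measure `dx / σ` on `(0,1)`. -/
def muSigma (a b : ℝ → ℝ) : Measure ℝ :=
  (volume.restrict (Ioo (0 : ℝ) 1)).withDensity fun x => ENNReal.ofReal (1 / sigma a b x)

/-- The measure `η dx` on `(0,1)`. -/
def muEta (a b : ℝ → ℝ) : Measure ℝ :=
  (volume.restrict (Ioo (0 : ℝ) 1)).withDensity fun x => ENNReal.ofReal (eta a b x)

/-- `L²_{1/σ}(0,1)`, with `⟨u, v⟩ = ∫ u v / σ`. -/
abbrev L2 (a b : ℝ → ℝ) := Lp ℝ 2 (muSigma a b)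

/-- `L²(0,1)` with the weight `η`, where the derivatives of elements of `H1 a b` live. -/
abbrev L2eta (a b : ℝ → ℝ) := Lp ℝ 2 (muEta a b)

theorem measurable_setIntegral_mono (h : ℝ → ℝ) (A : ℝ → Set ℝ) (hA : Monotone A) :
    Measurable fun x => ∫ s in A x, h s := by
  classical
  have hS : MeasurableSet {x | IntegrableOn h (A x)} := by
    apply Set.OrdConnected.measurableSet
    exact IsLowerSet.ordConnected fun x y hyx hx => IntegrableOn.mono_set hx (hA hyx)
  have h1 : Measurable fun x => (∫⁻ s in A x, ENNReal.ofReal (h s)).toReal :=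
    (Monotone.measurable fun x y hxy => lintegral_mono_set (hA hxy)).ennreal_toReal
  have h2 : Measurable fun x => (∫⁻ s in A x, ENNReal.ofReal (-h s)).toReal :=
    (Monotone.measurable fun x y hxy => lintegral_mono_set (hA hxy)).ennreal_toReal
  have h3 : (fun x => ∫ s in A x, h s) = {x | IntegrableOn h (A x)}.indicator
      (fun x => (∫⁻ s in A x, ENNReal.ofReal (h s)).toReal -
        (∫⁻ s in A x, ENNReal.ofReal (-h s)).toReal) := by
    funext x
    by_cases hx : IntegrableOn h (A x)
    · rw [indicator_of_mem (by exact hx)]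
      exact integral_eq_lintegral_pos_part_sub_lintegral_neg_part hx
    · rw [indicator_of_notMem (by exact hx)]
      exact integral_undef hx
  rw [h3]
  exact (h1.sub h2).indicator hS

theorem measurable_eta (a b : ℝ → ℝ) : Measurable (eta a b) := by
  have h1 := measurable_setIntegral_mono (fun s => b s / a s) (fun x => Ioc (1 / 2) x)
    (fun x y hxy => Ioc_subset_Ioc_right hxy)
  have h2 := measurable_setIntegral_mono (fun s => b s / a s) (fun x => Ioc (-x) (1 / 2))
    (fun x y hxy => Ioc_subset_Ioc_left (neg_le_neg hxy))
  have h3 := h2.comp measurable_neg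
  simp only [Function.comp_def, neg_neg] at h3
  exact Real.measurable_exp.comp (h1.sub h3)

theorem absCont_muEta (a b : ℝ → ℝ) :
    volume.restrict (Ioo (0 : ℝ) 1) ≪ muEta a b := by
  apply withDensity_absolutelyContinuous'
  · exact (measurable_eta a b).ennreal_ofReal.aemeasurable
  · exact Eventually.of_forall fun x => by simp [eta, Real.exp_pos]

theorem integral_congr_of_ae {u v : ℝ → ℝ} (h : u =ᵐ[volume.restrict (Ioo (0 : ℝ) 1)] v)
    {x : ℝ} (hx : x ∈ Icc (0 : ℝ) 1) :
    ∫ s in (0 : ℝ)..x, u s = ∫ s in (0 : ℝ)..x, v s := by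
  rw [intervalIntegral.integral_of_le hx.1, intervalIntegral.integral_of_le hx.1]
  apply integral_congr_ae
  rw [← restrict_Ioo_eq_restrict_Ioc]
  exact ae_mono (Measure.restrict_mono (Ioo_subset_Ioo_right hx.2) le_rfl) h

theorem intervalIntegrable_of_Ioo {u : ℝ → ℝ} (h : IntegrableOn u (Ioo 0 1))
    {x : ℝ} (hx : x ∈ Icc (0 : ℝ) 1) : IntervalIntegrable u volume 0 x := by
  rw [intervalIntegrable_iff_integrableOn_Ioo_of_le hx.1]
  exact h.mono_set (Ioo_subset_Ioo_right hx.2)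

theorem ae_mem_muSigma (a b : ℝ → ℝ) : ∀ᵐ x ∂(muSigma a b), x ∈ Icc (0 : ℝ) 1 :=
  (withDensity_absolutelyContinuous _ _).ae_le
    ((ae_restrict_mem measurableSet_Ioo).mono fun _ hx => Ioo_subset_Icc_self hx)

/-- `H¹_{1/σ}(0,1) = L²_{1/σ}(0,1) ∩ H¹₀(0,1)`. An element is a pair `(u, u')`: `u` is the
absolutely continuous function `x ↦ ∫₀ˣ u'`, which vanishes at `0`, and it also vanishes at `1`.
The norm is `‖u‖² = ∫ u² / σ + ∫ η (u')²`. (If `b / a` is integrable, then `η` is bounded away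
from zero, and the integrability of `u'` on `(0,1)` is automatic.) -/
def H1 (a b : ℝ → ℝ) : Submodule ℝ (WithLp 2 (L2 a b × L2eta a b)) where
  carrier := {z | IntegrableOn (z.snd : ℝ → ℝ) (Ioo 0 1) ∧
    (∀ᵐ x ∂(muSigma a b), z.fst x = ∫ s in (0 : ℝ)..x, z.snd s) ∧
    ∫ s in (0 : ℝ)..1, z.snd s = 0}
  zero_mem' := by
    have h2 : (((0 : WithLp 2 (L2 a b × L2eta a b)).snd : L2eta a b) : ℝ → ℝ)
        =ᵐ[volume.restrict (Ioo (0 : ℝ) 1)] fun _ => 0 :=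
      (absCont_muEta a b).ae_le (Lp.coeFn_zero ℝ 2 (muEta a b))
    refine ⟨(integrableOn_zero).congr_fun_ae h2.symm, ?_, ?_⟩
    · filter_upwards [Lp.coeFn_zero ℝ 2 (muSigma a b), ae_mem_muSigma a b] with x hx hx'
      rw [integral_congr_of_ae h2 hx']
      simpa using hx
    · rw [integral_congr_of_ae h2 (right_mem_Icc.2 zero_le_one)]
      simp
  add_mem' := by
    rintro z w ⟨hz1, hz2, hz3⟩ ⟨hw1, hw2, hw3⟩
    have h2 : (((z + w).snd : L2eta a b) : ℝ → ℝ)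
        =ᵐ[volume.restrict (Ioo (0 : ℝ) 1)] fun s => z.snd s + w.snd s :=
      (absCont_muEta a b).ae_le (Lp.coeFn_add z.snd w.snd)
    refine ⟨(hz1.add hw1).congr_fun_ae h2.symm, ?_, ?_⟩
    · filter_upwards [Lp.coeFn_add z.fst w.fst, ae_mem_muSigma a b, hz2, hw2] with x hx hx' h3 h4
      rw [integral_congr_of_ae h2 hx', intervalIntegral.integral_add
        (intervalIntegrable_of_Ioo hz1 hx') (intervalIntegrable_of_Ioo hw1 hx'), ← h3, ← h4]
      exact hx
    · have h1 : (1 : ℝ) ∈ Icc (0 : ℝ) 1 := right_mem_Icc.2 zero_le_one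
      rw [integral_congr_of_ae h2 h1, intervalIntegral.integral_add
        (intervalIntegrable_of_Ioo hz1 h1) (intervalIntegrable_of_Ioo hw1 h1), hz3, hw3, add_zero]
  smul_mem' := by
    rintro c z ⟨hz1, hz2, hz3⟩
    have h2 : (((c • z).snd : L2eta a b) : ℝ → ℝ)
        =ᵐ[volume.restrict (Ioo (0 : ℝ) 1)] fun s => c * z.snd s :=
      (absCont_muEta a b).ae_le (Lp.coeFn_smul c z.snd)
    refine ⟨(Integrable.const_mul hz1 c).congr h2.symm, ?_, ?_⟩
    · filter_upwards [Lp.coeFn_smul c z.fst, ae_mem_muSigma a b, hz2] with x hx hx' h3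
      rw [integral_congr_of_ae h2 hx', intervalIntegral.integral_const_mul, ← h3]
      exact hx
    · rw [integral_congr_of_ae h2 (right_mem_Icc.2 zero_le_one),
        intervalIntegral.integral_const_mul, hz3, mul_zero]

/-- The inclusion of `H¹_{1/σ}` in `L²_{1/σ}`. -/
def val (a b : ℝ → ℝ) : H1 a b →L[ℝ] L2 a b :=
  (WithLp.fstL 2 ℝ (L2 a b) (L2eta a b)).comp (H1 a b).subtypeL

/-- The derivative `u ↦ u'`. -/
def der (a b : ℝ → ℝ) : H1 a b →L[ℝ] L2eta a b :=
  (WithLp.sndL 2 ℝ (L2 a b) (L2eta a b)).comp (H1 a b).subtypeL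

/-- `H⁻¹_{1/σ}(0,1)`, the dual of `H¹_{1/σ}(0,1)`. -/
abbrev Hm1 (a b : ℝ → ℝ) := StrongDual ℝ (H1 a b)

/-- `L²_{1/σ}` as pivot space: `g` is identified with the functional `v ↦ ∫ g v / σ`. -/
def toHm1 (a b : ℝ → ℝ) (g : L2 a b) : Hm1 a b :=
  (innerSL ℝ g).comp (val a b)

/-- The derivative at `x = 1` (from the left) of the continuous representative of `u`. -/
def dxAtOne (a b : ℝ → ℝ) (u : H1 a b) : ℝ :=
  derivWithin (fun x => ∫ s in (0 : ℝ)..x, der a b u s) (Icc 0 1) 1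

/-- `C` is an admissible constant in the Hardy-Poincaré inequality
`∫ u² / (σ d) ≤ C ∫ η (u')²` on `H¹_{1/σ}`. -/
def IsHPConst (a b d : ℝ → ℝ) (C : ℝ) : Prop :=
  0 < C ∧ ∀ u : H1 a b,
    IntegrableOn (fun x => (val a b u x) ^ 2 / (sigma a b x * d x)) (Ioo 0 1) ∧
    ∫ x in Ioo (0 : ℝ) 1, (val a b u x) ^ 2 / (sigma a b x * d x) ≤
      C * ∫ x in Ioo (0 : ℝ) 1, eta a b x * (der a b u x) ^ 2

/-- The best constant in the Hardy-Poincaré inequality. -/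
def CHP (a b d : ℝ → ℝ) : ℝ := sInf {C | IsHPConst a b d C}

/-! ### The operator, and solutions of the homogeneous problem -/

/-- `w ∈ D(A_λ)` and `A_λ w = σ (η w')' + (λ / d) w = g ∈ L²_{1/σ}`: the equation
`(η w')' + λ w / (σ d) = g / σ` holds in the sense of distributions on `(0,1)`. -/
def IsALambda (a b d : ℝ → ℝ) (lam : ℝ) (w : H1 a b) (g : L2 a b) : Prop :=
  ∀ φ : ℝ → ℝ, ContDiff ℝ ∞ φ → HasCompactSupport φ → tsupport φ ⊆ Ioo 0 1 →
    -(∫ x in Ioo (0 : ℝ) 1, eta a b x * der a b w x * deriv φ x) +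
        lam * ∫ x in Ioo (0 : ℝ) 1, val a b w x * φ x / (sigma a b x * d x) =
      ∫ x in Ioo (0 : ℝ) 1, g x * φ x / sigma a b x

/-- `(v, v_t)` is the mild solution on `[0, ∞)` of
`v_tt = a v_xx + b v_x + (λ / d) v`, `v(t,0) = v(t,1) = 0`, `v(T) = v0`, `v_t(T) = v1`:
with `𝒜 (y, z) = (z, A_λ y)` on `D(A_λ) × H¹_{1/σ}`, the curve `V = (v, v_t)` is continuous in
`H¹_{1/σ} × L²_{1/σ}`, and for all `t` one has `∫_T^t V ∈ D(𝒜)` and `V(t) = V(T) + 𝒜 ∫_T^t V`. -/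
structure IsMildSol (a b d : ℝ → ℝ) (lam T : ℝ) (v0 : H1 a b) (v1 : L2 a b)
    (v : ℝ → H1 a b) (vt : ℝ → L2 a b) : Prop where
  cont : ContinuousOn v (Ici 0)
  cont_t : ContinuousOn vt (Ici 0)
  eq_fst : ∀ t ∈ Ici (0 : ℝ), val a b (v t) = val a b v0 + ∫ s in T..t, vt s
  eq_snd : ∀ t ∈ Ici (0 : ℝ), IsALambda a b d lam (∫ s in T..t, v s) (vt t - v1)

/-- Classical solutions on `[0, ∞)` of the homogeneous problem:
`v ∈ C²([0,∞); L²_{1/σ}) ∩ C¹([0,∞); H¹_{1/σ}) ∩ C([0,∞); D(A_λ))` and `v_tt = A_λ v`. -/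
structure IsClassicalSol (a b d : ℝ → ℝ) (lam : ℝ)
    (v vt : ℝ → H1 a b) (vtt : ℝ → L2 a b) : Prop where
  deriv_fst : ∀ t ∈ Ici (0 : ℝ), HasDerivWithinAt v (vt t) (Ici 0) t
  deriv_snd : ∀ t ∈ Ici (0 : ℝ), HasDerivWithinAt (fun s => val a b (vt s)) (vtt t) (Ici 0) t
  cont_t : ContinuousOn vt (Ici 0)
  cont_tt : ContinuousOn vtt (Ici 0)
  eqn : ∀ t ∈ Ici (0 : ℝ), IsALambda a b d lam (v t) (vtt t)

/-- `g = v_x(·, 1) ∈ L²(0,T)` for the mild solution `v` with data `(v0, v1)` at time `T`: the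
limit in `L²(0,T)` of the normal derivatives `v_{n,x}(·, 1)` of classical solutions `v_n` whose
data at time `T` converge to `(v0, v1)` in `H¹_{1/σ} × L²_{1/σ}`. -/
def IsNormalTrace (a b d : ℝ → ℝ) (lam T : ℝ) (v0 : H1 a b) (v1 : L2 a b) (g : ℝ → ℝ) : Prop :=
  MemLp g 2 (volume.restrict (Ioo 0 T)) ∧
  ∃ (v vt : ℕ → ℝ → H1 a b) (vtt : ℕ → ℝ → L2 a b),
    (∀ n, IsClassicalSol a b d lam (v n) (vt n) (vtt n)) ∧
    Tendsto (fun n => v n T) atTop (𝓝 v0) ∧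
    Tendsto (fun n => val a b (vt n T)) atTop (𝓝 v1) ∧
    Tendsto (fun n => eLpNorm (fun t => dxAtOne a b (v n t) - g t) 2
      (volume.restrict (Ioo 0 T))) atTop (𝓝 0)

/-! ### The controlled problem -/

/-- The time derivative `u_t(t) ∈ H⁻¹_{1/σ}` of a curve `u` in `L²_{1/σ}`, on `[0, ∞)`. -/
def timeDeriv (a b : ℝ → ℝ) (u : ℝ → L2 a b) (t : ℝ) : Hm1 a b :=
  derivWithin (fun s => toHm1 a b (u s)) (Ici 0) t

/-- `u` is the solution by transposition of
`u_tt - a u_xx - (λ / d) u - b u_x = 0`, `u(t,0) = 0`, `u(t,1) = f(t)`, `u(0) = u0`, `u_t(0) = u1`: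
for every `T > 0` and every solution `v` of the homogeneous problem with data `(v0, v1)` at `T`,
`⟨u_t(T), v0⟩ - ∫ u(T) v1 / σ = ⟨u1, v(0)⟩ - ∫ u0 v_t(0) / σ - η(1) ∫₀ᵀ f(t) v_x(t,1) dt`.
The minus sign in front of the boundary term is the one that integration by parts gives for the
boundary condition `u(t,1) = f(t)`. -/
structure IsTranspositionSol (a b d : ℝ → ℝ) (lam : ℝ) (f : ℝ → ℝ)
    (u0 : L2 a b) (u1 : Hm1 a b) (u : ℝ → L2 a b) : Prop where
  control : ∀ T > 0, MemLp f 2 (volume.restrict (Ioo 0 T))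
  cont : ContinuousOn u (Ici 0)
  smooth : ContDiffOn ℝ 1 (fun t => toHm1 a b (u t)) (Ici 0)
  identity : ∀ T > 0, ∀ (v0 : H1 a b) (v1 : L2 a b) (v : ℝ → H1 a b) (vt : ℝ → L2 a b)
    (vx : ℝ → ℝ), IsMildSol a b d lam T v0 v1 v vt → IsNormalTrace a b d lam T v0 v1 vx →
    timeDeriv a b u T v0 - inner ℝ (u T) v1 =
      u1 (v 0) - inner ℝ u0 (vt 0) - eta a b 1 * ∫ t in (0 : ℝ)..T, f t * vx t

/-! ### Hypotheses and the observability time -/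

/-- `b` is continuous, `b / a ∈ L¹(0,1)`, `a` and `d` are (WD) or (SD), `K_a + 2 K_d ≤ 2`, and
`λ < 1 / C_HP`. -/
structure BaseHyp (a b d : ℝ → ℝ) (lam : ℝ) : Prop where
  cont_b : ContinuousOn b (Icc 0 1)
  integrable : IntegrableOn (fun x => b x / a x) (Ioo 0 1)
  deg_a : IsWD a ∨ IsSD a
  deg_d : IsWD d ∨ IsSD d
  exp_le : degExp a + 2 * degExp d ≤ 2
  lam_lt : lam < 1 / CHP a b d

/-- `M = ‖b‖_{L^∞(0,1)} / a(1)`. -/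
def driftM (a b : ℝ → ℝ) : ℝ := linftyNorm b / a 1

/-- `M_∞ = ‖x b / a‖_{L^∞(0,1)}`. -/
def driftMInf (a b : ℝ → ℝ) : ℝ := linftyNorm fun x => x * b x / a x

/-- `4 max {1, 1/a(1)} + K_a max {1, C_HP max d}`. -/
def timeNum (a b d : ℝ → ℝ) : ℝ :=
  4 * max 1 (1 / a 1) + degExp a * max 1 (CHP a b d * sSup (d '' Icc 0 1))

/-- The range of negative `λ`, where `m` is `M` or `M_∞`; the observability time is `T0`. -/
def NegRange (a b d : ℝ → ℝ) (lam m T0 : ℝ) : Prop :=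
  -((2 - degExp a - 2 * m) / (CHP a b d * (1 + 3 * degExp a / 2 + degExp d + m))) < lam ∧
  lam < 0 ∧ degExp a < 2 - 2 * m ∧
  T0 = timeNum a b d /
    (2 * (1 - degExp a / 2 - m) - |lam| * CHP a b d * (1 + 3 * degExp a / 2 + degExp d + m))

/-- The range of nonnegative `λ`, where `m` is `M` or `M_∞`; the observability time is `T0`. -/
def NonnegRange (a b d : ℝ → ℝ) (lam m T0 : ℝ) : Prop :=
  0 ≤ lam ∧ degExp a + 2 * degExp d ≤ 2 - 2 * m ∧
  T0 = timeNum a b d / (1 - degExp a / 2 - m)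

/-- The four admissible cases, with the observability time `T0` of each. -/
def ControlHyp (a b d : ℝ → ℝ) (lam T0 : ℝ) : Prop :=
  BaseHyp a b d lam ∧
  ((degExp a ≤ 1 ∧ NegRange a b d lam (driftM a b) T0) ∨
   (degExp a ≤ 1 ∧ NonnegRange a b d lam (driftM a b) T0) ∨
   (1 < degExp a ∧ MemLp (fun x => x * b x / a x) ⊤ (volume.restrict (Ioo (0 : ℝ) 1)) ∧
      NegRange a b d lam (driftMInf a b) T0) ∨
   (1 < degExp a ∧ MemLp (fun x => x * b x / a x) ⊤ (volume.restrict (Ioo (0 : ℝ) 1)) ∧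
      NonnegRange a b d lam (driftMInf a b) T0))

end

end DegWave

/-!
The equation is null controllable because its normal derivative at `x = 1` observes the energy of
the homogeneous problem.

Let `V` be `H¹_{1/σ}` with the energy inner product `∫ η u' v' - λ ∫ u v / (σ d)`, which is
equivalent to the given one as `λ C_HP < 1` (`Coeffs.exists_energyNorm`), let `H = L²_{1/σ}`, and let
`ι : V → H` be the embedding. Then `A_λ w = g` means `w = -ι† g` (`Coeffs.isALambda_iff_eq`), so the
wave operator `(y, z) ↦ (z, A_λ y)` on `V × H` is the inverse of the bounded injective skew-adjoint
operator `J = waveInv ι`. Working with `J` alone avoids unbounded operators: its inverse generates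
a unitary group `S` (`IsSkew.exists_group`), mild solutions are the curves `t ↦ S (t - T) P`, and
classical solutions are those with `P = J q`. The normal derivative of the latter is
`ν (S (t - T) q).snd`, where `ν g = w'(1)` for the solution `w` of `A_λ w = g`.

Observability comes from the multiplier `x w'`. The flux `η w'` of an element of the domain is
absolutely continuous away from `0`, and integration by parts gives an identity for `w'(1)²`
(`Coeffs.multiplier_identity`). The boundary term at `0` vanishes in the limit: it is nonnegative,
and a positive limit would contradict `∫ η (w')² < ∞`. Integrated in time, the identity bounds the
energy by the observation. Two facts separate the singular term from the observability time.
* For some long time the observation bounds the energy. Here the multiplier `w` equidistributes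
  the energy, and the range of `λ` permits the absorption of the singular term
  (`Coeffs.exists_absorb`, `MultiplierData.exists_long_obs`).
* For every `T > 2 max {1, 1 / a(1)} / (1 - K_a / 2 - m)` it does so up to finitely many
  functionals, since the singular term is compact relative to the energy
  (`MultiplierData.exists_weak_obs`).

Together they give exact observability for all those `T`
(`IsUnitaryGroup.Admissible.exists_le_obs`): the states invisible on `(0, s)` form spaces of finite
dimension that decrease in `s`; where the dimension does not jump, the space is invariant under the
group, hence invisible for a long time, hence zero. The time `T₀` of the theorem is larger than this
threshold.

By Hilbert's uniqueness method (`exists_control`), there is then an input `f` that brings the dual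
variable `ζ = (A_λ⁻¹ u_t, -u)` from any initial state to zero in time `T`. The curve `ζ` exists and
has the regularity of a transposition solution (`exists_controlled_curve`,
`Coeffs.isTranspositionSol_of_dual`). The defining identity determines `ζ T` by duality with
classical trajectories, which are dense, so every transposition solution is at rest at time `T`
(`Coeffs.eq_zero_of_isTranspositionSol`).
-/

namespace DegWave

noncomputable section

/-! ### The unitary group with a given inverse generator -/

section Group

variable {X : Type*} [NormedAddCommGroup X] [InnerProductSpace ℝ X]

/-- `S` is a strongly continuous group of isometries whose generator is `J⁻¹`. The generator is
described through its bounded inverse `J`, so that no unbounded operator is needed. -/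
structure IsUnitaryGroup (J : X →L[ℝ] X) (S : ℝ → X →L[ℝ] X) : Prop where
  zero : S 0 = 1
  add : ∀ s t, S (s + t) = S s * S t
  norm : ∀ t x, ‖S t x‖ = ‖x‖
  cont : ∀ x, Continuous fun t => S t x
  comm : ∀ t x, S t (J x) = J (S t x)
  deriv : ∀ x t, HasDerivAt (fun t => S t (J x)) (S t x) t

/-- `J` is skew-adjoint. -/
def IsSkew (J : X →L[ℝ] X) : Prop := ∀ x y, inner ℝ (J x) y = -inner ℝ x (J y)

theorem IsSkew.inner_self {J : X →L[ℝ] X} (h : IsSkew J) (x : X) : inner ℝ (J x) x = 0 := by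
  have h1 := h x x
  have h2 := real_inner_comm x (J x)
  linarith

theorem denseRange_of_inner_eq_zero {Y : Type*} [NormedAddCommGroup Y] [InnerProductSpace ℝ Y]
    [CompleteSpace X] (A : Y →L[ℝ] X) (h : ∀ y, (∀ x, inner ℝ (A x) y = 0) → y = 0) :
    DenseRange A := by
  have h1 : (LinearMap.range (A : Y →ₗ[ℝ] X)).topologicalClosure = ⊤ := by
    rw [Submodule.topologicalClosure_eq_top_iff, Submodule.eq_bot_iff]
    intro y hy
    refine h y fun x => ?_
    exact (Submodule.mem_orthogonal _ _).1 hy _ ⟨x, rfl⟩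
  have h2 := (Submodule.dense_iff_topologicalClosure_eq_top).2 h1
  simpa [DenseRange] using! h2

variable [CompleteSpace X]

theorem exp_add_of_commute_clm {A B : X →L[ℝ] X} (h : Commute A B) :
    NormedSpace.exp (A + B) = NormedSpace.exp A * NormedSpace.exp B := by
  let : NormedAlgebra ℚ (X →L[ℝ] X) := NormedAlgebra.restrictScalars ℚ ℝ _
  exact NormedSpace.exp_add_of_commute h

theorem hasDerivAt_exp_smul_apply {B : X →L[ℝ] X} (x : X) (t : ℝ) :
    HasDerivAt (fun t : ℝ => NormedSpace.exp (t • B) x) (NormedSpace.exp (t • B) (B x)) t := by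
  have h := (hasDerivAt_exp_smul_const (𝕂 := ℝ) B t)
  exact ((ContinuousLinearMap.apply ℝ X x).hasFDerivAt.comp_hasDerivAt t h)

theorem hasDerivAt_exp_smul_apply' {B : X →L[ℝ] X} (x : X) (t : ℝ) :
    HasDerivAt (fun t : ℝ => NormedSpace.exp (t • B) x) (B (NormedSpace.exp (t • B) x)) t := by
  have h := (hasDerivAt_exp_smul_const' (𝕂 := ℝ) B t)
  exact ((ContinuousLinearMap.apply ℝ X x).hasFDerivAt.comp_hasDerivAt t h)

theorem IsSkew.norm_exp {B : X →L[ℝ] X} (h : IsSkew B) (t : ℝ) (x : X) :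
    ‖NormedSpace.exp (t • B) x‖ = ‖x‖ := by
  have hd : ∀ t : ℝ, HasDerivAt (fun t : ℝ => inner ℝ (NormedSpace.exp (t • B) x)
      (NormedSpace.exp (t • B) x)) 0 t := by
    intro t
    have h1 := hasDerivAt_exp_smul_apply' (B := B) x t
    have h2 := h1.inner ℝ h1
    rw [real_inner_comm, h.inner_self, add_zero] at h2
    exact h2
  have hc := is_const_of_deriv_eq_zero (fun t => (hd t).differentiableAt)
    (fun t => (hd t).deriv) t 0
  simp only [zero_smul, NormedSpace.exp_zero, one_apply_eq_self,
    real_inner_self_eq_norm_sq] at hc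
  exact (sq_eq_sq₀ (norm_nonneg _) (norm_nonneg _)).1 hc

theorem IsSkew.norm_exp_sub_le {B : X →L[ℝ] X} (h : IsSkew B) (t : ℝ) (x : X) :
    ‖NormedSpace.exp (t • B) x - x‖ ≤ ‖B x‖ * |t| := by
  have := (convex_univ (𝕜 := ℝ) (E := ℝ)).norm_image_sub_le_of_norm_hasDerivWithin_le
    (f := fun t : ℝ => NormedSpace.exp (t • B) x) (C := ‖B x‖) (x := 0) (y := t)
    (fun s _ => (hasDerivAt_exp_smul_apply (B := B) x s).hasDerivWithinAt)
    (fun s _ => (h.norm_exp s (B x)).le) (mem_univ _) (mem_univ _)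
  simpa using this

theorem IsSkew.denseRange {J : X →L[ℝ] X} (h : IsSkew J) (hJ : Function.Injective J) :
    DenseRange J := by
  refine denseRange_of_inner_eq_zero J fun y hy => hJ ?_
  rw [map_zero]
  refine ext_inner_left ℝ fun x => ?_
  have := hy x
  rw [h] at this
  rw [inner_zero_right]
  linarith

/-- The resolvent `(ε - J²)⁻¹` of a skew-adjoint operator. -/
theorem IsSkew.exists_resolvent {J : X →L[ℝ] X} (h : IsSkew J) {ε : ℝ} (hε : 0 < ε) :
    ∃ G : X →L[ℝ] X, (∀ x, ε • G x - J (J (G x)) = x) ∧ ∀ x, G (ε • x - J (J x)) = x := by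
  let T : X →L[ℝ] X := ε • 1 - J * J
  let B : X →L[ℝ] X →L[ℝ] ℝ := (innerSL ℝ).comp T
  have hT : ∀ x, T x = ε • x - J (J x) := fun x => by simp [T]
  have hB : IsCoercive B := by
    refine ⟨ε, hε, fun x => ?_⟩
    have h1 : B x x = ε * (‖x‖ * ‖x‖) + inner ℝ (J x) (J x) := by
      simp only [B, ContinuousLinearMap.comp_apply, innerSL_apply_apply, hT, inner_sub_left,
        inner_smul_left, h (J x) x]
      rw [real_inner_self_eq_norm_mul_norm]
      simp
    rw [h1, mul_assoc]
    have := real_inner_self_nonneg (x := J x)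
    linarith
  have hL : ∀ v, hB.continuousLinearEquivOfBilin v = T v := fun v => by
    refine ext_inner_right ℝ fun w => ?_
    rw [hB.continuousLinearEquivOfBilin_apply]
    simp [B]
  refine ⟨hB.continuousLinearEquivOfBilin.symm, fun x => ?_, fun x => ?_⟩
  · have := hL (hB.continuousLinearEquivOfBilin.symm x)
    rw [ContinuousLinearEquiv.apply_symm_apply, hT] at this
    exact this.symm
  · rw [← hT, ← hL]
    exact hB.continuousLinearEquivOfBilin.symm_apply_apply x

/-- Bounded skew-adjoint approximations of `J⁻¹`, namely `Bₙ = -J (εₙ - J²)⁻¹`, which converge to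
`J⁻¹` on the range of `J`. -/
theorem IsSkew.exists_approx {J : X →L[ℝ] X} (h : IsSkew J) (hJ : Function.Injective J) :
    ∃ B : ℕ → X →L[ℝ] X, (∀ n, IsSkew (B n)) ∧ (∀ m n, Commute (B m) (B n)) ∧
      (∀ n, Commute (B n) J) ∧ (∀ n x, ‖B n (J x)‖ ≤ 2 * ‖x‖) ∧
      ∀ x, Tendsto (fun n => B n (J x)) atTop (𝓝 x) := by
  have hpos : ∀ n : ℕ, (0 : ℝ) < 1 / ((n : ℝ) + 1) := fun n => by positivity
  choose G hG1 hG2 using fun n => h.exists_resolvent (hpos n)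
  set e : ℕ → ℝ := fun n => 1 / ((n : ℝ) + 1) with he
  have hGJ : ∀ n x, G n (J x) = J (G n x) := fun n x => by
    rw [← hG2 n (J (G n x))]
    congr 1
    conv_lhs => rw [← hG1 n x]
    simp
  have hGG : ∀ m n x, G m (G n x) = G n (G m x) := fun m n x => by
    rw [← hG2 n (G m (G n x))]
    congr 1
    rw [← hGJ, ← hGJ, ← map_smul, ← map_sub, hG1]
  have hBJ : ∀ n x, -(J (G n (J x))) = x - e n • G n x := fun n x => by
    rw [hGJ]
    have := hG1 n x
    rw [eq_sub_iff_add_eq, neg_add_eq_sub]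
    exact this
  -- the energy identity of the resolvent, from which all bounds follow
  have hid : ∀ n x, e n * ‖G n x‖ ^ 2 + ‖J (G n x)‖ ^ 2 = inner ℝ x (G n x) := fun n x => by
    have h1 := congrArg (fun y => inner ℝ y (G n x)) (hG1 n x)
    simp only [inner_sub_left, real_inner_smul_left, real_inner_self_eq_norm_sq, h (J (G n x))] at h1
    linarith
  have hb : ∀ n x, ‖e n • G n x‖ ≤ ‖x‖ := fun n x => by
    have h1 := hid n x
    have h2 := real_inner_le_norm x (G n x)
    rw [norm_smul, Real.norm_of_nonneg (hpos n).le]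
    rcases (norm_nonneg (G n x)).eq_or_lt with h0 | h0
    · rw [← h0]; simp
    · refine le_of_mul_le_mul_right ?_ h0
      nlinarith [sq_nonneg ‖J (G n x)‖]
  have hconvJ : ∀ x, Tendsto (fun n => e n • G n (J x)) atTop (𝓝 0) := fun x => by
    have hsq : ∀ n, ‖e n • G n (J x)‖ ^ 2 ≤ e n * ‖x‖ ^ 2 := fun n => by
      have h1 := hid n (J x)
      rw [h] at h1
      have h2 := neg_le_of_abs_le (abs_real_inner_le_norm x (J (G n (J x))))
      have h3 : e n * ‖G n (J x)‖ ^ 2 ≤ ‖x‖ ^ 2 := by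
        nlinarith [sq_nonneg (‖J (G n (J x))‖ - ‖x‖), sq_nonneg ‖J (G n (J x))‖]
      rw [norm_smul, Real.norm_of_nonneg (hpos n).le, mul_pow, sq, mul_assoc]
      exact mul_le_mul_of_nonneg_left h3 (hpos n).le
    rw [tendsto_zero_iff_norm_tendsto_zero]
    have h4 : Tendsto (fun n => ‖e n • G n (J x)‖ ^ 2) atTop (𝓝 0) := by
      refine squeeze_zero (fun n => sq_nonneg _) hsq ?_
      have := (tendsto_one_div_add_atTop_nhds_zero_nat (𝕜 := ℝ)).mul_const (‖x‖ ^ 2)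
      rwa [zero_mul] at this
    have h5 := h4.sqrt
    simpa [Real.sqrt_sq] using h5
  have hdense := h.denseRange hJ
  have hconv : ∀ x, Tendsto (fun n => e n • G n x) atTop (𝓝 0) := fun x => by
    rw [Metric.tendsto_atTop]
    intro ε hε
    obtain ⟨y, hy⟩ := hdense.exists_dist_lt x (half_pos hε)
    obtain ⟨N, hN⟩ := Metric.tendsto_atTop.1 (hconvJ y) (ε / 2) (half_pos hε)
    refine ⟨N, fun n hn => ?_⟩
    have h1 := hN n hn
    rw [dist_zero_right] at h1 ⊢
    have h2 : e n • G n x = e n • G n (x - J y) + e n • G n (J y) := by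
      rw [map_sub, smul_sub]; abel
    rw [h2]
    have h3 := hb n (x - J y)
    rw [← dist_eq_norm] at h3
    exact (norm_add_le _ _).trans_lt (by linarith)
  refine ⟨fun n => -(J * G n), fun n x y => ?_, fun m n => ?_, fun n => ?_, fun n x => ?_, fun x => ?_⟩
  · obtain ⟨x', rfl⟩ : ∃ x', e n • x' - J (J x') = x := ⟨G n x, hG1 n x⟩
    obtain ⟨y', rfl⟩ : ∃ y', e n • y' - J (J y') = y := ⟨G n y, hG1 n y⟩
    have hx := hG2 n x'
    have hy := hG2 n y'
    change inner ℝ (-(J (G n _))) _ = -inner ℝ _ (-(J (G n _)))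
    rw [hx, hy]
    simp only [he, inner_sub_left, inner_sub_right, inner_smul_left, inner_smul_right, inner_neg_left,
      inner_neg_right, h x' (y'), h x' (J (J y')), h (J x') (J y')]
    simp
  · ext x
    simp [hGJ, hGG m n]
  · ext x
    simp [hGJ]
  · have h1 := hBJ n x
    change ‖-(J (G n (J x)))‖ ≤ _
    rw [h1]
    have := norm_sub_le x (e n • G n x)
    linarith [hb n x]
  · have h1 : (fun n => (-(J * G n)) (J x)) = fun n => x - e n • G n x := by
      funext n
      exact hBJ n x
    rw [h1]
    simpa using (tendsto_const_nhds (x := x)).sub (hconv x)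

/-- Stone's theorem, for a generator with bounded inverse `J`: the group is the limit of the
exponentials of bounded skew-adjoint approximations of `J⁻¹`. -/
theorem IsSkew.exists_group {J : X →L[ℝ] X} (h : IsSkew J) (hJ : Function.Injective J) :
    ∃ S : ℝ → X →L[ℝ] X, IsUnitaryGroup J S := by
  obtain ⟨B, hB, hcomm, hBJ, hbd, hlim⟩ := h.exists_approx hJ
  let U : ℕ → ℝ → X →L[ℝ] X := fun n t => NormedSpace.exp (t • B n)
  have hUn : ∀ n t x, ‖U n t x‖ = ‖x‖ := fun n t x => (hB n).norm_exp t x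
  -- The approximations commute, so `exp (t Bₘ) = exp (t Bₙ) exp (t (Bₘ - Bₙ))`.
  have hdiff : ∀ m n t x, ‖U m t x - U n t x‖ ≤ ‖B m x - B n x‖ * |t| := fun m n t x => by
    have hsk : IsSkew (B m - B n) := fun x y => by
      simp only [sub_apply, inner_sub_left, inner_sub_right, hB m x y,
        hB n x y]
      ring
    have h1 : t • B m = t • B n + t • (B m - B n) := by rw [smul_sub]; abel
    have h2 : Commute (t • B n) (t • (B m - B n)) :=
      (((hcomm n m).sub_right (Commute.refl _)).smul_right t).smul_left t
    have h3 : U m t = U n t * NormedSpace.exp (t • (B m - B n)) := by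
      simp only [U]
      rw [h1, exp_add_of_commute_clm h2]
    rw [h3]
    change ‖U n t _ - _‖ ≤ _
    rw [← map_sub, hUn]
    exact hsk.norm_exp_sub_le t x
  have hdense := h.denseRange hJ
  have hcauchy : ∀ t x, CauchySeq fun n => U n t x := fun t x => by
    rw [Metric.cauchySeq_iff']
    intro ε hε
    obtain ⟨y, hy⟩ := hdense.exists_dist_lt x (show 0 < ε / 4 by linarith)
    have h0 : 0 < ε / 4 / (|t| + 1) := by positivity
    obtain ⟨N, hN⟩ := Metric.cauchySeq_iff'.1 (hlim y).cauchySeq _ h0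
    refine ⟨N, fun n hn => ?_⟩
    have h1 := hN n hn
    rw [dist_eq_norm] at h1 hy ⊢
    have h2 : U n t x - U N t x = U n t (x - J y) + (U n t (J y) - U N t (J y))
        - U N t (x - J y) := by simp only [map_sub]; abel
    have h3 := hdiff n N t (J y)
    have h4 : ‖B n (J y) - B N (J y)‖ * |t| ≤ ε / 4 := by
      rw [lt_div_iff₀ (by positivity)] at h1
      nlinarith [norm_nonneg (B n (J y) - B N (J y)), abs_nonneg t]
    rw [h2]
    refine (norm_sub_le _ _).trans_lt ?_
    have h5 := norm_add_le (U n t (x - J y)) (U n t (J y) - U N t (J y))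
    rw [hUn] at h5 ⊢
    linarith
  choose L hL using fun t x => cauchySeq_tendsto_of_complete (hcauchy t x)
  let S : ℝ → X →L[ℝ] X := fun t => continuousLinearMapOfTendsto (U · t)
    (tendsto_pi_nhds.2 (hL t) : Tendsto (fun n x => U n t x) atTop (𝓝 (L t)))
  have hS : ∀ t x, Tendsto (fun n => U n t x) atTop (𝓝 (S t x)) := hL
  have hSn : ∀ t x, ‖S t x‖ = ‖x‖ := fun t x => by
    refine tendsto_nhds_unique (hS t x).norm ?_
    simp [hUn]
  have hSd : ∀ x s t, ‖S t (J x) - S s (J x)‖ ≤ 2 * ‖x‖ * |t - s| := fun x s t => by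
    refine le_of_tendsto ((hS t (J x)).sub (hS s (J x))).norm (Eventually.of_forall fun n => ?_)
    have h1 : U n t = U n s * U n (t - s) := by
      simp only [U]
      rw [← exp_add_of_commute_clm (((Commute.refl (B n)).smul_right _).smul_left _), ← add_smul]
      congr 2
      ring
    rw [h1]
    change ‖U n s _ - _‖ ≤ _
    rw [← map_sub, hUn]
    exact ((hB n).norm_exp_sub_le _ _).trans
      (mul_le_mul_of_nonneg_right (hbd n x) (abs_nonneg _))
  have hScont : ∀ x, Continuous fun t => S t x := fun x => by
    rw [Metric.continuous_iff]
    intro s ε hε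
    obtain ⟨y, hy⟩ := hdense.exists_dist_lt x (show 0 < ε / 4 by linarith)
    refine ⟨ε / 4 / (2 * ‖y‖ + 1), by positivity, fun t ht => ?_⟩
    rw [Real.dist_eq, lt_div_iff₀ (by positivity)] at ht
    rw [dist_eq_norm] at hy ⊢
    have h2 : S t x - S s x = S t (x - J y) + (S t (J y) - S s (J y)) - S s (x - J y) := by
      simp only [map_sub]; abel
    rw [h2]
    refine (norm_sub_le _ _).trans_lt ?_
    have h5 := norm_add_le (S t (x - J y)) (S t (J y) - S s (J y))
    rw [hSn] at h5 ⊢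
    have h6 := hSd y s t
    nlinarith [abs_nonneg (t - s)]
  -- The generator is identified through the integrated equation, which passes to the limit.
  have hSint : ∀ x t, S t (J x) - J x = ∫ s in (0 : ℝ)..t, S s x := fun x t => by
    have h1 : ∀ n, U n t (J x) - J x = ∫ s in (0 : ℝ)..t, U n s (B n (J x)) := fun n => by
      rw [intervalIntegral.integral_eq_sub_of_hasDerivAt
        (f := fun s => U n s (J x)) (fun s _ => hasDerivAt_exp_smul_apply (J x) s)]
      · simp [U]
      · refine Continuous.intervalIntegrable ?_ _ _
        exact continuous_iff_continuousAt.2 fun s =>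
          (hasDerivAt_exp_smul_apply (B := B n) (B n (J x)) s).continuousAt
    have h2 : Tendsto (fun n => ∫ s in (0 : ℝ)..t, U n s (B n (J x))) atTop
        (𝓝 (∫ s in (0 : ℝ)..t, S s x)) := by
      refine intervalIntegral.tendsto_integral_filter_of_dominated_convergence
        (fun _ => 2 * ‖x‖) (Eventually.of_forall fun n => ?_)
        (Eventually.of_forall fun n => Eventually.of_forall fun s _ => ?_)
        (by simp) (Eventually.of_forall fun s _ => ?_)
      · refine Continuous.aestronglyMeasurable ?_
        exact continuous_iff_continuousAt.2 fun s =>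
          (hasDerivAt_exp_smul_apply (B := B n) (B n (J x)) s).continuousAt
      · rw [hUn]
        exact hbd n x
      · have h3 : (fun n => U n s (B n (J x))) = fun n => U n s (B n (J x) - x) + U n s x := by
          funext n; rw [map_sub]; abel
        rw [h3]
        have h4 : Tendsto (fun n => U n s (B n (J x) - x)) atTop (𝓝 0) := by
          rw [tendsto_zero_iff_norm_tendsto_zero]
          simp only [hUn]
          rw [← tendsto_iff_norm_sub_tendsto_zero]
          exact hlim x
        simpa using h4.add (hS s x)
    refine tendsto_nhds_unique ((hS t (J x)).sub_const (J x)) ?_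
    simpa only [h1] using h2
  refine ⟨S, ?_, fun s t => ?_, hSn, hScont, fun t x => ?_, fun x t => ?_⟩
  · ext x
    refine tendsto_nhds_unique (hS 0 x) ?_
    simp [U]
  · ext x
    refine tendsto_nhds_unique (hS (s + t) x) ?_
    have h1 : ∀ n, U n (s + t) = U n s * U n t := fun n => by
      simp only [U]
      rw [← exp_add_of_commute_clm (((Commute.refl (B n)).smul_right _).smul_left _), ← add_smul]
    have h3 : (fun n => U n (s + t) x) = fun n => U n s (U n t x - S t x) + U n s (S t x) := by
      funext n; rw [h1, map_sub]; simp
    rw [h3]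
    have h4 : Tendsto (fun n => U n s (U n t x - S t x)) atTop (𝓝 0) := by
      rw [tendsto_zero_iff_norm_tendsto_zero]
      simp only [hUn]
      rw [← tendsto_iff_norm_sub_tendsto_zero]
      exact hS t x
    simpa using h4.add (hS s (S t x))
  · refine tendsto_nhds_unique (hS t (J x)) ?_
    have h1 : ∀ n, U n t (J x) = J (U n t x) := fun n => by
      have := ((hBJ n).smul_left t).exp_left
      exact congrArg (fun A : X →L[ℝ] X => A x) this.eq
    simp only [h1]
    exact (J.continuous.tendsto _).comp (hS t x)
  · have h1 : (fun t => S t (J x)) = fun t => J x + ∫ s in (0 : ℝ)..t, S s x := by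
      funext t
      rw [← hSint]; abel
    rw [h1]
    exact ((hScont x).integral_hasStrictDerivAt 0 t).hasDerivAt.const_add _

end Group

/-! ### Uniqueness of mild solutions -/

section Mild

variable {X : Type*} [NormedAddCommGroup X] [InnerProductSpace ℝ X] [CompleteSpace X]
  {J : X →L[ℝ] X} {S : ℝ → X →L[ℝ] X}

omit [CompleteSpace X] in
theorem IsUnitaryGroup.neg_apply_apply (hS : IsUnitaryGroup J S) (t : ℝ) (x : X) :
    S (-t) (S t x) = x := by
  have := hS.add (-t) t
  rw [neg_add_cancel, hS.zero] at this
  exact (congrArg (fun A : X →L[ℝ] X => A x) this).symm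

omit [CompleteSpace X] in
theorem IsUnitaryGroup.add_apply (hS : IsUnitaryGroup J S) (s t : ℝ) (x : X) :
    S (s + t) x = S s (S t x) := congrArg (fun A : X →L[ℝ] X => A x) (hS.add s t)

omit [CompleteSpace X] in
theorem IsUnitaryGroup.inner_apply (hS : IsUnitaryGroup J S) (t : ℝ) (x y : X) :
    inner ℝ (S t x) y = inner ℝ x (S (-t) y) := by
  have h1 : ∀ x y, inner ℝ (S t x) (S t y) = inner ℝ x y := fun x y => by
    have h2 := norm_add_sq_real (S t x) (S t y)
    rw [← map_add, hS.norm, hS.norm, hS.norm, norm_add_sq_real] at h2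
    linarith
  have h3 : S t (S (-t) y) = y := by simpa using hS.neg_apply_apply (-t) y
  rw [← h1 x, h3]

theorem hasDerivAt_integral_of_continuousOn_Ici {D : ℝ → X} (hD : ContinuousOn D (Ici 0)) {T t : ℝ}
    (hT : 0 ≤ T) (ht : 0 < t) : HasDerivAt (fun t => ∫ s in T..t, D s) (D t) t := by
  refine intervalIntegral.integral_hasDerivAt_right ?_ ?_ (hD.continuousAt (Ici_mem_nhds ht))
  · refine ContinuousOn.intervalIntegrable (hD.mono ?_)
    exact fun x hx => (le_min hT ht.le).trans hx.1
  · exact ContinuousOn.stronglyMeasurableAtFilter isOpen_Ioi (hD.mono Ioi_subset_Ici_self) t ht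

theorem IsSkew.eq_zero_of_integral_eq (h : IsSkew J) (hJ : Function.Injective J) {D : ℝ → X}
    (hD : ContinuousOn D (Ici 0)) {T : ℝ} (hT : 0 < T)
    (hint : ∀ t ∈ Ici (0 : ℝ), J (D t) = ∫ s in T..t, D s) : ∀ t ∈ Ici (0 : ℝ), D t = 0 := by
  set F : ℝ → X := fun t => ∫ s in T..t, D s with hF
  have hd : ∀ t ∈ Ioi (0 : ℝ), HasDerivAt F (D t) t := fun t ht =>
    hasDerivAt_integral_of_continuousOn_Ici hD hT.le ht
  have hd2 : ∀ t ∈ Ioi (0 : ℝ), HasDerivAt (fun t => inner ℝ (F t) (F t)) 0 t := fun t ht => by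
    have h1 := (hd t ht).inner ℝ (hd t ht)
    have h2 : F t = J (D t) := (hint t (Ioi_subset_Ici_self ht)).symm
    rw [real_inner_comm (F t) (D t), h2, h.inner_self, add_zero] at h1
    exact h1
  have hF0 : ∀ t ∈ Ioi (0 : ℝ), F t = 0 := fun t ht => by
    have h1 := isOpen_Ioi.is_const_of_deriv_eq_zero isPreconnected_Ioi
      (fun s hs => (hd2 s hs).differentiableAt.differentiableWithinAt)
      (fun s hs => (hd2 s hs).deriv) ht hT
    have h2 : F T = 0 := by simp [hF]
    simp only [h2, inner_zero_right] at h1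
    exact inner_self_eq_zero.1 h1
  have hD0 : ∀ t ∈ Ioi (0 : ℝ), D t = 0 := fun t ht => by
    refine hJ ?_
    rw [map_zero, hint t (Ioi_subset_Ici_self ht)]
    exact hF0 t ht
  intro t ht
  rcases (mem_Ici.1 ht).eq_or_lt with h0 | h0
  · refine hJ ?_
    rw [map_zero, hint t ht, ← h0]
    rw [intervalIntegral.integral_symm, intervalIntegral.integral_of_le hT.le,
      setIntegral_congr_fun measurableSet_Ioc (g := fun _ => (0 : X)) fun s hs => hD0 s hs.1]
    simp
  · exact hD0 t h0

theorem IsUnitaryGroup.integral_eq (hS : IsUnitaryGroup J S) (x : X) (s t : ℝ) :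
    ∫ r in s..t, S r x = S t (J x) - S s (J x) :=
  intervalIntegral.integral_eq_sub_of_hasDerivAt (fun r _ => hS.deriv x r)
    ((hS.cont x).intervalIntegrable _ _)

/-- Mild solutions are given by the group. The equation `J (W t - P) = ∫ W` is the one that defines
mild solutions, with the generator moved to the other side. -/
theorem IsUnitaryGroup.eq_of_mild (hS : IsUnitaryGroup J S) (h : IsSkew J)
    (hJ : Function.Injective J) {W : ℝ → X} (hW : ContinuousOn W (Ici 0)) {T : ℝ} (hT : 0 < T)
    {P : X} (hint : ∀ t ∈ Ici (0 : ℝ), J (W t - P) = ∫ s in T..t, W s) :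
    ∀ t ∈ Ici (0 : ℝ), W t = S (t - T) P := by
  have hc : Continuous fun t => S (t - T) P := (hS.cont P).comp (continuous_id.sub continuous_const)
  intro t ht
  refine sub_eq_zero.1 (h.eq_zero_of_integral_eq hJ (D := fun t => W t - S (t - T) P)
    (hW.sub hc.continuousOn) hT (fun t ht => ?_) t ht)
  have h1 : IntervalIntegrable W volume T t := by
    refine ContinuousOn.intervalIntegrable (hW.mono ?_)
    exact fun x hx => (le_min hT.le ht).trans hx.1
  rw [intervalIntegral.integral_sub h1 (hc.intervalIntegrable _ _), ← hint t ht,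
    intervalIntegral.integral_comp_sub_right (fun r => S r P), sub_self, hS.integral_eq,
    hS.comm, hS.zero]
  simp only [map_sub, one_apply_eq_self]
  abel

/-- A classical solution is `J W` for its derivative `W`, which is itself a mild solution. -/
theorem IsUnitaryGroup.eq_of_classical (hS : IsUnitaryGroup J S) (h : IsSkew J)
    (hJ : Function.Injective J) {U W : ℝ → X} (hW : ContinuousOn W (Ici 0))
    (hU : ∀ t ∈ Ici (0 : ℝ), HasDerivWithinAt U (W t) (Ici 0) t)
    (hUW : ∀ t ∈ Ici (0 : ℝ), U t = J (W t)) {T : ℝ} (hT : 0 < T) :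
    ∀ t ∈ Ici (0 : ℝ), W t = S (t - T) (W T) := by
  refine hS.eq_of_mild h hJ hW hT fun t ht => ?_
  rw [map_sub, ← hUW t ht, ← hUW T hT.le]
  have hsub : uIcc T t ⊆ Ici 0 := fun x hx => (le_min hT.le ht).trans hx.1
  refine (intervalIntegral.integral_eq_sub_of_hasDeriv_right
    (fun x hx => ((hU x (hsub hx)).continuousWithinAt).mono hsub) (fun x hx => ?_)
    ((hW.mono hsub).intervalIntegrable)).symm
  exact (hU x (hsub (Ioo_subset_Icc_self hx))).mono fun y hy =>
    (mem_Ici.1 (hsub (Ioo_subset_Icc_self hx))).trans (le_of_lt hy)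

end Mild

/-! ### Duality -/

/-- A functional that is bounded in terms of `‖G q‖` is represented through `G`; `G` need be neither
injective nor bounded. -/
theorem exists_inner_eq_of_le {X Y : Type*} [AddCommGroup X] [Module ℝ X]
    [NormedAddCommGroup Y] [InnerProductSpace ℝ Y] [CompleteSpace Y] (G : X →ₗ[ℝ] Y)
    (l : X →ₗ[ℝ] ℝ) {C : ℝ} (hC : 0 ≤ C) (h : ∀ q, |l q| ≤ C * ‖G q‖) :
    ∃ y : Y, ‖y‖ ≤ C ∧ ∀ q, l q = inner ℝ y (G q) := by
  have hb : ∃ C : ℝ, ∀ q, ‖l q‖ ≤ C * ‖G q‖ := ⟨C, h⟩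
  let L : StrongDual ℝ (LinearMap.range G) := l.compLeftInverse G
  have hL : ∀ q, L ⟨G q, q, rfl⟩ = l q := fun q => l.compLeftInverse_apply_of_bdd G hb q _ rfl
  have hLn : ‖L‖ ≤ C := by
    refine L.opNorm_le_bound hC ?_
    rintro ⟨_, q, rfl⟩
    rw [hL]
    exact h q
  obtain ⟨g, hg1, hg2⟩ := exists_extension_norm_eq (LinearMap.range G) L
  refine ⟨(InnerProductSpace.toDual ℝ Y).symm g, ?_, fun q => ?_⟩
  · rw [LinearIsometryEquiv.norm_map, hg2]
    exact hLn
  · rw [InnerProductSpace.toDual_symm_apply, ← hL]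
    exact (hg1 ⟨G q, q, rfl⟩).symm

/-! ### Observation of the group and construction of controls -/

section Control

variable {X : Type*} [NormedAddCommGroup X] [InnerProductSpace ℝ X]
  {J : X →L[ℝ] X} {S : ℝ → X →L[ℝ] X}

theorem memLp_indicator_Ioc_of_continuous {g : ℝ → ℝ} (hg : Continuous g) (a b : ℝ) :
    MemLp ((Ioc a b).indicator g) 2 volume := by
  rw [memLp_indicator_iff_restrict measurableSet_Ioc]
  obtain ⟨C, hC⟩ := isCompact_Icc.exists_bound_of_continuousOn (s := Icc a b) hg.continuousOn
  refine MemLp.of_bound hg.aestronglyMeasurable C ?_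
  filter_upwards [ae_restrict_mem measurableSet_Ioc] with x hx
  exact hC x (Ioc_subset_Icc_self hx)

theorem IsUnitaryGroup.continuous_observation (hS : IsUnitaryGroup J S) (ν : X →L[ℝ] ℝ) (q : X) :
    Continuous fun s => ν (S s q) := ν.continuous.comp (hS.cont q)

/-- The observation `s ↦ ν (S s q)` on the time interval `(a, b)`, extended by zero to `ℝ`. -/
def IsUnitaryGroup.obs (hS : IsUnitaryGroup J S) (ν : X →L[ℝ] ℝ) (a b : ℝ) :
    X →ₗ[ℝ] Lp ℝ 2 (volume : Measure ℝ) where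
  toFun q := (memLp_indicator_Ioc_of_continuous (hS.continuous_observation ν q) a b).toLp _
  map_add' p q := by
    rw [← MemLp.toLp_add]
    congr 1
    simp only [map_add]
    exact indicator_add _ _ _
  map_smul' c q := by
    rw [RingHom.id_apply, ← MemLp.toLp_const_smul]
    congr 1
    simp only [map_smul]
    exact indicator_const_smul _ _ _

theorem IsUnitaryGroup.inner_obs (hS : IsUnitaryGroup J S) (ν : X →L[ℝ] ℝ) {a b : ℝ}
    (hab : a ≤ b) (F : Lp ℝ 2 (volume : Measure ℝ)) (q : X) :
    inner ℝ F (hS.obs ν a b q) = ∫ s in a..b, F s * ν (S s q) := by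
  rw [L2.inner_def, intervalIntegral.integral_of_le hab, ← integral_indicator measurableSet_Ioc]
  refine integral_congr_ae ?_
  filter_upwards [(memLp_indicator_Ioc_of_continuous
    (hS.continuous_observation ν q) a b).coeFn_toLp] with s hs
  change inner ℝ (F s) (_ : ℝ) = _
  change (hS.obs ν a b q : ℝ → ℝ) s = _ at hs
  rw [hs]
  by_cases h : s ∈ Ioc a b
  · simp [h, mul_comm]
  · simp [h]

theorem IsUnitaryGroup.norm_obs_sq (hS : IsUnitaryGroup J S) (ν : X →L[ℝ] ℝ) {a b : ℝ}
    (hab : a ≤ b) (q : X) :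
    ‖hS.obs ν a b q‖ ^ 2 = ∫ s in a..b, ν (S s q) ^ 2 := by
  rw [← real_inner_self_eq_norm_sq, hS.inner_obs ν hab, intervalIntegral.integral_of_le hab,
    intervalIntegral.integral_of_le hab]
  refine integral_congr_ae ?_
  have h := (memLp_indicator_Ioc_of_continuous (hS.continuous_observation ν q) a b).coeFn_toLp
  filter_upwards [ae_restrict_mem measurableSet_Ioc, ae_restrict_of_ae h] with s hs hs'
  change (hS.obs ν a b q : ℝ → ℝ) s = _ at hs'
  rw [hs', indicator_of_mem hs, sq]

theorem IsUnitaryGroup.norm_obs_shift (hS : IsUnitaryGroup J S) (ν : X →L[ℝ] ℝ) {a b : ℝ}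
    (hab : a ≤ b) (h : ℝ) (q : X) :
    ‖hS.obs ν a b (S h q)‖ = ‖hS.obs ν (a + h) (b + h) q‖ := by
  rw [← sq_eq_sq₀ (norm_nonneg _) (norm_nonneg _), hS.norm_obs_sq ν hab,
    hS.norm_obs_sq ν (by linarith), ← intervalIntegral.integral_comp_add_right]
  simp only [hS.add_apply]

theorem IsUnitaryGroup.norm_obs_mono (hS : IsUnitaryGroup J S) (ν : X →L[ℝ] ℝ) {a b a' b' : ℝ}
    (ha : a' ≤ a) (hab : a ≤ b) (hb : b ≤ b') (q : X) :
    ‖hS.obs ν a b q‖ ≤ ‖hS.obs ν a' b' q‖ := by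
  rw [← sq_le_sq₀ (norm_nonneg _) (norm_nonneg _), hS.norm_obs_sq ν hab,
    hS.norm_obs_sq ν (by linarith)]
  refine intervalIntegral.integral_mono_interval ha hab hb
    (Eventually.of_forall fun s => sq_nonneg _) ?_
  exact ((hS.continuous_observation ν q).pow 2).intervalIntegrable _ _

/-- Translation `s ↦ f (s + t)` in `L²(ℝ)`. -/
def translate (f : Lp ℝ 2 (volume : Measure ℝ)) (t : ℝ) : Lp ℝ 2 (volume : Measure ℝ) :=
  Lp.compMeasurePreserving (fun s => s + t) (measurePreserving_add_right volume t) f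

theorem continuous_translate (f : Lp ℝ 2 (volume : Measure ℝ)) : Continuous (translate f) := by
  refine Continuous.compMeasurePreservingLp (f := fun _ : ℝ => f)
    (g := fun t => (⟨fun s => s + t, by fun_prop⟩ : C(ℝ, ℝ))) continuous_const ?_
    (fun t => measurePreserving_add_right volume t) (by simp)
  refine ContinuousMap.continuous_of_continuous_uncurry _ ?_
  change Continuous fun p : ℝ × ℝ => p.2 + p.1
  fun_prop

/-- The pairing of an input with the observation, on the fixed time interval `(-L, 0)`: the input is
translated, and its dependence on `t` is through `translate` alone. -/
theorem inner_translate_obs (hS : IsUnitaryGroup J S) (ν : X →L[ℝ] ℝ)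
    {f : ℝ → ℝ} (hf : MemLp f 2 volume) (hf0 : ∀ s ≤ 0, f s = 0) {t L : ℝ} (ht : 0 ≤ t)
    (hL : t ≤ L) (q : X) :
    inner ℝ (translate (hf.toLp f) t) (hS.obs ν (-L) 0 q) =
      ∫ s in (0 : ℝ)..t, f s * ν (S (s - t) q) := by
  rw [hS.inner_obs ν (by linarith)]
  have h1 : (translate (hf.toLp f) t : ℝ → ℝ) =ᵐ[volume] fun s => f (s + t) := by
    refine (Lp.coeFn_compMeasurePreserving _ _).trans ?_
    exact (measurePreserving_add_right volume t).quasiMeasurePreserving.ae_eq_comp hf.coeFn_toLp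
  have hint : ∀ a b : ℝ, IntervalIntegrable (fun s => f (s + t) * ν (S s q)) volume a b := by
    intro a b
    have h2 : MemLp (fun s => f (s + t)) 2 volume :=
      hf.comp_measurePreserving (measurePreserving_add_right volume t)
    have h3 : IntervalIntegrable (fun s => f (s + t)) volume a b := by
      rw [intervalIntegrable_iff]
      have : IsFiniteMeasure (volume.restrict (uIoc a b)) := ⟨by simp [uIoc]⟩
      exact (h2.restrict _).integrable (by norm_num)
    exact h3.mul_continuousOn (hS.continuous_observation ν q).continuousOn
  have h2 : ∫ s in (-L)..0, (translate (hf.toLp f) t : ℝ → ℝ) s * ν (S s q) =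
      ∫ s in (-L)..0, f (s + t) * ν (S s q) :=
    intervalIntegral.integral_congr_ae (by filter_upwards [h1] with s hs _; rw [hs])
  rw [h2, ← intervalIntegral.integral_add_adjacent_intervals (hint (-L) (-t)) (hint (-t) 0)]
  have h3 : ∫ s in (-L)..(-t), f (s + t) * ν (S s q) = 0 := by
    rw [intervalIntegral.integral_of_le (by linarith)]
    refine setIntegral_eq_zero_of_forall_eq_zero fun s hs => ?_
    rw [hf0 _ (by linarith [hs.2]), zero_mul]
  rw [h3, zero_add]
  have h4 := intervalIntegral.integral_comp_add_right (a := -t) (b := 0)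
    (fun s => f s * ν (S (s - t) q)) t
  simpa using h4

variable [CompleteSpace X]

omit [CompleteSpace X] in
theorem norm_le_of_inner_le (hd : DenseRange J) {y : X} {C : ℝ} (hC : 0 ≤ C)
    (h : ∀ q, |inner ℝ y (J q)| ≤ C * ‖J q‖) : ‖y‖ ≤ C := by
  have h1 : ∀ x, |inner ℝ y x| ≤ C * ‖x‖ := fun x =>
    hd.induction (P := fun x => |inner ℝ y x| ≤ C * ‖x‖) (by rintro _ ⟨q, rfl⟩; exact h q)
      (isClosed_le (by fun_prop) (by fun_prop)) x
  have h2 := h1 y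
  rw [real_inner_self_eq_norm_sq, abs_of_nonneg (sq_nonneg _), sq] at h2
  rcases (norm_nonneg y).eq_or_lt with h0 | h0
  · rwa [← h0]
  · exact le_of_mul_le_mul_right h2 h0

/-- Admissibility of the observation `ν ∘ J⁻¹`: on bounded time intervals the observation of a
trajectory is bounded, in `L²`, by the norm of the initial datum `J q`. -/
def IsUnitaryGroup.Admissible (hS : IsUnitaryGroup J S) (ν : X →L[ℝ] ℝ) : Prop :=
  ∀ L, 0 ≤ L → ∃ C, 0 ≤ C ∧ ∀ q, ‖hS.obs ν 0 L q‖ ≤ C * ‖J q‖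

omit [CompleteSpace X] in
theorem IsUnitaryGroup.Admissible.backward {hS : IsUnitaryGroup J S} {ν : X →L[ℝ] ℝ}
    (ha : hS.Admissible ν) {L : ℝ} (hL : 0 ≤ L) :
    ∃ C, 0 ≤ C ∧ ∀ q, ‖hS.obs ν (-L) 0 q‖ ≤ C * ‖J q‖ := by
  obtain ⟨C, hC, h⟩ := ha L hL
  refine ⟨C, hC, fun q => ?_⟩
  have h1 := hS.norm_obs_shift ν hL (-L) q
  rw [zero_add, add_neg_cancel] at h1
  rw [← h1]
  refine (h _).trans_eq ?_
  rw [← hS.comm, hS.norm]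

/-- The response of the system to a boundary input `f`: the state `Z t` is characterized by duality
with the observation. -/
theorem IsUnitaryGroup.Admissible.exists_response {hS : IsUnitaryGroup J S} {ν : X →L[ℝ] ℝ}
    (ha : hS.Admissible ν) (hd : DenseRange J) {f : ℝ → ℝ} (hf : MemLp f 2 volume)
    (hf0 : ∀ s ≤ 0, f s = 0) :
    ∃ Z : ℝ → X, ContinuousOn Z (Ici 0) ∧ ∀ t, 0 ≤ t → ∀ q,
      inner ℝ (Z t) (J q) = -∫ s in (0 : ℝ)..t, f s * ν (S (s - t) q) := by
  have hex : ∀ t, ∃ z : X, 0 ≤ t → ∀ q,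
      inner ℝ z (J q) = -∫ s in (0 : ℝ)..t, f s * ν (S (s - t) q) := by
    intro t
    by_cases ht : 0 ≤ t
    · obtain ⟨C, hC, hb⟩ := ha.backward ht
      obtain ⟨y, -, hy⟩ := exists_inner_eq_of_le (J : X →ₗ[ℝ] X)
        (-((innerₗ _ (translate (hf.toLp f) t)).comp (hS.obs ν (-t) 0)))
        (C := ‖translate (hf.toLp f) t‖ * C) (by positivity) (fun q => by
          change |-(inner ℝ (translate (hf.toLp f) t) (hS.obs ν (-t) 0 q))| ≤ _
          rw [abs_neg]
          refine (abs_real_inner_le_norm _ _).trans ?_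
          rw [mul_assoc]
          exact mul_le_mul_of_nonneg_left (hb q) (norm_nonneg _))
      refine ⟨y, fun _ q => ?_⟩
      rw [← inner_translate_obs hS ν hf hf0 ht le_rfl]
      exact (hy q).symm
    · exact ⟨0, fun h => absurd h ht⟩
  choose Z hZ using hex
  refine ⟨Z, fun t ht => ?_, hZ⟩
  have ht' : (0 : ℝ) ≤ t := ht
  obtain ⟨C, hC, hb⟩ := ha.backward (show 0 ≤ t + 1 by linarith)
  -- continuity of `Z` is reduced to the continuity of translation in `L²`
  have hlip : ∀ s ∈ Ico (0 : ℝ) (t + 1),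
      ‖Z s - Z t‖ ≤ ‖translate (hf.toLp f) s - translate (hf.toLp f) t‖ * C := fun s hs => by
    refine norm_le_of_inner_le hd (by positivity) fun q => ?_
    rw [inner_sub_left, hZ s hs.1, hZ t ht, ← inner_translate_obs hS ν hf hf0 hs.1 hs.2.le,
      ← inner_translate_obs hS ν hf hf0 ht' (by linarith : t ≤ t + 1), neg_sub_neg,
      ← inner_sub_left (𝕜 := ℝ), mul_assoc, norm_sub_rev]
    exact (abs_real_inner_le_norm _ _).trans
      (mul_le_mul_of_nonneg_left (hb q) (norm_nonneg _))
  refine ContinuousWithinAt.mono_of_mem_nhdsWithin (t := Ico 0 (t + 1)) ?_ ?_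
  · rw [ContinuousWithinAt, tendsto_iff_norm_sub_tendsto_zero]
    refine squeeze_zero' (Eventually.of_forall fun s => norm_nonneg _)
      (eventually_mem_nhdsWithin.mono hlip) ?_
    have h1 := ((continuous_translate (hf.toLp f)).tendsto t)
    have h2 := ((tendsto_iff_norm_sub_tendsto_zero.1 h1).mul_const C).mono_left
      (nhdsWithin_le_nhds (s := Ico 0 (t + 1)))
    rwa [zero_mul] at h2
  · rw [← Ici_inter_Iio]
    exact inter_mem_nhdsWithin _ (Iio_mem_nhds (by linarith))

omit [CompleteSpace X] in
theorem IsUnitaryGroup.integral_integral_swap (hS : IsUnitaryGroup J S) (ν : X →L[ℝ] ℝ)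
    {f : ℝ → ℝ} (hf : MemLp f 2 volume) {T : ℝ} (hT : 0 ≤ T) (q : X) :
    ∫ s in (0 : ℝ)..T, ∫ t in (0 : ℝ)..s, f t * ν (S (t - s) q) =
      ∫ t in (0 : ℝ)..T, f t * ∫ s in t..T, ν (S (t - s) q) := by
  let g : ℝ → ℝ → ℝ := fun s t => (Iic s).indicator (fun t => f t * ν (S (t - s) q)) t
  have h1 : ∫ s in (0 : ℝ)..T, ∫ t in (0 : ℝ)..s, f t * ν (S (t - s) q) =
      ∫ s in Ioc 0 T, ∫ t in Ioc 0 T, g s t := by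
    rw [intervalIntegral.integral_of_le hT]
    refine setIntegral_congr_fun measurableSet_Ioc fun s hs => ?_
    simp only [g]
    rw [setIntegral_indicator measurableSet_Iic, intervalIntegral.integral_of_le hs.1.le]
    congr 2
    ext x
    simp only [mem_Ioc, mem_inter_iff, mem_Iic]
    exact ⟨fun h => ⟨⟨h.1, h.2.trans hs.2⟩, h.2⟩, fun h => ⟨h.1.1, h.2⟩⟩
  have h2 : ∫ t in (0 : ℝ)..T, f t * ∫ s in t..T, ν (S (t - s) q) =
      ∫ t in Ioc 0 T, ∫ s in Ioc 0 T, g s t := by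
    rw [intervalIntegral.integral_of_le hT]
    refine setIntegral_congr_fun measurableSet_Ioc fun t ht => ?_
    have h3 : ∀ s, g s t = (Ici t).indicator (fun s => f t * ν (S (t - s) q)) s := fun s => by
      simp only [g, indicator, mem_Iic, mem_Ici]
    simp only [h3]
    rw [setIntegral_indicator measurableSet_Ici, ← intervalIntegral.integral_const_mul,
      intervalIntegral.integral_of_le ht.2, ← integral_Icc_eq_integral_Ioc]
    congr 2
    ext x
    simp only [mem_Icc, mem_inter_iff, mem_Ici, mem_Ioc]
    exact ⟨fun h => ⟨⟨ht.1.trans_le h.1, h.2⟩, h.1⟩, fun h => ⟨h.2, h.1.2⟩⟩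
  rw [h1, h2]
  refine MeasureTheory.integral_integral_swap ?_
  have hfi : Integrable f (volume.restrict (Ioc 0 T)) := (hf.restrict _).integrable (by norm_num)
  have hb : Integrable (fun p : ℝ × ℝ => ‖ν‖ * ‖q‖ * f p.2)
      ((volume.restrict (Ioc 0 T)).prod (volume.restrict (Ioc 0 T))) :=
    (hfi.comp_snd _).const_mul _
  have hset : Function.uncurry g =
      {p : ℝ × ℝ | p.2 ≤ p.1}.indicator (fun p => f p.2 * ν (S (p.2 - p.1) q)) := by
    ext p
    simp only [Function.uncurry, g, indicator, mem_Iic, mem_ofPred_eq]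
  rw [hset]
  refine hb.mono ?_ (Eventually.of_forall fun p => ?_)
  · refine AEStronglyMeasurable.indicator ?_ (measurableSet_le measurable_snd measurable_fst)
    refine (hfi.comp_snd _).aestronglyMeasurable.mul ?_
    exact ((hS.continuous_observation ν q).comp
      (continuous_snd.sub continuous_fst)).aestronglyMeasurable
  · refine (norm_indicator_le_norm_self _ _).trans ?_
    rw [norm_mul, norm_mul, mul_comm]
    refine mul_le_mul_of_nonneg_right ?_ (norm_nonneg _)
    refine (ν.le_opNorm _).trans_eq ?_
    rw [hS.norm, norm_mul, norm_norm, norm_norm]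

/-- The integrated equation of motion of the response. -/
theorem IsUnitaryGroup.response_eq (hS : IsUnitaryGroup J S) (hsk : IsSkew J)
    (hd : DenseRange J) {n : X} {f : ℝ → ℝ} (hf : MemLp f 2 volume)
    {Z : ℝ → X} (hZc : ContinuousOn Z (Ici 0)) (hZ : ∀ t, 0 ≤ t → ∀ q,
      inner ℝ (Z t) (J q) = -∫ s in (0 : ℝ)..t, f s * innerSL ℝ n (S (s - t) q))
    {T : ℝ} (hT : 0 ≤ T) :
    J (Z T) = (∫ s in (0 : ℝ)..T, Z s) + (∫ s in (0 : ℝ)..T, f s) • n := by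
  have hfi : ∀ g : ℝ → ℝ, Continuous g →
      IntervalIntegrable (fun s => f s * g s) volume 0 T := fun g hg => by
    have h3 : IntervalIntegrable f volume 0 T := by
      rw [intervalIntegrable_iff]
      have : IsFiniteMeasure (volume.restrict (uIoc 0 T)) := ⟨by simp [uIoc]⟩
      exact (hf.restrict _).integrable (by norm_num)
    exact h3.mul_continuousOn hg.continuousOn
  have hkey : ∀ q, inner ℝ (J (Z T)) (J q) =
      inner ℝ ((∫ s in (0 : ℝ)..T, Z s) + (∫ s in (0 : ℝ)..T, f s) • n) (J q) := fun q => by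
    have hZi : IntervalIntegrable Z volume 0 T :=
      (hZc.mono (by rw [uIcc_of_le hT]; exact Icc_subset_Ici_self)).intervalIntegrable
    have h1 : inner ℝ (∫ s in (0 : ℝ)..T, Z s) (J q) = ∫ s in (0 : ℝ)..T, inner ℝ (Z s) (J q) := by
      have := (innerSL ℝ (J q)).intervalIntegral_comp_comm hZi
      simp only [innerSL_apply_apply] at this
      rw [real_inner_comm, ← this]
      simp only [real_inner_comm]
    have h2 : ∫ s in (0 : ℝ)..T, inner ℝ (Z s) (J q) =
        -∫ s in (0 : ℝ)..T, ∫ t in (0 : ℝ)..s, f t * innerSL ℝ n (S (t - s) q) := by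
      rw [← intervalIntegral.integral_neg]
      refine intervalIntegral.integral_congr fun s hs => ?_
      rw [uIcc_of_le hT] at hs
      exact hZ s hs.1 q
    have h3 : ∀ t, ∫ s in t..T, innerSL ℝ n (S (t - s) q) =
        innerSL ℝ n (J q) - innerSL ℝ n (S (t - T) (J q)) := fun t => by
      rw [intervalIntegral.integral_comp_sub_left (fun r => innerSL ℝ n (S r q)),
        (innerSL ℝ n).intervalIntegral_comp_comm ((hS.cont q).intervalIntegrable _ _),
        hS.integral_eq, sub_self, hS.zero, ← map_sub]
      rfl
    rw [inner_add_left, h1, h2, hS.integral_integral_swap _ hf hT, hsk, hZ T hT]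
    simp only [h3, mul_sub]
    rw [intervalIntegral.integral_sub (hfi _ continuous_const) (hfi _ ?_),
      intervalIntegral.integral_mul_const, real_inner_smul_left]
    · simp
    · exact (hS.continuous_observation (innerSL ℝ n) (J q)).comp
        (continuous_id.sub continuous_const)
  have h0 := norm_le_of_inner_le hd (y := J (Z T) - ((∫ s in (0 : ℝ)..T, Z s) +
    (∫ s in (0 : ℝ)..T, f s) • n)) le_rfl fun q => by rw [inner_sub_left, hkey]; simp
  exact sub_eq_zero.1 (norm_le_zero_iff.1 h0)

omit [CompleteSpace X] in
/-- Hilbert's uniqueness method: if the observation on `(0, T)` is bounded below, then every state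
is the response at time `T` to some input. -/
theorem IsUnitaryGroup.exists_input (hS : IsUnitaryGroup J S) {ν : X →L[ℝ] ℝ} {T C : ℝ}
    (hT : 0 ≤ T) (hC : 0 ≤ C) (hobs : ∀ q, ‖J q‖ ≤ C * ‖hS.obs ν 0 T q‖) (z : X) :
    ∃ f : Lp ℝ 2 (volume : Measure ℝ), ∀ q,
      inner ℝ z (J q) = -∫ s in (0 : ℝ)..T, f s * ν (S (s - T) q) := by
  obtain ⟨f, -, hf⟩ := exists_inner_eq_of_le (hS.obs ν 0 T)
    (-((innerₗ _ z).comp ((S T).comp J : X →ₗ[ℝ] X))) (C := ‖z‖ * C) (by positivity) (fun q => by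
      simp only [LinearMap.neg_apply, LinearMap.comp_apply, abs_neg]
      refine (abs_real_inner_le_norm _ _).trans ?_
      rw [mul_assoc]
      refine mul_le_mul_of_nonneg_left ?_ (norm_nonneg _)
      change ‖S T (J q)‖ ≤ _
      rw [hS.norm]
      exact hobs q)
  refine ⟨f, fun q => ?_⟩
  have h1 := hf (S (-T) q)
  rw [hS.inner_obs ν hT] at h1
  have h2 : S T (J (S (-T) q)) = J q := by
    rw [← hS.comm]
    simpa using hS.neg_apply_apply (-T) (J q)
  have h3 : ∀ s, S s (S (-T) q) = S (s - T) q := fun s => by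
    rw [← hS.add_apply, sub_eq_add_neg]
  simp only [h3] at h1
  rw [← h1]
  change _ = - -(inner ℝ z (S T (J (S (-T) q))))
  rw [h2, neg_neg]

end Control

/-! ### Observability by compactness and uniqueness -/

section Observability

/-- An injective operator that is bounded below up to a term of finite rank is bounded below. -/
theorem exists_norm_le_of_injective {X Y : Type*} [NormedAddCommGroup X] [NormedSpace ℝ X]
    [CompleteSpace X] [NormedAddCommGroup Y] [NormedSpace ℝ Y] {A : X →L[ℝ] Y}
    (hA : ∀ x, A x = 0 → x = 0) {k : ℕ} (F : X →L[ℝ] (Fin k → ℝ)) {C : ℝ}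
    (h : ∀ x, ‖x‖ ≤ C * (‖A x‖ + ‖F x‖)) : ∃ C', 0 ≤ C' ∧ ∀ x, ‖x‖ ≤ C' * ‖A x‖ := by
  by_contra! hcon
  have h1 : ∀ n : ℕ, ∃ x, ‖x‖ = 1 ∧ ‖A x‖ ≤ 1 / ((n : ℝ) + 1) := fun n => by
    obtain ⟨x, hx⟩ := hcon ((n : ℝ) + 1) (by positivity)
    have hx0 : 0 < ‖x‖ := lt_of_le_of_lt (by positivity) hx
    refine ⟨‖x‖⁻¹ • x, ?_, ?_⟩
    · rw [norm_smul, norm_inv, norm_norm, inv_mul_cancel₀ hx0.ne']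
    · rw [map_smul, norm_smul, norm_inv, norm_norm, le_div_iff₀ (by positivity),
        mul_assoc, inv_mul_le_iff₀ hx0]
      linarith
  choose x hx1 hx2 using h1
  have hAx : Tendsto (fun n => ‖A (x n)‖) atTop (𝓝 0) :=
    squeeze_zero (fun n => norm_nonneg _) hx2 tendsto_one_div_add_atTop_nhds_zero_nat
  obtain ⟨y, -, φ, hφ, hy⟩ := tendsto_subseq_of_bounded (s := Metric.closedBall 0 ‖F‖)
    Metric.isBounded_closedBall (x := fun n => F (x n)) fun n => by
      rw [mem_closedBall_zero_iff]
      exact (F.le_opNorm _).trans_eq (by rw [hx1, mul_one])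
  have hcau : CauchySeq fun n => x (φ n) := by
    rw [Metric.cauchySeq_iff]
    intro ε hε
    have hAφ := hAx.comp hφ.tendsto_atTop
    have hδ : 0 < ε / (3 * (|C| + 1)) := by positivity
    obtain ⟨N1, hN1⟩ := Metric.tendsto_atTop.1 hAφ _ hδ
    obtain ⟨N2, hN2⟩ := Metric.cauchySeq_iff.1 hy.cauchySeq _ hδ
    refine ⟨max N1 N2, fun m hm n hn => ?_⟩
    have a1 := hN1 m (le_of_max_le_left hm)
    have a2 := hN1 n (le_of_max_le_left hn)
    have a3 := hN2 m (le_of_max_le_right hm) n (le_of_max_le_right hn)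
    simp only [Function.comp_apply, dist_zero_right, norm_norm] at a1 a2 a3
    rw [dist_eq_norm] at a3 ⊢
    have a4 := h (x (φ m) - x (φ n))
    rw [map_sub, map_sub] at a4
    have a5 := norm_sub_le (A (x (φ m))) (A (x (φ n)))
    have a6 : ‖A (x (φ m)) - A (x (φ n))‖ + ‖F (x (φ m)) - F (x (φ n))‖ <
        3 * (ε / (3 * (|C| + 1))) := by linarith
    have a7 : 3 * (ε / (3 * (|C| + 1))) * (|C| + 1) = ε := by field_simp
    have a8 : 0 ≤ ‖A (x (φ m)) - A (x (φ n))‖ + ‖F (x (φ m)) - F (x (φ n))‖ := by positivity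
    nlinarith [le_abs_self C, abs_nonneg C]
  obtain ⟨z, hz⟩ := cauchySeq_tendsto_of_complete hcau
  have hz1 : ‖z‖ = 1 := by
    refine tendsto_nhds_unique hz.norm ?_
    simp [hx1]
  have hz2 : A z = 0 := by
    rw [← norm_eq_zero]
    exact tendsto_nhds_unique ((A.continuous.tendsto _).comp hz).norm (hAx.comp hφ.tendsto_atTop)
  rw [hA z hz2, norm_zero] at hz1
  exact zero_ne_one hz1

variable {X : Type*} [NormedAddCommGroup X] [InnerProductSpace ℝ X]
  {J : X →L[ℝ] X} {S : ℝ → X →L[ℝ] X}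

/-- The observation on `(0, L)` as a function of the initial datum `J q`, extended by continuity to
all data of finite energy. -/
def IsUnitaryGroup.trace (hS : IsUnitaryGroup J S) (ν : X →L[ℝ] ℝ) (L : ℝ) :
    X →L[ℝ] Lp ℝ 2 (volume : Measure ℝ) :=
  (hS.obs ν 0 L).extendOfNorm (J : X →ₗ[ℝ] X)

variable {hS : IsUnitaryGroup J S} {ν : X →L[ℝ] ℝ}

theorem IsUnitaryGroup.Admissible.trace_apply (ha : hS.Admissible ν) (hd : DenseRange J) {L : ℝ}
    (hL : 0 ≤ L) (q : X) : hS.trace ν L (J q) = hS.obs ν 0 L q := by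
  obtain ⟨C, -, hC⟩ := ha L hL
  exact LinearMap.extendOfNorm_eq (e := (J : X →ₗ[ℝ] X)) hd ⟨C, hC⟩ q

theorem IsUnitaryGroup.Admissible.norm_trace_mono (ha : hS.Admissible ν) (hd : DenseRange J)
    {L L' : ℝ} (hL : 0 ≤ L) (hLL : L ≤ L') (p : X) :
    ‖hS.trace ν L p‖ ≤ ‖hS.trace ν L' p‖ := by
  refine hd.induction (P := fun p => ‖hS.trace ν L p‖ ≤ ‖hS.trace ν L' p‖) ?_
    (isClosed_le (by fun_prop) (by fun_prop)) p
  rintro _ ⟨q, rfl⟩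
  rw [ha.trace_apply hd hL, ha.trace_apply hd (hL.trans hLL)]
  exact hS.norm_obs_mono ν le_rfl hL hLL q

theorem IsUnitaryGroup.Admissible.norm_trace_shift_le (ha : hS.Admissible ν) (hd : DenseRange J)
    {L h : ℝ} (hL : 0 ≤ L) (hh : 0 ≤ h) (p : X) :
    ‖hS.trace ν L (S h p)‖ ≤ ‖hS.trace ν (L + h) p‖ := by
  refine hd.induction (P := fun p => ‖hS.trace ν L (S h p)‖ ≤ ‖hS.trace ν (L + h) p‖) ?_
    (isClosed_le (by fun_prop) (by fun_prop)) p
  rintro _ ⟨q, rfl⟩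
  rw [hS.comm, ha.trace_apply hd hL, ha.trace_apply hd (by linarith), hS.norm_obs_shift ν hL]
  exact hS.norm_obs_mono ν (by linarith) (by linarith) le_rfl q

theorem IsUnitaryGroup.Admissible.norm_trace_add_le (ha : hS.Admissible ν) (hd : DenseRange J)
    {L h : ℝ} (hL : 0 ≤ L) (hh : 0 ≤ h) (p : X) :
    ‖hS.trace ν (L + h) p‖ ≤ ‖hS.trace ν h p‖ + ‖hS.trace ν L (S h p)‖ := by
  refine hd.induction (P := fun p => ‖hS.trace ν (L + h) p‖ ≤
    ‖hS.trace ν h p‖ + ‖hS.trace ν L (S h p)‖) ?_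
    (isClosed_le (by fun_prop) (by fun_prop)) p
  rintro _ ⟨q, rfl⟩
  rw [hS.comm, ha.trace_apply hd hL, ha.trace_apply hd (by linarith), ha.trace_apply hd hh,
    hS.norm_obs_shift ν hL]
  refine abs_le_of_sq_le_sq' ?_ (by positivity) |>.2
  have h1 := hS.norm_obs_sq ν (show (0 : ℝ) ≤ L + h by linarith) q
  have h2 := hS.norm_obs_sq ν hh q
  have h3 := hS.norm_obs_sq ν (show 0 + h ≤ L + h by linarith) q
  have hi : ∀ a b : ℝ, IntervalIntegrable (fun s => ν (S s q) ^ 2) volume a b := fun a b =>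
    ((hS.continuous_observation ν q).pow 2).intervalIntegrable _ _
  rw [zero_add] at h3 ⊢
  rw [← intervalIntegral.integral_add_adjacent_intervals (hi 0 h) (hi h (L + h)), ← h2, ← h3] at h1
  rw [h1]
  nlinarith [norm_nonneg (hS.obs ν 0 h q), norm_nonneg (hS.obs ν h (L + h) q)]

variable [CompleteSpace X]

/-- If the observation controls the energy up to finitely many functionals for all times beyond
`T₁`, and controls it completely for some time, however long, then it controls the energy for all
times beyond `T₁`. The kernels of the observation on `(0, s)` are finite-dimensional and decrease
with `s`, so two of them coincide; that kernel is invariant under the group, hence is invisible for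
all times, hence is zero. -/
theorem IsUnitaryGroup.Admissible.exists_le_obs (ha : hS.Admissible ν) (hd : DenseRange J) {T₁ : ℝ}
    (hT₁ : 0 ≤ T₁)
    (hweak : ∀ T, T₁ < T → ∃ (C : ℝ) (k : ℕ) (F : X →L[ℝ] (Fin k → ℝ)), ∀ q,
      ‖J q‖ ≤ C * (‖hS.obs ν 0 T q‖ + ‖F (J q)‖))
    (hlong : ∃ L C, 0 ≤ L ∧ ∀ q, ‖J q‖ ≤ C * ‖hS.obs ν 0 L q‖) {T : ℝ} (hT : T₁ < T) :
    ∃ C, 0 ≤ C ∧ ∀ q, ‖J q‖ ≤ C * ‖hS.obs ν 0 T q‖ := by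
  have hweak' : ∀ T, T₁ < T → ∃ (C : ℝ) (k : ℕ) (F : X →L[ℝ] (Fin k → ℝ)), ∀ p,
      ‖p‖ ≤ C * (‖hS.trace ν T p‖ + ‖F p‖) := fun T hT => by
    obtain ⟨C, k, F, h⟩ := hweak T hT
    refine ⟨C, k, F, fun p => ?_⟩
    refine hd.induction (P := fun p => ‖p‖ ≤ C * (‖hS.trace ν T p‖ + ‖F p‖)) ?_
      (isClosed_le (by fun_prop) (by fun_prop)) p
    rintro _ ⟨q, rfl⟩
    rw [ha.trace_apply hd (hT₁.trans hT.le)]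
    exact h q
  obtain ⟨L, CL, hL, hlong⟩ := hlong
  have hlong' : ∀ p, ‖p‖ ≤ CL * ‖hS.trace ν L p‖ := fun p => by
    refine hd.induction (P := fun p => ‖p‖ ≤ CL * ‖hS.trace ν L p‖) ?_
      (isClosed_le (by fun_prop) (by fun_prop)) p
    rintro _ ⟨q, rfl⟩
    rw [ha.trace_apply hd hL]
    exact hlong q
  let N : ℝ → Submodule ℝ X := fun s => LinearMap.ker (hS.trace ν s).toLinearMap
  have hN : ∀ s p, p ∈ N s ↔ hS.trace ν s p = 0 := fun s p => LinearMap.mem_ker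
  have hfin : ∀ s, T₁ < s → FiniteDimensional ℝ (N s) := fun s hs => by
    obtain ⟨C, k, F, h⟩ := hweak' s hs
    refine FiniteDimensional.of_injective (F.toLinearMap.comp (N s).subtype)
      ((injective_iff_map_eq_zero _).2 fun p hp => ?_)
    have h1 := h p
    have h2 : F (p : X) = 0 := hp
    rw [(hN s p).1 p.2, h2, norm_zero, norm_zero, add_zero, mul_zero] at h1
    exact Subtype.ext (norm_le_zero_iff.1 h1)
  have hmono : ∀ s s', 0 ≤ s → s ≤ s' → N s' ≤ N s := fun s s' hs hss p hp => by
    rw [hN] at hp ⊢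
    have h1 := ha.norm_trace_mono hd hs hss p
    rw [hp, norm_zero] at h1
    exact norm_le_zero_iff.1 h1
  -- a kernel of minimal dimension: the kernels for slightly larger times coincide with it
  obtain ⟨s₁, ⟨hs₁, hs₁T⟩, hmin⟩ : ∃ s₁ ∈ Ioo T₁ T, ∀ s ∈ Ioo T₁ T,
      Module.finrank ℝ (N s₁) ≤ Module.finrank ℝ (N s) := by
    have hne : ((fun s => Module.finrank ℝ (N s)) '' Ioo T₁ T).Nonempty :=
      (nonempty_Ioo.2 hT).image _
    obtain ⟨s₁, h1, h2⟩ := Nat.sInf_mem hne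
    exact ⟨s₁, h1, fun s hs => by
      exact h2.trans_le <| Nat.sInf_le (mem_image_of_mem _ hs)⟩
  have hs₁0 : 0 < s₁ := hT₁.trans_lt hs₁
  set s₂ := (s₁ + T) / 2 with hs₂
  have heq : N s₂ = N s₁ := by
    have := hfin s₁ hs₁
    exact Submodule.eq_of_le_of_finrank_le (hmono s₁ s₂ hs₁0.le (by linarith))
      (hmin s₂ ⟨by linarith, by linarith⟩)
  obtain ⟨h, hh0, hh1, hh2⟩ : ∃ h, 0 < h ∧ h ≤ s₁ ∧ s₁ + h ≤ s₂ :=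
    ⟨min s₁ (s₂ - s₁), lt_min hs₁0 (by linarith), min_le_left _ _, by
      linarith [min_le_right s₁ (s₂ - s₁)]⟩
  have hinv : ∀ p ∈ N s₁, S h p ∈ N s₁ := fun p hp => by
    rw [← heq] at hp
    have hp' := hmono (s₁ + h) s₂ (by linarith) hh2 hp
    rw [hN] at hp' ⊢
    have h1 := ha.norm_trace_shift_le hd hs₁0.le hh0.le p
    rw [hp', norm_zero] at h1
    exact norm_le_zero_iff.1 h1
  -- each step of the induction uses invariance and lengthens the time interval by `h`
  have hall : ∀ k : ℕ, ∀ p ∈ N s₁, p ∈ N (s₁ + k * h) := fun k => by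
    induction k with
    | zero => intro p hp; simpa using hp
    | succ k ih =>
      intro p hp
      have h1 := (hN _ _).1 (ih _ (hinv p hp))
      have h2 := (hN _ _).1 (hmono h s₁ hh0.le hh1 hp)
      have h3 := ha.norm_trace_add_le hd (L := s₁ + k * h) (by positivity) hh0.le p
      rw [h1, h2, norm_zero, add_zero] at h3
      rw [hN, Nat.cast_succ, add_mul, one_mul, ← add_assoc]
      exact norm_le_zero_iff.1 h3
  have hzero : ∀ p ∈ N s₁, p = 0 := fun p hp => by
    obtain ⟨k, hk⟩ := exists_nat_ge (L / h)
    have h1 : L ≤ s₁ + k * h := by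
      rw [div_le_iff₀ hh0] at hk
      linarith
    have h2 := (hN _ _).1 (hmono L _ hL h1 (hall k p hp))
    have h3 := hlong' p
    rw [h2, norm_zero, mul_zero] at h3
    exact norm_le_zero_iff.1 h3
  obtain ⟨C, k, F, hF⟩ := hweak' T hT
  obtain ⟨C', hC', h⟩ := exists_norm_le_of_injective (A := hS.trace ν T)
    (fun p hp => hzero p (hmono s₁ T hs₁0.le hs₁T.le hp)) F hF
  refine ⟨C', hC', fun q => ?_⟩
  rw [← ha.trace_apply hd (hT₁.trans hT.le)]
  exact h (J q)

end Observability

/-! ### The wave equation as a first order system, and the multiplier method -/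

section Wave

variable {V H : Type*} [NormedAddCommGroup V] [InnerProductSpace ℝ V] [CompleteSpace V]
  [NormedAddCommGroup H] [InnerProductSpace ℝ H] [CompleteSpace H]

/-- The inverse of the wave operator `(y, z) ↦ (z, A y)` on `V × H`, where `V` carries the energy
inner product and `A⁻¹ = -ι†` for the embedding `ι : V → H`. -/
def waveInv (ι : V →L[ℝ] H) : WithLp 2 (V × H) →L[ℝ] WithLp 2 (V × H) :=
  (WithLp.prodContinuousLinearEquiv 2 ℝ V H).symm.toContinuousLinearMap.comp
    ((-(ι.adjoint.comp (WithLp.sndL 2 ℝ V H))).prod (ι.comp (WithLp.fstL 2 ℝ V H)))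

theorem waveInv_fst (ι : V →L[ℝ] H) (p : WithLp 2 (V × H)) :
    (waveInv ι p).fst = -ι.adjoint p.snd := rfl

theorem waveInv_snd (ι : V →L[ℝ] H) (p : WithLp 2 (V × H)) :
    (waveInv ι p).snd = ι p.fst := rfl

theorem isSkew_waveInv (ι : V →L[ℝ] H) : IsSkew (waveInv ι) := fun x y => by
  rw [WithLp.prod_inner_apply, WithLp.prod_inner_apply]
  change inner ℝ (-ι.adjoint x.snd) y.fst + inner ℝ (ι x.fst) y.snd =
    -(inner ℝ x.fst (-ι.adjoint y.snd) + inner ℝ x.snd (ι y.fst))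
  rw [inner_neg_left, inner_neg_right, ContinuousLinearMap.adjoint_inner_left,
    ContinuousLinearMap.adjoint_inner_right]
  ring

theorem adjoint_injective_of_denseRange {ι : V →L[ℝ] H} (hd : DenseRange ι) :
    Function.Injective ι.adjoint := by
  refine (injective_iff_map_eq_zero _).2 fun z hz => ?_
  have h1 : ∀ y, inner ℝ z y = 0 := fun y =>
    hd.induction (P := fun y => inner ℝ z y = 0) (by
      rintro _ ⟨v, rfl⟩
      rw [← ContinuousLinearMap.adjoint_inner_left, hz, inner_zero_left])
      (isClosed_eq (by fun_prop) (by fun_prop)) y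
  exact inner_self_eq_zero.1 (h1 z)

theorem injective_waveInv {ι : V →L[ℝ] H} (hι : Function.Injective ι) (hd : DenseRange ι) :
    Function.Injective (waveInv ι) := by
  refine (injective_iff_map_eq_zero _).2 fun p hp => ?_
  have h1 : -ι.adjoint p.snd = 0 := by rw [← waveInv_fst, hp]; rfl
  have h2 : ι p.fst = 0 := by rw [← waveInv_snd, hp]; rfl
  have h3 : p.snd = 0 := adjoint_injective_of_denseRange hd (by rw [map_zero, ← neg_eq_zero, h1])
  have h4 : p.fst = 0 := hι (by rw [map_zero, h2])
  exact (WithLp.equiv 2 (V × H)).injective (Prod.ext h4 h3)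

omit [CompleteSpace V] [CompleteSpace H] in
theorem phase_norm_sq (p : WithLp 2 (V × H)) : ‖p‖ ^ 2 = ‖p.fst‖ ^ 2 + ‖p.snd‖ ^ 2 := by
  rw [← real_inner_self_eq_norm_sq, WithLp.prod_inner_apply]
  change inner ℝ p.fst p.fst + inner ℝ p.snd p.snd = _
  rw [real_inner_self_eq_norm_sq, real_inner_self_eq_norm_sq]

/-- What the multiplier method needs to know of a boundary observation `ν` of the wave equation:
`mul` is the multiplier `u ↦ x u'`, and `‖D u‖²` is the potential energy of the singular term.
The fields `lower` and `upper` are the two sides of the multiplier identity for an element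
`v = -ι† g` of the domain of the operator, and `damp`, `damp_ge` are those of the multiplier identity
for a velocity. By `mul_le`, the multiplier is bounded by the elastic energy
`‖v‖² + λ ‖D v‖²`; by `absorb`, the term `θ ‖D v‖²` does not destroy the coercivity of the sum of
`lower` and `damp`; by `interp` and `compact`, lower order terms are relatively compact. -/
structure MultiplierData (ι mul D : V →L[ℝ] H) (ν : H →L[ℝ] ℝ)
    (lam κ A B θ μ κ₁ C₁ : ℝ) : Prop where
  pos_κ : 0 < κ
  pos_c : 0 < A + B
  pos_κ₁ : 0 < κ₁
  pos_μ : 1 ≤ μ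
  lower : ∀ g, inner ℝ g (mul (-ι.adjoint g)) + A * ‖ι.adjoint g‖ ^ 2 + θ * ‖D (ι.adjoint g)‖ ^ 2 ≤
    κ * ν g ^ 2
  upper : ∀ g, κ * ν g ^ 2 ≤ inner ℝ g (mul (-ι.adjoint g)) + C₁ * ‖ι.adjoint g‖ ^ 2
  damp : ∀ z, inner ℝ (ι z) (mul z) ≤ -(B * ‖ι z‖ ^ 2)
  damp_ge : ∀ z, -(C₁ * ‖ι z‖ ^ 2) ≤ inner ℝ (ι z) (mul z)
  mul_le : ∀ v, ‖mul v‖ ^ 2 ≤ μ * (‖v‖ ^ 2 + lam * ‖D v‖ ^ 2)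
  absorb : ∀ v, κ₁ * ‖v‖ ^ 2 ≤ (A + B) * ‖v‖ ^ 2 + θ * ‖D v‖ ^ 2
  interp : ∀ ε > 0, ∃ C, 0 ≤ C ∧ ∀ v, ‖D v‖ ^ 2 ≤ ε * ‖v‖ ^ 2 + C * ‖ι v‖ ^ 2
  compact : ∀ ε > 0, ∃ (k : ℕ) (ℓ : Fin k → V →L[ℝ] ℝ), ∀ v,
    ‖ι v‖ ^ 2 ≤ ε * ‖v‖ ^ 2 + ∑ i, ℓ i v ^ 2

variable {ι mul D : V →L[ℝ] H} {ν : H →L[ℝ] ℝ} {lam κ A B θ μ κ₁ C₁ : ℝ}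
  {S : ℝ → WithLp 2 (V × H) →L[ℝ] WithLp 2 (V × H)}

/-- The multiplier functional `⟨v_t, x v_x⟩ - c ⟨v_t, v⟩` at the state `p = (v, v_t)`. -/
def multFunc (ι mul : V →L[ℝ] H) (c : ℝ) (p : WithLp 2 (V × H)) : ℝ :=
  inner ℝ p.snd (mul p.fst) - c * inner ℝ p.snd (ι p.fst)

theorem hasDerivAt_inner_comp (hS : IsUnitaryGroup (waveInv ι) S) (L : V →L[ℝ] H)
    (q : WithLp 2 (V × H)) (t : ℝ) :
    HasDerivAt (fun t => inner ℝ (S t (waveInv ι q)).snd (L (S t (waveInv ι q)).fst))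
      (inner ℝ (S t q).snd (L (-ι.adjoint (S t q).snd)) +
        inner ℝ (ι (S t q).fst) (L (S t q).fst)) t := by
  have h1 : HasDerivAt (fun t => L (S t (waveInv ι q)).fst) (L (S t q).fst) t :=
    ((L.comp (WithLp.fstL 2 ℝ V H)).hasFDerivAt.comp_hasDerivAt t (hS.deriv q t))
  have h2 : HasDerivAt (fun t => (S t (waveInv ι q)).snd) (S t q).snd t :=
    ((WithLp.sndL 2 ℝ V H).hasFDerivAt.comp_hasDerivAt t (hS.deriv q t))
  have h3 := h2.inner ℝ h1
  rw [hS.comm, waveInv_snd, waveInv_fst] at h3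
  rw [add_comm]
  exact h3

theorem hasDerivAt_multFunc (hS : IsUnitaryGroup (waveInv ι) S) (c : ℝ)
    (q : WithLp 2 (V × H)) (t : ℝ) :
    HasDerivAt (fun t => multFunc ι mul c (S t (waveInv ι q)))
      (inner ℝ (S t q).snd (mul (-ι.adjoint (S t q).snd)) +
        inner ℝ (ι (S t q).fst) (mul (S t q).fst) -
        c * (‖ι (S t q).fst‖ ^ 2 - ‖ι.adjoint (S t q).snd‖ ^ 2)) t := by
  have h1 := hasDerivAt_inner_comp hS mul q t
  have h2 := (hasDerivAt_inner_comp hS ι q t).const_mul c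
  have h3 := h1.sub h2
  have h4 : inner ℝ (S t q).snd (ι (-ι.adjoint (S t q).snd)) +
      inner ℝ (ι (S t q).fst) (ι (S t q).fst) =
      ‖ι (S t q).fst‖ ^ 2 - ‖ι.adjoint (S t q).snd‖ ^ 2 := by
    rw [map_neg, inner_neg_right, ← ContinuousLinearMap.adjoint_inner_left,
      real_inner_self_eq_norm_sq, real_inner_self_eq_norm_sq]
    ring
  rw [h4] at h3
  exact h3

/-- The energy along the trajectory of `J q`. -/
theorem energy_eq (hS : IsUnitaryGroup (waveInv ι) S) (q : WithLp 2 (V × H)) (t : ℝ) :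
    ‖ι.adjoint (S t q).snd‖ ^ 2 + ‖ι (S t q).fst‖ ^ 2 = ‖waveInv ι q‖ ^ 2 := by
  have h1 := hS.norm t (waveInv ι q)
  have h2 := phase_norm_sq (S t (waveInv ι q))
  rw [h1, hS.comm, waveInv_fst, waveInv_snd, norm_neg] at h2
  exact h2.symm

omit [CompleteSpace V] [CompleteSpace H] in
theorem abs_multFunc_le (ι mul : V →L[ℝ] H) (c : ℝ) :
    ∃ K, 0 ≤ K ∧ ∀ p, |multFunc ι mul c p| ≤ K * ‖p‖ ^ 2 := by
  refine ⟨‖mul‖ + |c| * ‖ι‖, by positivity, fun p => ?_⟩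
  have h0 := phase_norm_sq p
  have hf : ‖p.fst‖ ≤ ‖p‖ :=
    abs_le_of_sq_le_sq' (by nlinarith [sq_nonneg ‖p.snd‖]) (norm_nonneg _) |>.2
  have hs : ‖p.snd‖ ≤ ‖p‖ :=
    abs_le_of_sq_le_sq' (by nlinarith [sq_nonneg ‖p.fst‖]) (norm_nonneg _) |>.2
  have hL : ∀ L : V →L[ℝ] H, |inner ℝ p.snd (L p.fst)| ≤ ‖L‖ * ‖p‖ ^ 2 := fun L => by
    refine (abs_real_inner_le_norm _ _).trans ?_
    calc ‖p.snd‖ * ‖L p.fst‖ ≤ ‖p‖ * (‖L‖ * ‖p‖) := by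
          refine mul_le_mul hs ((L.le_opNorm _).trans ?_) (norm_nonneg _) (norm_nonneg _)
          exact mul_le_mul_of_nonneg_left hf (norm_nonneg _)
      _ = ‖L‖ * ‖p‖ ^ 2 := by ring
  refine (abs_sub _ _).trans ?_
  rw [abs_mul, add_mul, mul_assoc]
  exact add_le_add (hL mul) (mul_le_mul_of_nonneg_left (hL ι) (abs_nonneg c))

/-- A pointwise lower bound for the observation, integrated over `(0, L)`. -/
theorem le_norm_obs_sq (hS : IsUnitaryGroup (waveInv ι) S) {L : ℝ} (hL : 0 ≤ L) (c : ℝ)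
    (q : WithLp 2 (V × H)) {G : ℝ} (hG : ∀ t,
      inner ℝ (S t q).snd (mul (-ι.adjoint (S t q).snd)) +
        inner ℝ (ι (S t q).fst) (mul (S t q).fst) -
        c * (‖ι (S t q).fst‖ ^ 2 - ‖ι.adjoint (S t q).snd‖ ^ 2) + G ≤ κ * ν (S t q).snd ^ 2) :
    G * L + multFunc ι mul c (S L (waveInv ι q)) - multFunc ι mul c (waveInv ι q) ≤
      κ * ‖hS.obs (ν.comp (WithLp.sndL 2 ℝ V H)) 0 L q‖ ^ 2 := by
  have hc : Continuous fun t => κ * ν (S t q).snd ^ 2 :=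
    continuous_const.mul ((hS.continuous_observation (ν.comp (WithLp.sndL 2 ℝ V H)) q).pow 2)
  have h1 := intervalIntegral.sub_le_integral_of_hasDeriv_right_of_le
    (g := fun t => multFunc ι mul c (S t (waveInv ι q)) + G * t)
    (φ := fun t => κ * ν (S t q).snd ^ 2) hL
    (fun t _ => ((hasDerivAt_multFunc hS c q t).add
      ((hasDerivAt_id t).const_mul G)).continuousAt.continuousWithinAt)
    (fun t _ => ((hasDerivAt_multFunc hS c q t).add
      ((hasDerivAt_id t).const_mul G)).hasDerivWithinAt) (hc.integrableOn_Icc)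
    (fun t _ => by simpa using hG t)
  rw [hS.norm_obs_sq _ hL, ← intervalIntegral.integral_const_mul]
  refine le_trans (le_of_eq ?_) h1
  rw [hS.zero]
  simp
  ring

/-- A pointwise upper bound for the observation, integrated over `(0, L)`. -/
theorem norm_obs_sq_le (hS : IsUnitaryGroup (waveInv ι) S) {L : ℝ} (hL : 0 ≤ L) (c : ℝ)
    (q : WithLp 2 (V × H)) {G : ℝ} (hG : ∀ t, κ * ν (S t q).snd ^ 2 ≤
      inner ℝ (S t q).snd (mul (-ι.adjoint (S t q).snd)) +
        inner ℝ (ι (S t q).fst) (mul (S t q).fst) -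
        c * (‖ι (S t q).fst‖ ^ 2 - ‖ι.adjoint (S t q).snd‖ ^ 2) + G) :
    κ * ‖hS.obs (ν.comp (WithLp.sndL 2 ℝ V H)) 0 L q‖ ^ 2 ≤
      G * L + multFunc ι mul c (S L (waveInv ι q)) - multFunc ι mul c (waveInv ι q) := by
  have hc : Continuous fun t => κ * ν (S t q).snd ^ 2 :=
    continuous_const.mul ((hS.continuous_observation (ν.comp (WithLp.sndL 2 ℝ V H)) q).pow 2)
  have h1 := intervalIntegral.integral_le_sub_of_hasDeriv_right_of_le
    (g := fun t => multFunc ι mul c (S t (waveInv ι q)) + G * t)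
    (φ := fun t => κ * ν (S t q).snd ^ 2) hL
    (fun t _ => ((hasDerivAt_multFunc hS c q t).add
      ((hasDerivAt_id t).const_mul G)).continuousAt.continuousWithinAt)
    (fun t _ => ((hasDerivAt_multFunc hS c q t).add
      ((hasDerivAt_id t).const_mul G)).hasDerivWithinAt) (hc.integrableOn_Icc)
    (fun t _ => by simpa using hG t)
  rw [hS.norm_obs_sq _ hL, ← intervalIntegral.integral_const_mul]
  refine le_trans h1 (le_of_eq ?_)
  rw [hS.zero]
  simp
  ring

namespace MultiplierData

variable (h : MultiplierData ι mul D ν lam κ A B θ μ κ₁ C₁)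
include h

/-- The hidden regularity of the observation. -/
theorem admissible (hS : IsUnitaryGroup (waveInv ι) S) :
    hS.Admissible (ν.comp (WithLp.sndL 2 ℝ V H)) := by
  intro L hL
  obtain ⟨K, hK, hm⟩ := abs_multFunc_le ι mul 0
  refine ⟨Real.sqrt ((|C₁| * L + 2 * K) / κ), Real.sqrt_nonneg _, fun q => ?_⟩
  have h1 := norm_obs_sq_le (κ := κ) (ν := ν) (mul := mul) hS hL 0 q
      (G := |C₁| * ‖waveInv ι q‖ ^ 2) fun t => by
    have e1 := h.upper (S t q).snd
    have e2 := h.damp_ge (S t q).fst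
    have e3 := energy_eq hS q t
    have e4 := mul_le_mul_of_nonneg_right (le_abs_self C₁)
      (add_nonneg (sq_nonneg ‖ι.adjoint (S t q).snd‖) (sq_nonneg ‖ι (S t q).fst‖))
    rw [← e3]
    linarith
  have h2 := (abs_le.1 (hm (S L (waveInv ι q)))).2
  have h3 := (abs_le.1 (hm (waveInv ι q))).1
  rw [hS.norm] at h2
  have h4 : ‖hS.obs (ν.comp (WithLp.sndL 2 ℝ V H)) 0 L q‖ ^ 2 ≤
      (|C₁| * L + 2 * K) / κ * ‖waveInv ι q‖ ^ 2 := by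
    rw [div_mul_eq_mul_div, le_div_iff₀ h.pos_κ]
    nlinarith
  have hnn : 0 ≤ (|C₁| * L + 2 * K) / κ := div_nonneg (by positivity) h.pos_κ.le
  refine abs_le_of_sq_le_sq' ?_ (by positivity) |>.2
  rwa [mul_pow, Real.sq_sqrt hnn]

/-- Observability for a long time. The multiplier `v` gives equipartition of the energy, so that
the singular term can be absorbed. -/
theorem exists_long_obs (hS : IsUnitaryGroup (waveInv ι) S) :
    ∃ L C, 0 ≤ L ∧ ∀ q, ‖waveInv ι q‖ ≤
      C * ‖hS.obs (ν.comp (WithLp.sndL 2 ℝ V H)) 0 L q‖ := by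
  -- This weight of `⟨v_t, v⟩` turns `A ‖v‖² + B ‖v_t‖²` into `(A + B - κ₁ / 2) ‖v‖² + (κ₁ / 2) ‖v_t‖²`,
  -- so that all but `κ₁ / 2` of the coercivity is available for absorbing the singular term.
  obtain ⟨K, hK, hm⟩ := abs_multFunc_le ι mul (-(B - κ₁ / 2))
  have hκ := h.pos_κ
  have hκ₁ := h.pos_κ₁
  refine ⟨(2 * K + κ) / (κ₁ / 2), 1, by positivity, fun q => ?_⟩
  have h1 := le_norm_obs_sq (κ := κ) (ν := ν) (mul := mul) hS (L := (2 * K + κ) / (κ₁ / 2))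
    (by positivity) (-(B - κ₁ / 2)) q
    (G := κ₁ / 2 * ‖waveInv ι q‖ ^ 2) fun t => by
    have e1 := h.lower (S t q).snd
    have e2 := h.damp (S t q).fst
    have e3 := energy_eq hS q t
    have e4 := h.absorb (ι.adjoint (S t q).snd)
    rw [← e3]
    linarith
  have h2 := (abs_le.1 (hm (S ((2 * K + κ) / (κ₁ / 2)) (waveInv ι q)))).1
  have h3 := (abs_le.1 (hm (waveInv ι q))).2
  rw [hS.norm] at h2
  have h4 : κ₁ / 2 * ‖waveInv ι q‖ ^ 2 * ((2 * K + κ) / (κ₁ / 2)) =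
      (2 * K + κ) * ‖waveInv ι q‖ ^ 2 := by field_simp
  rw [h4] at h1
  have h5 : ‖waveInv ι q‖ ^ 2 ≤ ‖hS.obs (ν.comp (WithLp.sndL 2 ℝ V H)) 0
      ((2 * K + κ) / (κ₁ / 2)) q‖ ^ 2 := le_of_mul_le_mul_left (by linarith) hκ
  rw [one_mul]
  exact abs_le_of_sq_le_sq' h5 (norm_nonneg _) |>.2

/-- The inverse of the wave operator is compact, in the form that it is arbitrarily small up to
finitely many functionals. -/
theorem compact_waveInv {ε : ℝ} (hε : 0 < ε) :
    ∃ (k : ℕ) (ℓ : Fin k → WithLp 2 (V × H) →L[ℝ] ℝ), ∀ p,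
      ‖waveInv ι p‖ ^ 2 ≤ ε * ‖p‖ ^ 2 + ∑ i, ℓ i p ^ 2 := by
  set δ := min ε (ε ^ 2 / (‖ι.adjoint‖ ^ 2 + 1)) with hδ
  have hδ0 : 0 < δ := lt_min (by positivity) (by positivity)
  obtain ⟨k, ℓ, hℓ⟩ := h.compact δ hδ0
  refine ⟨k + k, Fin.append (fun i => (ℓ i).comp (WithLp.fstL 2 ℝ V H))
    (fun i => (1 / Real.sqrt ε) • ((ℓ i).comp (ι.adjoint.comp (WithLp.sndL 2 ℝ V H)))), fun p => ?_⟩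
  have h1 : ‖ι p.fst‖ ^ 2 ≤ ε * ‖p.fst‖ ^ 2 + ∑ i, ℓ i p.fst ^ 2 := by
    refine (hℓ p.fst).trans ?_
    have : δ ≤ ε := min_le_left _ _
    have := mul_le_mul_of_nonneg_right this (sq_nonneg ‖p.fst‖)
    exact add_le_add this le_rfl
  -- The adjoint is handled through `‖ι† z‖² = ⟨z, ι ι† z⟩`.
  have h2 : ‖ι.adjoint p.snd‖ ^ 2 ≤ ε * ‖p.snd‖ ^ 2 + 1 / ε * ∑ i, ℓ i (ι.adjoint p.snd) ^ 2 := by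
    have e1 : ‖ι.adjoint p.snd‖ ^ 2 = inner ℝ p.snd (ι (ι.adjoint p.snd)) := by
      rw [← ContinuousLinearMap.adjoint_inner_left, real_inner_self_eq_norm_sq]
    have e2 := real_inner_le_norm p.snd (ι (ι.adjoint p.snd))
    have e3 := hℓ (ι.adjoint p.snd)
    have e5 : δ * ‖ι.adjoint p.snd‖ ^ 2 ≤ ε ^ 2 * ‖p.snd‖ ^ 2 := by
      have a1 : δ ≤ ε ^ 2 / (‖ι.adjoint‖ ^ 2 + 1) := min_le_right _ _
      have a2 : ‖ι.adjoint p.snd‖ ^ 2 ≤ (‖ι.adjoint‖ ^ 2 + 1) * ‖p.snd‖ ^ 2 := by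
        have := ι.adjoint.le_opNorm p.snd
        have := pow_le_pow_left₀ (norm_nonneg _) this 2
        rw [mul_pow] at this
        nlinarith [sq_nonneg ‖p.snd‖]
      refine (mul_le_mul a1 a2 (sq_nonneg _) (by positivity)).trans_eq ?_
      field_simp
    set σ := ∑ i, ℓ i (ι.adjoint p.snd) ^ 2 with hσ
    have e6 : (ε * ‖p.snd‖ ^ 2 + 1 / ε * σ) * ε = ε ^ 2 * ‖p.snd‖ ^ 2 + σ := by
      field_simp
    refine le_of_mul_le_mul_right ?_ hε
    rw [e6]
    have e7 := mul_le_mul_of_nonneg_right (e1.le.trans e2) hε.le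
    have e8 : 0 ≤ σ := Finset.sum_nonneg fun i _ => sq_nonneg _
    have e9 := sq_nonneg (ε * ‖p.snd‖ - ‖ι (ι.adjoint p.snd)‖)
    rw [sub_sq, mul_pow] at e9
    linarith
  have h3 := phase_norm_sq (waveInv ι p)
  rw [waveInv_fst, waveInv_snd, norm_neg] at h3
  rw [h3, phase_norm_sq p, Fin.sum_univ_add]
  simp only [Fin.append_left, Fin.append_right]
  have h4 : ∀ i, (((1 / Real.sqrt ε) • ((ℓ i).comp (ι.adjoint.comp (WithLp.sndL 2 ℝ V H)))) p) ^ 2 =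
      1 / ε * ℓ i (ι.adjoint p.snd) ^ 2 := fun i => by
    change ((1 / Real.sqrt ε) * ℓ i (ι.adjoint p.snd)) ^ 2 = _
    rw [mul_pow, div_pow, one_pow, Real.sq_sqrt hε.le]
  simp only [h4]
  rw [← Finset.mul_sum]
  change _ ≤ _ + (∑ i, ℓ i p.fst ^ 2 + _)
  linarith

/-- Up to a compact term, the multiplier functional is bounded by `μ / 2` times the squared norm. The
two ends of a time interval contribute `μ` in total. -/
theorem abs_multFunc_le_add (c : ℝ) {ε : ℝ} (hε : 0 < ε) :
    ∃ C, 0 ≤ C ∧ ∀ p : WithLp 2 (V × H),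
      |multFunc ι mul c p| ≤ (μ / 2 + ε) * ‖p‖ ^ 2 + C * ‖ι p.fst‖ ^ 2 := by
  have hμ := h.pos_μ
  obtain ⟨C, hC, hD⟩ := h.interp (ε / (μ * (|lam| + 1))) (by positivity)
  refine ⟨μ / 2 * |lam| * C + c ^ 2 / (2 * ε), by positivity, fun p => ?_⟩
  have h0 := phase_norm_sq p
  have h1 : |inner ℝ p.snd (mul p.fst)| ≤ 1 / 2 * (‖p.snd‖ ^ 2 + ‖mul p.fst‖ ^ 2) := by
    refine (abs_real_inner_le_norm _ _).trans ?_
    nlinarith [sq_nonneg (‖p.snd‖ - ‖mul p.fst‖)]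
  have h2 := h.mul_le p.fst
  have h3 : |c| * |inner ℝ p.snd (ι p.fst)| ≤ ε / 2 * ‖p.snd‖ ^ 2 +
      c ^ 2 / (2 * ε) * ‖ι p.fst‖ ^ 2 := by
    have e1 := mul_le_mul_of_nonneg_left (abs_real_inner_le_norm p.snd (ι p.fst)) (abs_nonneg c)
    refine e1.trans (le_of_mul_le_mul_right ?_ hε)
    have e2 : (ε / 2 * ‖p.snd‖ ^ 2 + c ^ 2 / (2 * ε) * ‖ι p.fst‖ ^ 2) * ε =
        ε ^ 2 / 2 * ‖p.snd‖ ^ 2 + |c| ^ 2 / 2 * ‖ι p.fst‖ ^ 2 := by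
      rw [sq_abs]; field_simp
    rw [e2]
    nlinarith [sq_nonneg (ε * ‖p.snd‖ - |c| * ‖ι p.fst‖)]
  have h4 : μ / 2 * (lam * ‖D p.fst‖ ^ 2) ≤ ε / 2 * ‖p.fst‖ ^ 2 +
      μ / 2 * |lam| * C * ‖ι p.fst‖ ^ 2 := by
    have e1 := mul_le_mul_of_nonneg_left (hD p.fst) (abs_nonneg lam)
    have e2 := mul_le_mul_of_nonneg_right (le_abs_self lam) (sq_nonneg ‖D p.fst‖)
    have e3 : |lam| * (ε / (μ * (|lam| + 1)) * ‖p.fst‖ ^ 2) * μ ≤ ε * ‖p.fst‖ ^ 2 := by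
      have : |lam| * (ε / (μ * (|lam| + 1)) * ‖p.fst‖ ^ 2) * μ =
          |lam| / (|lam| + 1) * (ε * ‖p.fst‖ ^ 2) := by field_simp
      rw [this]
      refine mul_le_of_le_one_left (by positivity) ?_
      rw [div_le_one (by positivity)]
      linarith
    have e4 := mul_le_mul_of_nonneg_right (e2.trans e1) (show 0 ≤ μ / 2 by linarith)
    linarith
  have h5 : ‖p.snd‖ ^ 2 ≤ μ * ‖p.snd‖ ^ 2 := le_mul_of_one_le_left (sq_nonneg _) hμ
  have h6 : 0 ≤ ε / 2 * ‖p.snd‖ ^ 2 + ε / 2 * ‖p.fst‖ ^ 2 := by positivity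
  refine (abs_sub _ _).trans ?_
  rw [abs_mul, h0]
  linarith

/-- Observability up to finitely many functionals, in the time `2 μ / (A + B)`: the singular term is
compact and does not contribute to the time. -/
theorem exists_weak_obs (hS : IsUnitaryGroup (waveInv ι) S) {T : ℝ}
    (hT : 2 * μ / (A + B) < T) :
    ∃ (C : ℝ) (k : ℕ) (F : WithLp 2 (V × H) →L[ℝ] (Fin k → ℝ)), ∀ q,
      ‖waveInv ι q‖ ≤ C * (‖hS.obs (ν.comp (WithLp.sndL 2 ℝ V H)) 0 T q‖ +
        ‖F (waveInv ι q)‖) := by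
  have hμ := h.pos_μ
  have hc := h.pos_c
  have hκ := h.pos_κ
  have hT0 : 0 < T := lt_of_le_of_lt (by positivity) hT
  rw [div_lt_iff₀ hc] at hT
  -- The gain `g` is what remains of the coercivity after the boundary terms in time; half of it pays
  -- for `ε`, a quarter for the compact terms.
  set g := (A + B) / 2 * T - μ with hg
  have hg0 : 0 < g := by rw [hg]; linarith
  set ε := g / (2 * (|θ| * T + 2)) with hε
  have hε0 : 0 < ε := by positivity
  have hεg : ε * (|θ| * T + 2) = g / 2 := by rw [hε]; field_simp
  obtain ⟨C₂, hC₂, hD⟩ := h.interp ε hε0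
  obtain ⟨C₃, hC₃, hm⟩ := h.abs_multFunc_le_add ((A - B) / 2) hε0
  set C₄ := |θ| * C₂ * T + 2 * C₃ with hC₄
  have hC₄0 : 0 ≤ C₄ := by positivity
  obtain ⟨k, ℓ, hℓ⟩ := h.compact_waveInv (ε := g / (4 * (C₄ + 1))) (by positivity)
  refine ⟨Real.sqrt ((κ + C₄ * k) / (g / 4)), k, ContinuousLinearMap.pi ℓ, fun q => ?_⟩
  set p := waveInv ι q with hp
  have hnorm : ∀ t, ‖ι (S t p).fst‖ ^ 2 ≤ ‖waveInv ι p‖ ^ 2 := fun t => by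
    have e1 := phase_norm_sq (waveInv ι (S t p))
    rw [← hS.comm, hS.norm, hS.comm, waveInv_snd] at e1
    rw [e1]
    linarith [sq_nonneg ‖(waveInv ι (S t p)).fst‖]
  -- the weight `(A - B) / 2` splits the coercivity evenly between potential and kinetic energy
  have h1 := le_norm_obs_sq (κ := κ) (ν := ν) hS hT0.le ((A - B) / 2) q (mul := mul)
    (G := ((A + B) / 2 - |θ| * ε) * ‖p‖ ^ 2 - |θ| * C₂ * ‖waveInv ι p‖ ^ 2) fun t => by
    have e1 := h.lower (S t q).snd
    have e2 := h.damp (S t q).fst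
    have e3 := energy_eq hS q t
    have e4 := hD (ι.adjoint (S t q).snd)
    have e5 := hnorm t
    rw [hp, hS.comm, waveInv_fst, map_neg, norm_neg, ← hp] at e5
    have e6 : ‖ι.adjoint (S t q).snd‖ ^ 2 ≤ ‖p‖ ^ 2 := by
      rw [← e3]; linarith [sq_nonneg ‖ι (S t q).fst‖]
    have e7 : -(θ * ‖D (ι.adjoint (S t q).snd)‖ ^ 2) ≤
        |θ| * (ε * ‖p‖ ^ 2 + C₂ * ‖waveInv ι p‖ ^ 2) := by
      have a1 := mul_le_mul_of_nonneg_right (neg_le_abs θ)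
        (sq_nonneg ‖D (ι.adjoint (S t q).snd)‖)
      have a2 : ‖D (ι.adjoint (S t q).snd)‖ ^ 2 ≤ ε * ‖p‖ ^ 2 + C₂ * ‖waveInv ι p‖ ^ 2 :=
        e4.trans (add_le_add (mul_le_mul_of_nonneg_left e6 hε0.le)
          (mul_le_mul_of_nonneg_left e5 hC₂))
      have a3 := mul_le_mul_of_nonneg_left a2 (abs_nonneg θ)
      linarith
    have e8 : (A + B) / 2 * ‖p‖ ^ 2 = (A + B) / 2 * ‖ι.adjoint (S t q).snd‖ ^ 2 +
        (A + B) / 2 * ‖ι (S t q).fst‖ ^ 2 := by rw [← mul_add, e3]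
    linarith
  have h2 := (abs_le.1 (hm (S T p))).1
  have h3 := (abs_le.1 (hm p)).2
  rw [hS.norm] at h2
  have h4 := mul_le_mul_of_nonneg_left (hnorm T) hC₃
  have h5 := hnorm 0
  rw [hS.zero, one_apply_eq_self] at h5
  have h5' := mul_le_mul_of_nonneg_left h5 hC₃
  have h6 := mul_le_mul_of_nonneg_left (hℓ p) hC₄0
  have h7 : C₄ * (g / (4 * (C₄ + 1)) * ‖p‖ ^ 2) ≤ g / 4 * ‖p‖ ^ 2 := by
    have : C₄ * (g / (4 * (C₄ + 1)) * ‖p‖ ^ 2) = C₄ / (C₄ + 1) * (g / 4 * ‖p‖ ^ 2) := by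
      field_simp
    rw [this]
    refine mul_le_of_le_one_left (by positivity) ?_
    rw [div_le_one (by positivity)]
    linarith
  have h8 : ∑ i, ℓ i p ^ 2 ≤ k * ‖(ContinuousLinearMap.pi ℓ) p‖ ^ 2 := by
    refine (Finset.sum_le_card_nsmul _ _ (‖(ContinuousLinearMap.pi ℓ) p‖ ^ 2) fun i _ => ?_).trans
      (by simp)
    rw [← sq_abs]
    exact pow_le_pow_left₀ (abs_nonneg _) (norm_le_pi_norm ((ContinuousLinearMap.pi ℓ) p) i) 2
  have h8' := mul_le_mul_of_nonneg_left h8 hC₄0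
  set x := ‖hS.obs (ν.comp (WithLp.sndL 2 ℝ V H)) 0 T q‖ with hx
  set y := ‖(ContinuousLinearMap.pi ℓ) p‖ with hy
  have hεg' : ε * (|θ| * T + 2) * ‖p‖ ^ 2 = g / 2 * ‖p‖ ^ 2 := by rw [hεg]
  have hg' : g * ‖p‖ ^ 2 = ((A + B) / 2 * T - μ) * ‖p‖ ^ 2 := by rw [hg]
  have hC₄' : C₄ * ‖waveInv ι p‖ ^ 2 = (|θ| * C₂ * T + 2 * C₃) * ‖waveInv ι p‖ ^ 2 := by rw [hC₄]
  have h9 : g / 4 * ‖p‖ ^ 2 ≤ κ * x ^ 2 + C₄ * k * y ^ 2 := by linarith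
  have hx0 : 0 ≤ x := norm_nonneg _
  have hy0 : 0 ≤ y := norm_nonneg _
  have hk0 : 0 ≤ C₄ * k := by positivity
  have h10 : ‖p‖ ^ 2 ≤ (κ + C₄ * k) / (g / 4) * (x + y) ^ 2 := by
    rw [div_mul_eq_mul_div, le_div_iff₀ (by positivity)]
    have a1 : x ^ 2 ≤ (x + y) ^ 2 := pow_le_pow_left₀ hx0 (by linarith) 2
    have a2 : y ^ 2 ≤ (x + y) ^ 2 := pow_le_pow_left₀ hy0 (by linarith) 2
    have a3 := mul_le_mul_of_nonneg_left a1 hκ.le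
    have a4 := mul_le_mul_of_nonneg_left a2 hk0
    linarith
  refine abs_le_of_sq_le_sq' ?_ (by positivity) |>.2
  rwa [mul_pow, Real.sq_sqrt (by positivity)]

/-- The observability inequality. -/
theorem exists_obs (hS : IsUnitaryGroup (waveInv ι) S) (hd : DenseRange (waveInv ι)) {T : ℝ}
    (hT : 2 * μ / (A + B) < T) :
    ∃ C, 0 ≤ C ∧ ∀ q, ‖waveInv ι q‖ ≤ C * ‖hS.obs (ν.comp (WithLp.sndL 2 ℝ V H)) 0 T q‖ :=
  (h.admissible hS).exists_le_obs hd
    (div_nonneg (by linarith [h.pos_μ]) h.pos_c.le)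
    (fun _ hT => h.exists_weak_obs hS hT) (h.exists_long_obs hS) hT

end MultiplierData

end Wave

/-! ### Degenerate coefficients -/

section Coefficients

/-- The common consequences of weak and strong degeneracy. -/
structure IsDegenerate (g : ℝ → ℝ) (K : ℝ) : Prop where
  cont : ContinuousOn g (Icc 0 1)
  pos : ∀ x ∈ Ioc (0 : ℝ) 1, 0 < g x
  exp_pos : 0 < K
  exp_lt : K < 2
  hasDerivAt : ∀ x ∈ Ioo (0 : ℝ) 1, HasDerivAt g (deriv g x) x
  cont_deriv : ContinuousOn (deriv g) (Ioo 0 1)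
  deriv_le : ∀ x ∈ Ioo (0 : ℝ) 1, |x * deriv g x / g x| ≤ K

theorem isDegenerate_of_contDiffOn {g : ℝ → ℝ} (hc : ContinuousOn g (Icc 0 1))
    (hs : ContDiffOn ℝ 1 g (Ioc 0 1)) (hpos : ∀ x ∈ Ioc (0 : ℝ) 1, 0 < g x) (hb : DegBdd g)
    (h0 : 0 < degExp g) (h2 : degExp g < 2) : IsDegenerate g (degExp g) := by
  have hd : ∀ x ∈ Ioo (0 : ℝ) 1, ContDiffAt ℝ 1 g x := fun x hx =>
    (hs x ⟨hx.1, hx.2.le⟩).contDiffAt (Ioc_mem_nhds hx.1 hx.2)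
  refine ⟨hc, hpos, h0, h2, fun x hx => ?_, ?_, fun x hx => ?_⟩
  · exact ((hd x hx).differentiableAt one_ne_zero).hasDerivAt
  · exact (hs.mono Ioo_subset_Ioc_self).continuousOn_deriv_of_isOpen isOpen_Ioo le_rfl
  · have h1 : x * |derivWithin g (Icc 0 1) x| / g x ≤ degExp g :=
      le_csSup hb (mem_image_of_mem _ ⟨hx.1, hx.2.le⟩)
    rw [derivWithin_of_mem_nhds (Icc_mem_nhds hx.1 hx.2)] at h1
    rwa [abs_div, abs_mul, abs_of_pos hx.1, abs_of_pos (hpos x ⟨hx.1, hx.2.le⟩)]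

theorem isDegenerate {g : ℝ → ℝ} (h : IsWD g ∨ IsSD g) : IsDegenerate g (degExp g) := by
  rcases h with h | h
  · exact isDegenerate_of_contDiffOn h.cont h.smooth h.pos h.bdd h.exp_mem.1
      (h.exp_mem.2.trans one_lt_two)
  · exact isDegenerate_of_contDiffOn h.smooth.continuousOn (h.smooth.mono Ioc_subset_Icc_self)
      h.pos h.bdd (one_pos.trans_le h.exp_mem.1) h.exp_mem.2

/-- A degenerate coefficient vanishes at `0` no faster than `x ^ K`. -/
theorem IsDegenerate.rpow_le {g : ℝ → ℝ} {K : ℝ} (h : IsDegenerate g K) {x : ℝ}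
    (hx : x ∈ Ioc (0 : ℝ) 1) : g 1 * x ^ K ≤ g x := by
  have hanti : AntitoneOn (fun x => g x * x ^ (-K)) (Ioc 0 1) := by
    have hder : ∀ x ∈ Ioo (0 : ℝ) 1, HasDerivAt (fun x => g x * x ^ (-K))
        (deriv g x * x ^ (-K) + g x * (-K * x ^ (-K - 1))) x := fun x hx =>
      (h.hasDerivAt x hx).mul (Real.hasDerivAt_rpow_const (Or.inl hx.1.ne'))
    refine antitoneOn_of_deriv_nonpos (convex_Ioc 0 1) ?_ ?_ ?_
    · refine (h.cont.mono Ioc_subset_Icc_self).mul (ContinuousOn.rpow_const continuousOn_id ?_)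
      exact fun x hx => Or.inl hx.1.ne'
    · rw [interior_Ioc]
      exact fun x hx => (hder x hx).differentiableAt.differentiableWithinAt
    · rw [interior_Ioc]
      intro x hx
      have hg := h.pos x ⟨hx.1, hx.2.le⟩
      have h1 := (abs_le.1 (h.deriv_le x hx)).2
      rw [div_le_iff₀ hg] at h1
      have h2 : x ^ (-K) = x * x ^ (-K - 1) := by
        rw [← Real.rpow_one_add' hx.1.le (by linarith [h.exp_pos])]
        congr 1
        ring
      rw [(hder x hx).deriv, h2]
      have h3 : 0 < x ^ (-K - 1) := Real.rpow_pos_of_pos hx.1 _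
      nlinarith
  have h1 := hanti hx (right_mem_Ioc.2 one_pos) hx.2
  simp only [Real.one_rpow, mul_one] at h1
  have h2 : 0 < x ^ K := Real.rpow_pos_of_pos hx.1 _
  rw [Real.rpow_neg hx.1.le] at h1
  calc g 1 * x ^ K ≤ g x * (x ^ K)⁻¹ * x ^ K := mul_le_mul_of_nonneg_right h1 h2.le
    _ = g x := by field_simp

/-- The properties of the coefficients on which the analysis rests; `m` bounds the drift. -/
structure Coeffs (a b d : ℝ → ℝ) (Ka Kd m : ℝ) : Prop where
  deg_a : IsDegenerate a Ka
  deg_d : IsDegenerate d Kd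
  cont_b : ContinuousOn b (Icc 0 1)
  integrable : IntegrableOn (fun x => b x / a x) (Ioo 0 1)
  exp_lt : Ka + Kd < 2
  drift : ∀ᵐ x ∂(volume.restrict (Ioo (0 : ℝ) 1)), |x * b x / a x| ≤ m

theorem ae_abs_le_linftyNorm {g : ℝ → ℝ}
    (hg : MemLp g ⊤ (volume.restrict (Ioo (0 : ℝ) 1))) :
    ∀ᵐ x ∂(volume.restrict (Ioo (0 : ℝ) 1)), |g x| ≤ linftyNorm g := by
  have h1 := ae_le_eLpNormEssSup (f := g) (μ := volume.restrict (Ioo (0 : ℝ) 1))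
  filter_upwards [h1] with x hx
  rw [← eLpNorm_exponent_top] at hx
  have h2 := ENNReal.toReal_mono hg.eLpNorm_ne_top hx
  simpa [linftyNorm] using h2

/-- For `K_a ≤ 1` the bound `a x ≥ a 1 x ^ K_a ≥ a 1 x` makes `x b / a` bounded by `‖b‖_∞ / a 1`. -/
theorem BaseHyp.coeffs_driftM {a b d : ℝ → ℝ} {lam : ℝ} (h : BaseHyp a b d lam)
    (hK : degExp a ≤ 1) : Coeffs a b d (degExp a) (degExp d) (driftM a b) := by
  have ha := isDegenerate h.deg_a
  have hd := isDegenerate h.deg_d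
  have ha1 := ha.pos 1 (right_mem_Ioc.2 one_pos)
  refine ⟨ha, hd, h.cont_b, h.integrable, by linarith [h.exp_le, hd.exp_pos], ?_⟩
  have hb : MemLp b ⊤ (volume.restrict (Ioo (0 : ℝ) 1)) := by
    obtain ⟨C, hC⟩ := isCompact_Icc.exists_bound_of_continuousOn h.cont_b
    refine memLp_top_of_bound
      ((h.cont_b.mono Ioo_subset_Icc_self).aestronglyMeasurable measurableSet_Ioo) C ?_
    filter_upwards [ae_restrict_mem measurableSet_Ioo] with x hx
    exact hC x (Ioo_subset_Icc_self hx)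
  filter_upwards [ae_abs_le_linftyNorm hb, ae_restrict_mem measurableSet_Ioo] with x hx hx'
  have hax := ha.pos x ⟨hx'.1, hx'.2.le⟩
  have h1 := ha.rpow_le ⟨hx'.1, hx'.2.le⟩
  have h2 : x ≤ x ^ degExp a := by
    simpa using Real.rpow_le_rpow_of_exponent_ge hx'.1 hx'.2.le hK
  rw [abs_div, abs_mul, abs_of_pos hx'.1, abs_of_pos hax, driftM, div_le_div_iff₀ hax ha1]
  have h3 : 0 ≤ linftyNorm b := ENNReal.toReal_nonneg
  have h4 : x * a 1 ≤ a x := by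
    refine le_trans ?_ h1
    rw [mul_comm]
    exact mul_le_mul_of_nonneg_left h2 ha1.le
  calc x * |b x| * a 1 = |b x| * (x * a 1) := by ring
    _ ≤ linftyNorm b * a x := mul_le_mul hx h4 (mul_nonneg hx'.1.le ha1.le) h3

theorem BaseHyp.coeffs_driftMInf {a b d : ℝ → ℝ} {lam : ℝ} (h : BaseHyp a b d lam)
    (hm : MemLp (fun x => x * b x / a x) ⊤ (volume.restrict (Ioo (0 : ℝ) 1))) :
    Coeffs a b d (degExp a) (degExp d) (driftMInf a b) := by
  have ha := isDegenerate h.deg_a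
  have hd := isDegenerate h.deg_d
  exact ⟨ha, hd, h.cont_b, h.integrable, by linarith [h.exp_le, hd.exp_pos],
    ae_abs_le_linftyNorm hm⟩

namespace Coeffs

variable {a b d : ℝ → ℝ} {Ka Kd m : ℝ} (hC : Coeffs a b d Ka Kd m)
include hC

theorem a_pos {x : ℝ} (hx : x ∈ Ioc (0 : ℝ) 1) : 0 < a x := hC.deg_a.pos x hx

theorem d_pos {x : ℝ} (hx : x ∈ Ioc (0 : ℝ) 1) : 0 < d x := hC.deg_d.pos x hx

theorem cont_drift : ContinuousOn (fun x => b x / a x) (Ioc 0 1) :=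
  (hC.cont_b.mono Ioc_subset_Icc_self).div (hC.deg_a.cont.mono Ioc_subset_Icc_self)
    fun _ hx => (hC.a_pos hx).ne'

theorem continuousOn_eta : ContinuousOn (eta a b) (Icc 0 1) := by
  refine Real.continuous_exp.comp_continuousOn ?_
  have h1 : IntegrableOn (fun x => b x / a x) (uIcc 0 1) := by
    rw [uIcc_of_le zero_le_one, integrableOn_Icc_iff_integrableOn_Ioo]
    exact hC.integrable
  have h2 := intervalIntegral.continuousOn_primitive_interval' (a := 1 / 2) (b₁ := 0) (b₂ := 1)
    h1.intervalIntegrable (by rw [uIcc_of_le zero_le_one]; constructor <;> norm_num)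
  rwa [uIcc_of_le zero_le_one] at h2

theorem hasDerivAt_eta {x : ℝ} (hx : x ∈ Ioo (0 : ℝ) 1) :
    HasDerivAt (eta a b) (eta a b x * (b x / a x)) x := by
  refine HasDerivAt.exp ?_
  refine intervalIntegral.integral_hasDerivAt_right ?_ ?_ ?_
  · refine ContinuousOn.intervalIntegrable (hC.cont_drift.mono fun y hy => ?_)
    exact ⟨(lt_min (by norm_num) hx.1).trans_le hy.1, hy.2.trans (max_le (by norm_num) hx.2.le)⟩
  · exact ContinuousOn.stronglyMeasurableAtFilter isOpen_Ioo
      (hC.cont_drift.mono Ioo_subset_Ioc_self) x hx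
  · exact (hC.cont_drift x ⟨hx.1, hx.2.le⟩).continuousAt (Ioc_mem_nhds hx.1 hx.2)

omit hC in
theorem eta_pos (x : ℝ) : 0 < eta a b x := Real.exp_pos _

theorem exists_eta_bounds : ∃ c C, 0 < c ∧ 0 < C ∧ ∀ x ∈ Icc (0 : ℝ) 1,
    c ≤ eta a b x ∧ eta a b x ≤ C := by
  obtain ⟨x₀, -, h1⟩ := isCompact_Icc.exists_isMinOn (nonempty_Icc.2 zero_le_one)
    hC.continuousOn_eta
  obtain ⟨x₁, -, h2⟩ := isCompact_Icc.exists_isMaxOn (nonempty_Icc.2 zero_le_one)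
    hC.continuousOn_eta
  exact ⟨_, _, eta_pos x₀, eta_pos x₁, fun x hx => ⟨h1 hx, h2 hx⟩⟩

theorem sq_le_a {x : ℝ} (hx : x ∈ Ioo (0 : ℝ) 1) : x ^ 2 ≤ 1 / a 1 * a x := by
  have hx' : x ∈ Ioc (0 : ℝ) 1 := ⟨hx.1, hx.2.le⟩
  have ha1 := hC.a_pos (right_mem_Ioc.2 one_pos)
  have h1 := hC.deg_a.rpow_le hx'
  have h2 := Real.rpow_le_rpow_of_exponent_ge hx.1 hx.2.le hC.deg_a.exp_lt.le
  rw [Real.rpow_two] at h2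
  rw [one_div, le_inv_mul_iff₀ ha1]
  exact (mul_le_mul_of_nonneg_left h2 ha1.le).trans h1

theorem rpow_le_mul {x : ℝ} (hx : x ∈ Ioo (0 : ℝ) 1) :
    a 1 * d 1 * x ^ (Ka + Kd) ≤ a x * d x := by
  have hx' : x ∈ Ioc (0 : ℝ) 1 := ⟨hx.1, hx.2.le⟩
  have ha1 := hC.a_pos (right_mem_Ioc.2 one_pos)
  have hd1 := hC.d_pos (right_mem_Ioc.2 one_pos)
  have h1 := hC.deg_a.rpow_le hx'
  have h2 := hC.deg_d.rpow_le hx'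
  rw [Real.rpow_add hx.1]
  have h3 : 0 < x ^ Ka := Real.rpow_pos_of_pos hx.1 _
  have h4 : 0 < x ^ Kd := Real.rpow_pos_of_pos hx.1 _
  calc a 1 * d 1 * (x ^ Ka * x ^ Kd) = (a 1 * x ^ Ka) * (d 1 * x ^ Kd) := by ring
    _ ≤ a x * d x := mul_le_mul h1 h2 (by positivity) (hC.a_pos hx').le

theorem sq_le_mul {x : ℝ} (hx : x ∈ Ioo (0 : ℝ) 1) : x ^ 2 ≤ 1 / (a 1 * d 1) * (a x * d x) := by
  have ha1 := hC.a_pos (right_mem_Ioc.2 one_pos)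
  have hd1 := hC.d_pos (right_mem_Ioc.2 one_pos)
  have h1 := hC.rpow_le_mul hx
  have h2 := Real.rpow_le_rpow_of_exponent_ge hx.1 hx.2.le hC.exp_lt.le
  rw [Real.rpow_two] at h2
  rw [one_div, le_inv_mul_iff₀ (mul_pos ha1 hd1)]
  exact (mul_le_mul_of_nonneg_left h2 (mul_pos ha1 hd1).le).trans h1

/-- The weight `1 / (σ d)` is at most of order `x ^ (-s)` with `s = K_a + K_d < 2`. -/
theorem exists_weight_le : ∃ C, 0 < C ∧ ∀ x ∈ Ioo (0 : ℝ) 1,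
    1 / (sigma a b x * d x) ≤ C * x ^ (-(Ka + Kd)) := by
  obtain ⟨c, C, hc, hC0, hb⟩ := hC.exists_eta_bounds
  have ha1 := hC.a_pos (right_mem_Ioc.2 one_pos)
  have hd1 := hC.d_pos (right_mem_Ioc.2 one_pos)
  refine ⟨C / (a 1 * d 1), by positivity, fun x hx => ?_⟩
  have hx' : x ∈ Ioc (0 : ℝ) 1 := ⟨hx.1, hx.2.le⟩
  have hax := hC.a_pos hx'
  have hdx := hC.d_pos hx'
  have hη := eta_pos (a := a) (b := b) x
  have h3 : 0 < x ^ (Ka + Kd) := Real.rpow_pos_of_pos hx.1 _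
  have h1 := hC.rpow_le_mul hx
  rw [sigma, Real.rpow_neg hx.1.le]
  have e1 : 1 / (a x * (eta a b x)⁻¹ * d x) = eta a b x / (a x * d x) := by field_simp
  have e2 : C / (a 1 * d 1) * (x ^ (Ka + Kd))⁻¹ = C / (a 1 * d 1 * x ^ (Ka + Kd)) := by field_simp
  rw [e1, e2]
  exact div_le_div₀ hC0.le (hb x (Ioo_subset_Icc_self hx)).2 (by positivity) h1

theorem sigma_pos {x : ℝ} (hx : x ∈ Ioc (0 : ℝ) 1) : 0 < sigma a b x :=
  mul_pos (hC.a_pos hx) (inv_pos.2 (eta_pos x))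

theorem exists_d_le : ∃ C, 0 < C ∧ ∀ x ∈ Icc (0 : ℝ) 1, d x ≤ C := by
  obtain ⟨x₁, -, h2⟩ := isCompact_Icc.exists_isMaxOn (nonempty_Icc.2 zero_le_one) hC.deg_d.cont
  have h3 := h2 (right_mem_Icc.2 zero_le_one)
  exact ⟨d x₁, (hC.d_pos (right_mem_Ioc.2 one_pos)).trans_le h3, fun x hx => h2 hx⟩

theorem continuousOn_sigma : ContinuousOn (sigma a b) (Icc 0 1) :=
  hC.deg_a.cont.mul (hC.continuousOn_eta.inv₀ fun _ _ => (eta_pos _).ne')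

end Coeffs

end Coefficients

/-! ### Weighted `L²` spaces on the unit interval -/

section Weighted

/-- Lebesgue measure on `(0,1)`. -/
abbrev muI : Measure ℝ := volume.restrict (Ioo (0 : ℝ) 1)

/-- The measure `ρ dx` on `(0,1)`. -/
abbrev muW (ρ : ℝ → ℝ) : Measure ℝ := muI.withDensity fun x => ENNReal.ofReal (ρ x)

variable {ρ : ℝ → ℝ} (hc : ContinuousOn ρ (Ioo 0 1)) (hp : ∀ x ∈ Ioo (0 : ℝ) 1, 0 < ρ x)

include hc in
theorem aemeasurable_weight : AEMeasurable (fun x => ENNReal.ofReal (ρ x)) muI :=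
  (hc.aemeasurable measurableSet_Ioo).ennreal_ofReal

include hc hp in
theorem ae_muW : ae (muW ρ) = ae muI := by
  refine le_antisymm (withDensity_absolutelyContinuous _ _).ae_le ?_
  refine (withDensity_absolutelyContinuous' (aemeasurable_weight hc) ?_).ae_le
  filter_upwards [ae_restrict_mem measurableSet_Ioo] with x hx
  simpa using hp x hx

include hc hp in
theorem integrable_muW_iff {f : ℝ → ℝ} :
    Integrable f (muW ρ) ↔ Integrable (fun x => ρ x * f x) muI := by
  rw [integrable_withDensity_iff_integrable_smul₀' (aemeasurable_weight hc)
    (Eventually.of_forall fun x => ENNReal.ofReal_lt_top)]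
  refine integrable_congr ?_
  filter_upwards [ae_restrict_mem measurableSet_Ioo] with x hx
  rw [ENNReal.toReal_ofReal (hp x hx).le, smul_eq_mul]

include hc hp in
theorem integral_muW (f : ℝ → ℝ) : ∫ x, f x ∂(muW ρ) = ∫ x in Ioo (0 : ℝ) 1, ρ x * f x := by
  rw [integral_withDensity_eq_integral_toReal_smul₀ (aemeasurable_weight hc)
    (Eventually.of_forall fun x => ENNReal.ofReal_lt_top)]
  refine integral_congr_ae ?_
  filter_upwards [ae_restrict_mem measurableSet_Ioo] with x hx
  rw [ENNReal.toReal_ofReal (hp x hx).le, smul_eq_mul]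

include hc hp in
theorem memLp_two_muW {f : ℝ → ℝ} (hf : AEStronglyMeasurable f muI)
    (hi : Integrable (fun x => ρ x * f x ^ 2) muI) : MemLp f 2 (muW ρ) :=
  (memLp_two_iff_integrable_sq (hf.mono_ac (Measure.ae_le_iff_absolutelyContinuous.1
    (ae_muW hc hp).le))).2 ((integrable_muW_iff hc hp).2 hi)

include hc hp in
theorem integrable_muW_mul (f g : Lp ℝ 2 (muW ρ)) :
    Integrable (fun x => ρ x * (f x * g x)) muI := by
  refine (integrable_muW_iff hc hp).1 ((L2.integrable_inner (𝕜 := ℝ) f g).congr ?_)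
  exact Eventually.of_forall fun x => by simp [mul_comm]

include hc hp in
theorem inner_muW (f g : Lp ℝ 2 (muW ρ)) :
    inner ℝ f g = ∫ x in Ioo (0 : ℝ) 1, ρ x * (f x * g x) := by
  rw [L2.inner_def, integral_muW hc hp]
  exact integral_congr_ae (Eventually.of_forall fun x => by simp [mul_comm])

include hc hp in
theorem norm_sq_muW (f : Lp ℝ 2 (muW ρ)) :
    ‖f‖ ^ 2 = ∫ x in Ioo (0 : ℝ) 1, ρ x * f x ^ 2 := by
  rw [← real_inner_self_eq_norm_sq, inner_muW hc hp]
  simp only [sq]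

include hc hp in
theorem aestronglyMeasurable_muW (f : Lp ℝ 2 (muW ρ)) :
    AEStronglyMeasurable (f : ℝ → ℝ) muI :=
  (Lp.aestronglyMeasurable f).mono_ac (Measure.ae_le_iff_absolutelyContinuous.1 (ae_muW hc hp).ge)

include hc hp in
theorem coeFn_muW_add (f g : Lp ℝ 2 (muW ρ)) :
    ((f + g : Lp ℝ 2 (muW ρ)) : ℝ → ℝ) =ᵐ[muI] fun x => f x + g x := by
  rw [← ae_muW hc hp]; exact Lp.coeFn_add f g

include hc hp in
theorem coeFn_muW_smul (c : ℝ) (f : Lp ℝ 2 (muW ρ)) :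
    ((c • f : Lp ℝ 2 (muW ρ)) : ℝ → ℝ) =ᵐ[muI] fun x => c * f x := by
  rw [← ae_muW hc hp]; exact Lp.coeFn_smul c f

/-- A pointwise defined linear map between weighted spaces, with a bound in the weighted norms, is
a bounded operator. -/
theorem exists_clm_muW {ρ' : ℝ → ℝ} (hc' : ContinuousOn ρ' (Ioo 0 1))
    (hp' : ∀ x ∈ Ioo (0 : ℝ) 1, 0 < ρ' x) (F : Lp ℝ 2 (muW ρ) → ℝ → ℝ)
    (hadd : ∀ f g, F (f + g) =ᵐ[muI] fun x => F f x + F g x)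
    (hsmul : ∀ (c : ℝ) f, F (c • f) =ᵐ[muI] fun x => c * F f x)
    (hmeas : ∀ f, AEStronglyMeasurable (F f) muI)
    (hint : ∀ f, Integrable (fun x => ρ' x * F f x ^ 2) muI) {C : ℝ}
    (hb : ∀ f, ∫ x in Ioo (0 : ℝ) 1, ρ' x * F f x ^ 2 ≤ C * ‖f‖ ^ 2) :
    ∃ L : Lp ℝ 2 (muW ρ) →L[ℝ] Lp ℝ 2 (muW ρ'), (∀ f, L f =ᵐ[muI] F f) ∧
      ∀ f, ‖L f‖ ^ 2 ≤ C * ‖f‖ ^ 2 := by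
  have hm : ∀ f, MemLp (F f) 2 (muW ρ') := fun f => memLp_two_muW hc' hp' (hmeas f) (hint f)
  have hL : ∀ f, ((hm f).toLp (F f) : ℝ → ℝ) =ᵐ[muI] F f := fun f => by
    rw [← ae_muW hc' hp']; exact (hm f).coeFn_toLp
  have hnorm : ∀ f, ‖(hm f).toLp (F f)‖ ^ 2 ≤ C * ‖f‖ ^ 2 := fun f => by
    rw [norm_sq_muW hc' hp']
    refine (integral_congr_ae ?_).trans_le (hb f)
    filter_upwards [hL f] with x hx
    rw [hx]
  have hC : ∀ f, ‖(hm f).toLp (F f)‖ ≤ √(max C 0) * ‖f‖ := fun f => by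
    rw [← Real.sqrt_sq (norm_nonneg f), ← Real.sqrt_mul (le_max_right _ _)]
    refine Real.le_sqrt_of_sq_le ((hnorm f).trans ?_)
    exact mul_le_mul_of_nonneg_right (le_max_left _ _) (sq_nonneg _)
  let L : Lp ℝ 2 (muW ρ) →ₗ[ℝ] Lp ℝ 2 (muW ρ') :=
    { toFun := fun f => (hm f).toLp (F f)
      map_add' := fun f g => by
        refine Lp.ext ?_
        rw [Filter.EventuallyEq, ae_muW hc' hp']
        filter_upwards [hL (f + g), hL f, hL g, hadd f g,
          coeFn_muW_add hc' hp' ((hm f).toLp (F f)) ((hm g).toLp (F g))] with x h1 h2 h3 h4 h5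
        rw [h1, h4, h5, h2, h3]
      map_smul' := fun c f => by
        refine Lp.ext ?_
        rw [Filter.EventuallyEq, ae_muW hc' hp']
        filter_upwards [hL (c • f), hL f, hsmul c f,
          coeFn_muW_smul hc' hp' c ((hm f).toLp (F f))] with x h1 h2 h4 h5
        rw [h1, h4, RingHom.id_apply, h5, h2] }
  exact ⟨L.mkContinuous _ hC, hL, hnorm⟩

end Weighted

/-! ### Operators on the space of derivatives -/

namespace Coeffs

section Operators

variable {a b d : ℝ → ℝ} {Ka Kd m : ℝ} (hC : Coeffs a b d Ka Kd m)
include hC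

theorem cont_weight : ContinuousOn (fun x => 1 / sigma a b x) (Ioo 0 1) :=
  continuousOn_const.div (hC.continuousOn_sigma.mono Ioo_subset_Icc_self)
    fun _ hx => (hC.sigma_pos ⟨hx.1, hx.2.le⟩).ne'

theorem weight_pos : ∀ x ∈ Ioo (0 : ℝ) 1, 0 < 1 / sigma a b x :=
  fun _ hx => one_div_pos.2 (hC.sigma_pos ⟨hx.1, hx.2.le⟩)

theorem cont_eta : ContinuousOn (eta a b) (Ioo 0 1) :=
  hC.continuousOn_eta.mono Ioo_subset_Icc_self

theorem ae_muSigma : ae (muSigma a b) = ae muI := ae_muW hC.cont_weight hC.weight_pos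

theorem ae_muEta : ae (muEta a b) = ae muI := ae_muW hC.cont_eta fun x _ => eta_pos x

theorem inner_L2 (f g : L2 a b) :
    inner ℝ f g = ∫ x in Ioo (0 : ℝ) 1, 1 / sigma a b x * (f x * g x) :=
  inner_muW hC.cont_weight hC.weight_pos f g

theorem norm_sq_L2 (f : L2 a b) :
    ‖f‖ ^ 2 = ∫ x in Ioo (0 : ℝ) 1, 1 / sigma a b x * f x ^ 2 :=
  norm_sq_muW hC.cont_weight hC.weight_pos f

theorem integrable_L2_mul (f g : L2 a b) :
    Integrable (fun x => 1 / sigma a b x * (f x * g x)) muI :=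
  integrable_muW_mul hC.cont_weight hC.weight_pos f g

theorem inner_L2eta (f g : L2eta a b) :
    inner ℝ f g = ∫ x in Ioo (0 : ℝ) 1, eta a b x * (f x * g x) :=
  inner_muW hC.cont_eta (fun x _ => eta_pos x) f g

theorem norm_sq_L2eta (f : L2eta a b) :
    ‖f‖ ^ 2 = ∫ x in Ioo (0 : ℝ) 1, eta a b x * f x ^ 2 :=
  norm_sq_muW hC.cont_eta (fun x _ => eta_pos x) f

theorem integrable_L2eta_mul (f g : L2eta a b) :
    Integrable (fun x => eta a b x * (f x * g x)) muI :=
  integrable_muW_mul hC.cont_eta (fun x _ => eta_pos x) f g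

theorem coeFn_L2eta_add (f g : L2eta a b) :
    ((f + g : L2eta a b) : ℝ → ℝ) =ᵐ[muI] fun x => f x + g x :=
  coeFn_muW_add hC.cont_eta (fun x _ => eta_pos x) f g

theorem coeFn_L2eta_smul (c : ℝ) (f : L2eta a b) :
    ((c • f : L2eta a b) : ℝ → ℝ) =ᵐ[muI] fun x => c * f x :=
  coeFn_muW_smul hC.cont_eta (fun x _ => eta_pos x) c f

theorem aestronglyMeasurable_L2 (f : L2 a b) : AEStronglyMeasurable (f : ℝ → ℝ) muI :=
  aestronglyMeasurable_muW hC.cont_weight hC.weight_pos f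

theorem aestronglyMeasurable_L2eta (f : L2eta a b) : AEStronglyMeasurable (f : ℝ → ℝ) muI :=
  aestronglyMeasurable_muW hC.cont_eta (fun x _ => eta_pos x) f

theorem ext_L2 {f g : L2 a b} (h : (f : ℝ → ℝ) =ᵐ[muI] g) : f = g :=
  Lp.ext (by rw [Filter.EventuallyEq, hC.ae_muSigma]; exact h)

theorem ext_L2eta {f g : L2eta a b} (h : (f : ℝ → ℝ) =ᵐ[muI] g) : f = g :=
  Lp.ext (by rw [Filter.EventuallyEq, hC.ae_muEta]; exact h)

theorem memLp_L2eta {f : ℝ → ℝ} (hf : AEStronglyMeasurable f muI)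
    (hi : Integrable (fun x => eta a b x * f x ^ 2) muI) : MemLp f 2 (muEta a b) :=
  memLp_two_muW hC.cont_eta (fun x _ => eta_pos x) hf hi

theorem coeFn_toLp_L2eta {f : ℝ → ℝ} (hf : MemLp f 2 (muEta a b)) :
    (hf.toLp f : ℝ → ℝ) =ᵐ[muI] f := by
  rw [← hC.ae_muEta]; exact hf.coeFn_toLp

theorem memLp_muEta_of_bounded {f : ℝ → ℝ} (hf : AEStronglyMeasurable f muI) {M : ℝ}
    (hM : ∀ x ∈ Ioo (0 : ℝ) 1, |f x| ≤ M) : MemLp f 2 (muEta a b) := by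
  obtain ⟨c, C, hc, hC0, hb⟩ := hC.exists_eta_bounds
  refine hC.memLp_L2eta hf (Integrable.of_bound
    ((hC.cont_eta.aestronglyMeasurable measurableSet_Ioo).mul (hf.pow 2)) (C * M ^ 2) ?_)
  filter_upwards [ae_restrict_mem measurableSet_Ioo] with x hx
  rw [Real.norm_eq_abs, abs_mul, abs_of_pos (eta_pos x), abs_pow]
  exact mul_le_mul (hb x (Ioo_subset_Icc_self hx)).2
    (pow_le_pow_left₀ (abs_nonneg _) (hM x hx) 2) (by positivity) hC0.le

theorem integrableOn_L2eta (w : L2eta a b) : IntegrableOn (w : ℝ → ℝ) (Ioo 0 1) := by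
  obtain ⟨c, C, hc, hC0, hb⟩ := hC.exists_eta_bounds
  have h1 : Integrable (fun x => w x ^ 2) muI := by
    refine ((hC.integrable_L2eta_mul w w).const_mul c⁻¹).mono'
      ((hC.aestronglyMeasurable_L2eta w).pow 2) ?_
    filter_upwards [ae_restrict_mem measurableSet_Ioo] with x hx
    rw [Real.norm_of_nonneg (sq_nonneg _), ← sq, inv_mul_eq_div, le_div_iff₀ hc, mul_comm]
    exact mul_le_mul_of_nonneg_right (hb x (Ioo_subset_Icc_self hx)).1 (sq_nonneg _)
  exact ((memLp_two_iff_integrable_sq (hC.aestronglyMeasurable_L2eta w)).2 h1).integrable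
    one_le_two

theorem intervalIntegrable_L2eta (w : L2eta a b) {x y : ℝ} (hx : x ∈ Icc (0 : ℝ) 1)
    (hy : y ∈ Icc (0 : ℝ) 1) : IntervalIntegrable (w : ℝ → ℝ) volume x y :=
  (intervalIntegrable_of_Ioo (hC.integrableOn_L2eta w) hx).symm.trans
    (intervalIntegrable_of_Ioo (hC.integrableOn_L2eta w) hy)

/-- Increments of a primitive are continuous functionals of the derivative, and the primitive is
Hölder continuous of exponent `1 / 2`. -/
theorem exists_increment : ∃ C, 0 < C ∧ ∀ x y : ℝ, 0 ≤ x → x ≤ y → y ≤ 1 →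
    ∃ e : L2eta a b, ‖e‖ ^ 2 ≤ C * (y - x) ∧
      ∀ w : L2eta a b, inner ℝ e w = ∫ s in x..y, w s := by
  obtain ⟨c, C, hc, hC0, hb⟩ := hC.exists_eta_bounds
  refine ⟨c⁻¹, inv_pos.2 hc, fun x y hx hxy hy => ?_⟩
  set f : ℝ → ℝ := (Ioo x y).indicator fun s => (eta a b s)⁻¹ with hf
  have hsub : Ioo x y ⊆ Ioo (0 : ℝ) 1 := Ioo_subset_Ioo hx hy
  have hinv : ContinuousOn (fun s => (eta a b s)⁻¹) (Ioo 0 1) :=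
    hC.cont_eta.inv₀ fun s _ => (eta_pos s).ne'
  have hmeas : AEStronglyMeasurable f muI :=
    (hinv.aestronglyMeasurable measurableSet_Ioo).indicator measurableSet_Ioo
  have hm : MemLp f 2 (muEta a b) := by
    refine hC.memLp_muEta_of_bounded hmeas (M := c⁻¹) fun s hs => ?_
    rw [hf, indicator_apply]
    split_ifs
    · rw [abs_of_pos (inv_pos.2 (eta_pos s))]
      exact inv_anti₀ hc (hb s (Ioo_subset_Icc_self hs)).1
    · simpa using hc.le
  have key : ∀ w : L2eta a b, inner ℝ (hm.toLp f) w = ∫ s in x..y, w s := fun w => by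
    rw [hC.inner_L2eta, intervalIntegral.integral_of_le hxy, integral_Ioc_eq_integral_Ioo]
    have h1 : ∫ s in Ioo (0 : ℝ) 1, eta a b s * ((hm.toLp f) s * w s) =
        ∫ s in Ioo (0 : ℝ) 1, (Ioo x y).indicator w s := by
      refine integral_congr_ae ?_
      filter_upwards [hC.coeFn_toLp_L2eta hm] with s hs
      rw [hs, hf, indicator_apply, indicator_apply]
      split_ifs
      · have := (eta_pos (a := a) (b := b) s).ne'
        field_simp
      · simp
    rw [h1, setIntegral_indicator measurableSet_Ioo, inter_eq_self_of_subset_right hsub]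
  refine ⟨hm.toLp f, ?_, key⟩
  rw [← real_inner_self_eq_norm_sq, key, intervalIntegral.integral_of_le hxy,
    integral_Ioc_eq_integral_Ioo]
  have h2 : ∫ s in Ioo x y, (hm.toLp f) s ≤ ∫ s in Ioo x y, c⁻¹ := by
    have hI := (hC.integrableOn_L2eta (hm.toLp f)).mono_set hsub
    refine integral_mono_ae hI (by simp) ?_
    have h3 : ∀ᵐ s ∂(volume.restrict (Ioo x y)), (hm.toLp f) s = f s :=
      ae_mono (Measure.restrict_mono hsub le_rfl) (hC.coeFn_toLp_L2eta hm)
    filter_upwards [h3, ae_restrict_mem measurableSet_Ioo] with s hs hs'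
    rw [hs, hf, indicator_of_mem hs']
    exact inv_anti₀ hc (hb s (Ioo_subset_Icc_self (hsub hs'))).1
  refine h2.trans_eq ?_
  rw [setIntegral_const, smul_eq_mul, measureReal_def, Real.volume_Ioo,
    ENNReal.toReal_ofReal (by linarith), mul_comm]

theorem exists_increment_bound : ∃ C, 0 < C ∧ ∀ x y : ℝ, 0 ≤ x → x ≤ y → y ≤ 1 →
    ∀ w : L2eta a b, (∫ s in x..y, w s) ^ 2 ≤ C * (y - x) * ‖w‖ ^ 2 := by
  obtain ⟨C, hC0, h⟩ := hC.exists_increment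
  refine ⟨C, hC0, fun x y hx hxy hy w => ?_⟩
  obtain ⟨e, he, hw⟩ := h x y hx hxy hy
  rw [← hw]
  calc (inner ℝ e w : ℝ) ^ 2 = |inner ℝ e w| ^ 2 := (sq_abs _).symm
    _ ≤ (‖e‖ * ‖w‖) ^ 2 := pow_le_pow_left₀ (abs_nonneg _) (abs_real_inner_le_norm _ _) 2
    _ = ‖e‖ ^ 2 * ‖w‖ ^ 2 := mul_pow _ _ _
    _ ≤ _ := mul_le_mul_of_nonneg_right he (sq_nonneg _)

theorem continuousOn_primitive (w : L2eta a b) :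
    ContinuousOn (fun x => ∫ s in (0 : ℝ)..x, w s) (Icc 0 1) := by
  have h2 := intervalIntegral.continuousOn_primitive_interval' (a := 0) (b₁ := 0) (b₂ := 1)
    (hC.intervalIntegrable_L2eta w (left_mem_Icc.2 zero_le_one) (right_mem_Icc.2 zero_le_one))
    (by simp)
  rwa [uIcc_of_le zero_le_one] at h2

theorem primitive_add (w z : L2eta a b) {x : ℝ} (hx : x ∈ Icc (0 : ℝ) 1) :
    ∫ s in (0 : ℝ)..x, (w + z : L2eta a b) s = (∫ s in (0 : ℝ)..x, w s) + ∫ s in (0 : ℝ)..x, z s := by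
  have h0 := left_mem_Icc.2 (zero_le_one (α := ℝ))
  rw [integral_congr_of_ae (hC.coeFn_L2eta_add w z) hx, intervalIntegral.integral_add
    (hC.intervalIntegrable_L2eta w h0 hx) (hC.intervalIntegrable_L2eta z h0 hx)]

theorem primitive_smul (c : ℝ) (w : L2eta a b) {x : ℝ} (hx : x ∈ Icc (0 : ℝ) 1) :
    ∫ s in (0 : ℝ)..x, (c • w : L2eta a b) s = c * ∫ s in (0 : ℝ)..x, w s := by
  rw [integral_congr_of_ae (hC.coeFn_L2eta_smul c w) hx, intervalIntegral.integral_const_mul]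

/-- Multiplication operators `w ↦ ρ w`. -/
theorem exists_mulOp {ρ : ℝ → ℝ} (hρ : ContinuousOn ρ (Ioo 0 1)) {C : ℝ}
    (hb : ∀ x ∈ Ioo (0 : ℝ) 1, 1 / sigma a b x * ρ x ^ 2 ≤ C * eta a b x) :
    ∃ L : L2eta a b →L[ℝ] L2 a b, (∀ w, L w =ᵐ[muI] fun x => ρ x * w x) ∧
      ∀ w, ‖L w‖ ^ 2 ≤ C * ‖w‖ ^ 2 := by
  have hle : ∀ w : L2eta a b, ∀ x ∈ Ioo (0 : ℝ) 1,
      1 / sigma a b x * (ρ x * w x) ^ 2 ≤ C * (eta a b x * w x ^ 2) := fun w x hx =>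
    calc 1 / sigma a b x * (ρ x * w x) ^ 2 = 1 / sigma a b x * ρ x ^ 2 * w x ^ 2 := by ring
      _ ≤ C * eta a b x * w x ^ 2 := mul_le_mul_of_nonneg_right (hb x hx) (sq_nonneg _)
      _ = _ := by ring
  have hmeas : ∀ w : L2eta a b, AEStronglyMeasurable (fun x => ρ x * w x) muI := fun w =>
    (hρ.aestronglyMeasurable measurableSet_Ioo).mul (hC.aestronglyMeasurable_L2eta w)
  have hdom : ∀ w : L2eta a b, Integrable (fun x => C * (eta a b x * w x ^ 2)) muI := fun w => by
    simpa only [sq] using (hC.integrable_L2eta_mul w w).const_mul C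
  have hint : ∀ w : L2eta a b,
      Integrable (fun x => 1 / sigma a b x * (ρ x * w x) ^ 2) muI := fun w => by
    refine (hdom w).mono' ((hC.cont_weight.aestronglyMeasurable measurableSet_Ioo).mul
      ((hmeas w).pow 2)) ?_
    filter_upwards [ae_restrict_mem measurableSet_Ioo] with x hx
    rw [Real.norm_of_nonneg (mul_nonneg (hC.weight_pos x hx).le (sq_nonneg _))]
    exact hle w x hx
  refine exists_clm_muW (ρ := eta a b) hC.cont_weight hC.weight_pos
    (fun (w : L2eta a b) x => ρ x * w x) (fun f g => ?_) (fun c f => ?_) hmeas hint fun w => ?_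
  · filter_upwards [hC.coeFn_L2eta_add f g] with x hx
    rw [← mul_add]
    exact congrArg _ hx
  · filter_upwards [hC.coeFn_L2eta_smul c f] with x hx
    rw [mul_left_comm]
    exact congrArg _ hx
  · have h1 : ∫ x in Ioo (0 : ℝ) 1, 1 / sigma a b x * (ρ x * w x) ^ 2 ≤
        ∫ x in Ioo (0 : ℝ) 1, C * (eta a b x * w x ^ 2) := by
      refine integral_mono_ae (hint w) (hdom w) ?_
      filter_upwards [ae_restrict_mem measurableSet_Ioo] with x hx using hle w x hx
    refine h1.trans_eq ?_
    rw [integral_const_mul]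
    exact congrArg _ (hC.norm_sq_L2eta w).symm

/-- Weighted primitives `w ↦ ρ ∫₀ˣ w`. -/
theorem exists_primOp {ρ : ℝ → ℝ} (hρ : ContinuousOn ρ (Ioo 0 1))
    (hi : Integrable (fun x => 1 / sigma a b x * ρ x ^ 2 * x) muI) :
    ∃ L : L2eta a b →L[ℝ] L2 a b, ∀ w, L w =ᵐ[muI] fun x => ρ x * ∫ s in (0 : ℝ)..x, w s := by
  obtain ⟨C, hC0, hinc⟩ := hC.exists_increment_bound
  have hle : ∀ w : L2eta a b, ∀ x ∈ Ioo (0 : ℝ) 1,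
      1 / sigma a b x * (ρ x * ∫ s in (0 : ℝ)..x, w s) ^ 2 ≤
        C * ‖w‖ ^ 2 * (1 / sigma a b x * ρ x ^ 2 * x) := fun w x hx => by
    have h1 := hinc 0 x le_rfl hx.1.le hx.2.le w
    have h2 : 0 ≤ 1 / sigma a b x * ρ x ^ 2 := mul_nonneg (hC.weight_pos x hx).le (sq_nonneg _)
    calc _ = 1 / sigma a b x * ρ x ^ 2 * (∫ s in (0 : ℝ)..x, w s) ^ 2 := by ring
      _ ≤ 1 / sigma a b x * ρ x ^ 2 * (C * (x - 0) * ‖w‖ ^ 2) := mul_le_mul_of_nonneg_left h1 h2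
      _ = _ := by ring
  have hmeas : ∀ w : L2eta a b,
      AEStronglyMeasurable (fun x => ρ x * ∫ s in (0 : ℝ)..x, w s) muI := fun w =>
    (hρ.mul ((hC.continuousOn_primitive w).mono
      Ioo_subset_Icc_self)).aestronglyMeasurable measurableSet_Ioo
  have hint : ∀ w : L2eta a b, Integrable
      (fun x => 1 / sigma a b x * (ρ x * ∫ s in (0 : ℝ)..x, w s) ^ 2) muI := fun w => by
    refine (hi.const_mul (C * ‖w‖ ^ 2)).mono'
      ((hC.cont_weight.aestronglyMeasurable measurableSet_Ioo).mul ((hmeas w).pow 2)) ?_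
    filter_upwards [ae_restrict_mem measurableSet_Ioo] with x hx
    rw [Real.norm_of_nonneg (mul_nonneg (hC.weight_pos x hx).le (sq_nonneg _))]
    exact hle w x hx
  refine (exists_clm_muW (ρ := eta a b) hC.cont_weight hC.weight_pos
    (fun (w : L2eta a b) x => ρ x * ∫ s in (0 : ℝ)..x, w s) (fun f g => ?_) (fun c f => ?_)
    hmeas hint (C := C * ∫ x in Ioo (0 : ℝ) 1, 1 / sigma a b x * ρ x ^ 2 * x)
    fun w => ?_).imp fun L hL => hL.1
  · filter_upwards [ae_restrict_mem measurableSet_Ioo] with x hx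
    rw [← mul_add]
    exact congrArg _ (hC.primitive_add f g (Ioo_subset_Icc_self hx))
  · filter_upwards [ae_restrict_mem measurableSet_Ioo] with x hx
    rw [mul_left_comm]
    exact congrArg _ (hC.primitive_smul c f (Ioo_subset_Icc_self hx))
  · rw [mul_right_comm, ← integral_const_mul]
    refine integral_mono_ae (hint w) (hi.const_mul _) ?_
    filter_upwards [ae_restrict_mem measurableSet_Ioo] with x hx using hle w x hx

end Operators

end Coeffs

/-! ### Test functions and the lemma of du Bois-Reymond -/

section TestFunctions

/-- Smooth functions with compact support in `(0,1)`. -/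
structure IsTest (φ : ℝ → ℝ) : Prop where
  smooth : ContDiff ℝ ∞ φ
  compact : HasCompactSupport φ
  supp : tsupport φ ⊆ Ioo 0 1

theorem IsTest.eq_zero {φ : ℝ → ℝ} (h : IsTest φ) {x : ℝ} (hx : x ∉ Ioo (0 : ℝ) 1) : φ x = 0 :=
  image_eq_zero_of_notMem_tsupport fun h' => hx (h.supp h')

theorem IsTest.deriv {φ : ℝ → ℝ} (h : IsTest φ) : IsTest (deriv φ) :=
  ⟨(contDiff_infty_iff_deriv.1 h.smooth).2, h.compact.deriv, tsupport_deriv_subset.trans h.supp⟩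

theorem IsTest.hasDerivAt {φ : ℝ → ℝ} (h : IsTest φ) (x : ℝ) :
    HasDerivAt φ (_root_.deriv φ x) x :=
  ((contDiff_infty_iff_deriv.1 h.smooth).1 x).hasDerivAt

/-- All the mass of a test function sits in a compact interval inside `(0,1)`. -/
theorem IsTest.exists_Icc {φ : ℝ → ℝ} (h : IsTest φ) : ∃ α β : ℝ, 0 < α ∧ α < β ∧ β < 1 ∧
    ∀ x, x ∉ Icc α β → φ x = 0 := by
  have hK : IsCompact (insert (1 / 2) (insert (1 / 3) (tsupport φ))) :=
    (h.compact.insert _).insert _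
  obtain ⟨α, hα, hα'⟩ := hK.exists_isLeast (insert_nonempty _ _)
  obtain ⟨β, hβ, hβ'⟩ := hK.exists_isGreatest (insert_nonempty _ _)
  have hsub : insert (1 / 2 : ℝ) (insert (1 / 3) (tsupport φ)) ⊆ Ioo (0 : ℝ) 1 := by
    refine insert_subset (by norm_num) (insert_subset (by norm_num) h.supp)
  have h1 : α ≤ 1 / 3 := hα' (by simp)
  have h2 : 1 / 2 ≤ β := hβ' (by simp)
  refine ⟨α, β, (hsub hα).1, by linarith, (hsub hβ).2, fun x hx => ?_⟩
  refine image_eq_zero_of_notMem_tsupport fun h' => hx ⟨hα' ?_, hβ' ?_⟩ <;> simp [h']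

theorem IsTest.integrable_mul {φ h : ℝ → ℝ} (hφ : IsTest φ)
    (hh : LocallyIntegrableOn h (Ioo 0 1)) : Integrable (fun x => h x * φ x) := by
  have h1 : IntegrableOn (fun x => h x * φ x) (tsupport φ) :=
    (hh.integrableOn_compact_subset hφ.supp hφ.compact).mul_continuousOn
      hφ.smooth.continuous.continuousOn hφ.compact
  refine (integrableOn_iff_integrable_of_support_subset ?_).1 h1
  exact (Function.support_mul_subset_right _ _).trans (subset_tsupport _)

theorem IsTest.setIntegral_mul {φ : ℝ → ℝ} (hφ : IsTest φ) (h : ℝ → ℝ) :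
    ∫ x in Ioo (0 : ℝ) 1, h x * φ x = ∫ x, h x * φ x :=
  setIntegral_eq_integral_of_forall_compl_eq_zero fun x hx => by rw [hφ.eq_zero hx, mul_zero]

theorem exists_isTest_integral_eq_one : ∃ ψ, IsTest ψ ∧ ∫ x, ψ x = 1 := by
  obtain ⟨f, h1, h2, h3, h4, h5⟩ := exists_contDiff_tsupport_subset (n := ⊤)
    (Ioo_mem_nhds (show (0 : ℝ) < 1 / 2 by norm_num) (show (1 / 2 : ℝ) < 1 by norm_num))
  have hpos : 0 < ∫ x, f x := by
    refine Continuous.integral_pos_of_hasCompactSupport_nonneg_nonzero (x := 1 / 2)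
      h3.continuous h2 (fun x => (h4 (mem_range_self x)).1) ?_
    rw [h5]
    exact one_ne_zero
  refine ⟨fun x => (∫ x, f x)⁻¹ * f x, ⟨contDiff_const.mul h3, h2.mul_left, ?_⟩, ?_⟩
  · exact tsupport_mul_subset_right.trans h1
  · rw [integral_const_mul, inv_mul_cancel₀ hpos.ne']

theorem IsTest.primitive {χ : ℝ → ℝ} (h : IsTest χ) (h0 : ∫ x, χ x = 0) :
    IsTest fun x => ∫ s in (0 : ℝ)..x, χ s := by
  have hd : _root_.deriv (fun x => ∫ s in (0 : ℝ)..x, χ s) = χ :=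
    funext fun x => h.smooth.continuous.deriv_integral _ _ _
  obtain ⟨α, β, hα, hαβ, hβ, hz⟩ := h.exists_Icc
  have hsupp : Function.support (fun x => ∫ s in (0 : ℝ)..x, χ s) ⊆ Icc α β := by
    intro x hx
    by_contra hx'
    refine hx ?_
    rcases lt_or_ge x α with h1 | h1
    · refine intervalIntegral.integral_zero_ae (Eventually.of_forall fun s hs => hz s fun hs' => ?_)
      rcases mem_uIoc.1 hs with h2 | h2 <;> linarith [hs'.1, h2.1, h2.2]
    · have h2 : β < x := by
        by_contra h2
        exact hx' ⟨h1, not_lt.1 h2⟩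
      change ∫ s in (0 : ℝ)..x, χ s = 0
      rw [intervalIntegral.integral_eq_integral_of_support_subset, h0]
      intro s hs
      have h3 : s ∈ Icc α β := by
        by_contra h3
        exact hs (hz s h3)
      exact ⟨hα.trans_le h3.1, h3.2.trans h2.le⟩
  have htsupp := closure_minimal hsupp isClosed_Icc
  refine ⟨contDiff_infty_iff_deriv.2 ⟨fun x => ?_, by rw [hd]; exact h.smooth⟩,
    isCompact_Icc.of_isClosed_subset (isClosed_tsupport _) htsupp,
    fun x hx => ⟨hα.trans_le (htsupp hx).1, (htsupp hx).2.trans_lt hβ⟩⟩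
  exact (intervalIntegral.integral_hasDerivAt_right (h.smooth.continuous.intervalIntegrable _ _)
    (h.smooth.continuous.stronglyMeasurableAtFilter _ _)
    h.smooth.continuous.continuousAt).differentiableAt

/-- The lemma of du Bois-Reymond: a function with vanishing distributional derivative is
constant. -/
theorem exists_ae_eq_const {h : ℝ → ℝ} (hh : LocallyIntegrableOn h (Ioo 0 1))
    (H : ∀ φ, IsTest φ → ∫ x in Ioo (0 : ℝ) 1, h x * deriv φ x = 0) :
    ∃ k : ℝ, h =ᵐ[muI] fun _ => k := by
  obtain ⟨ψ, hψ, hψ1⟩ := exists_isTest_integral_eq_one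
  set k : ℝ := ∫ x, h x * ψ x with hk
  refine ⟨k, ?_⟩
  have hloc : LocallyIntegrableOn (fun x => h x - k) (Ioo 0 1) :=
    hh.sub (locallyIntegrableOn_const k)
  have key : ∀ χ, IsTest χ → ∫ x, (h x - k) * χ x = 0 := fun χ hχ => by
    set c : ℝ := ∫ x, χ x with hc
    have hcont : Integrable χ := hχ.smooth.continuous.integrable_of_hasCompactSupport hχ.compact
    have hcontψ : Integrable ψ := hψ.smooth.continuous.integrable_of_hasCompactSupport hψ.compact
    have hθ : IsTest fun x => χ x - c * ψ x := by
      refine ⟨hχ.smooth.sub (contDiff_const.mul hψ.smooth), hχ.compact.sub hψ.compact.mul_left, ?_⟩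
      refine (tsupport_sub _ _).trans (union_subset hχ.supp ?_)
      exact tsupport_mul_subset_right.trans hψ.supp
    have h0 : ∫ x, (χ x - c * ψ x) = 0 := by
      rw [integral_sub hcont (hcontψ.const_mul c), integral_const_mul, hψ1, mul_one, sub_self]
    have h1 := H _ (hθ.primitive h0)
    have hd : deriv (fun x => ∫ s in (0 : ℝ)..x, (χ s - c * ψ s)) = fun x => χ x - c * ψ x :=
      funext fun x => hθ.smooth.continuous.deriv_integral _ _ _
    rw [hd, hθ.setIntegral_mul] at h1
    have h2 : ∫ x, h x * (χ x - c * ψ x) = (∫ x, h x * χ x) - c * k := by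
      rw [hk, ← integral_const_mul, ← integral_sub (hχ.integrable_mul hh)
        ((hψ.integrable_mul hh).const_mul c)]
      exact integral_congr_ae (Eventually.of_forall fun x => by ring)
    have h3 : ∫ x, (h x - k) * χ x = (∫ x, h x * χ x) - k * c := by
      rw [hc, ← integral_const_mul, ← integral_sub (hχ.integrable_mul hh) (hcont.const_mul k)]
      exact integral_congr_ae (Eventually.of_forall fun x => by ring)
    rw [h3, mul_comm k c, ← h2, h1]
  have h4 := isOpen_Ioo.ae_eq_zero_of_integral_contDiff_smul_eq_zero hloc fun g hg hg' hg'' => by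
    simpa only [smul_eq_mul, mul_comm] using key g ⟨hg, hg', hg''⟩
  rw [Filter.EventuallyEq, ae_restrict_iff' measurableSet_Ioo]
  filter_upwards [h4] with x hx hx' using sub_eq_zero.1 (hx hx')

theorem IsTest.integral_deriv {φ : ℝ → ℝ} (h : IsTest φ) (x : ℝ) :
    ∫ s in (0 : ℝ)..x, _root_.deriv φ s = φ x := by
  rw [intervalIntegral.integral_eq_sub_of_hasDerivAt (fun s _ => h.hasDerivAt s)
    (h.deriv.smooth.continuous.intervalIntegrable _ _), h.eq_zero (x := 0) (by simp), sub_zero]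

/-- The integral of the derivative of a function with compact support in `(0,1)` vanishes; this
is integration by parts for products that involve a test function. -/
theorem integral_deriv_eq_zero_of_isTest {F F' φ : ℝ → ℝ} (hφ : IsTest φ)
    (hF : ∀ x ∈ Ioo (0 : ℝ) 1, HasDerivAt F (F' x) x) (hF' : ContinuousOn F' (Ioo 0 1))
    (h0 : ∀ x, φ x = 0 → F x = 0) (h0' : ∀ x, φ x = 0 → deriv φ x = 0 → F' x = 0) :
    Integrable F' muI ∧ ∫ x in Ioo (0 : ℝ) 1, F' x = 0 := by
  obtain ⟨α, β, hα, hαβ, hβ, hz⟩ := hφ.exists_Icc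
  have hz' : ∀ x, x ∉ Icc α β → deriv φ x = 0 := fun x hx => by
    have : φ =ᶠ[𝓝 x] fun _ => 0 := by
      filter_upwards [isClosed_Icc.isOpen_compl.mem_nhds hx] with y hy using hz y hy
    rw [this.deriv_eq, deriv_const]
  -- enlarge the interval, so that `φ` vanishes at its endpoints
  set α' := α / 2 with hα'
  set β' := (β + 1) / 2 with hβ'
  have e1 : 0 < α' := by linarith
  have e2 : α' < α := by linarith
  have e3 : β < β' := by linarith
  have e4 : β' < 1 := by linarith
  have hsub : Icc α' β' ⊆ Ioo (0 : ℝ) 1 := fun x hx => ⟨by linarith [hx.1], by linarith [hx.2]⟩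
  have hI : IntegrableOn F' (Icc α' β') := (hF'.mono hsub).integrableOn_compact isCompact_Icc
  have hzero : ∀ x, x ∉ Icc α' β' → F' x = 0 := fun x hx => by
    have hx' : x ∉ Icc α β := fun h => hx ⟨by linarith [h.1], by linarith [h.2]⟩
    exact h0' x (hz x hx') (hz' x hx')
  have hint : Integrable F' := by
    refine (integrableOn_iff_integrable_of_support_subset fun x hx => ?_).1 hI
    by_contra h
    exact hx (hzero x h)
  refine ⟨hint.restrict, ?_⟩
  have h1 : ∫ x in Ioo (0 : ℝ) 1, F' x = ∫ x in Ioc α' β', F' x := by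
    rw [← integral_Icc_eq_integral_Ioc]
    rw [setIntegral_eq_integral_of_forall_compl_eq_zero hzero,
      setIntegral_eq_integral_of_forall_compl_eq_zero]
    exact fun x hx => hzero x fun h => hx (hsub h)
  rw [h1, ← intervalIntegral.integral_of_le (by linarith),
    intervalIntegral.integral_eq_sub_of_hasDerivAt (f := F)]
  · rw [h0 β' (hz _ fun h => by linarith [h.2]), h0 α' (hz _ fun h => by linarith [h.1]), sub_zero]
  · intro x hx
    rw [uIcc_of_le (by linarith)] at hx
    exact hF x (hsub hx)
  · rw [intervalIntegrable_iff_integrableOn_Icc_of_le (by linarith)]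
    exact hI

end TestFunctions

/-! ### The space `H¹_{1/σ}` -/

namespace Coeffs

section Sobolev

variable {a b d : ℝ → ℝ} {Ka Kd m : ℝ} (hC : Coeffs a b d Ka Kd m)

include hC in
theorem integrable_weight_mul : Integrable (fun x => 1 / (sigma a b x * d x) * x) muI := by
  obtain ⟨C, hC0, hw⟩ := hC.exists_weight_le
  have h1 : IntegrableOn (fun x : ℝ => x ^ (1 - (Ka + Kd))) (Ioo 0 1) :=
    (intervalIntegral.integrableOn_Ioo_rpow_iff one_pos).2 (by linarith [hC.exp_lt])
  have hc : ContinuousOn (fun x => 1 / (sigma a b x * d x) * x) (Ioo 0 1) :=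
    (continuousOn_const.div ((hC.continuousOn_sigma.mul hC.deg_d.cont).mono Ioo_subset_Icc_self)
      fun x hx => (mul_pos (hC.sigma_pos ⟨hx.1, hx.2.le⟩) (hC.d_pos ⟨hx.1, hx.2.le⟩)).ne').mul
      continuousOn_id
  refine (h1.const_mul C).mono' (hc.aestronglyMeasurable measurableSet_Ioo) ?_
  filter_upwards [ae_restrict_mem measurableSet_Ioo] with x hx
  have h2 := mul_pos (hC.sigma_pos ⟨hx.1, hx.2.le⟩) (hC.d_pos ⟨hx.1, hx.2.le⟩)
  rw [Real.norm_of_nonneg (mul_nonneg (one_div_pos.2 h2).le hx.1.le)]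
  refine (mul_le_mul_of_nonneg_right (hw x hx) hx.1.le).trans_eq ?_
  rw [sub_eq_add_neg, Real.rpow_add hx.1, Real.rpow_one]
  ring

include hC in
theorem continuousOn_inv_sqrt_d : ContinuousOn (fun x => (√(d x))⁻¹) (Ioo 0 1) :=
  ((hC.deg_d.cont.mono Ioo_subset_Icc_self).sqrt).inv₀
    fun _ hx => (Real.sqrt_pos.2 (hC.d_pos ⟨hx.1, hx.2.le⟩)).ne'

include hC in
theorem inv_sqrt_d_sq {x : ℝ} (hx : x ∈ Ioo (0 : ℝ) 1) : (√(d x))⁻¹ ^ 2 = 1 / d x := by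
  rw [inv_pow, Real.sq_sqrt (hC.d_pos ⟨hx.1, hx.2.le⟩).le, one_div]

include hC in
theorem exists_primL2 : ∃ L : L2eta a b →L[ℝ] L2 a b,
    ∀ w, L w =ᵐ[muI] fun x => ∫ s in (0 : ℝ)..x, w s := by
  obtain ⟨C, hC0, hd⟩ := hC.exists_d_le
  obtain ⟨L, hL⟩ := hC.exists_primOp (ρ := fun _ => 1) continuousOn_const (by
    refine (hC.integrable_weight_mul.const_mul C).mono'
      (((hC.cont_weight.mul continuousOn_const).mul continuousOn_id).aestronglyMeasurable
        measurableSet_Ioo) ?_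
    filter_upwards [ae_restrict_mem measurableSet_Ioo] with x hx
    have h1 := hC.sigma_pos ⟨hx.1, hx.2.le⟩
    have h2 := hC.d_pos ⟨hx.1, hx.2.le⟩
    rw [Real.norm_of_nonneg (mul_nonneg (mul_nonneg (one_div_pos.2 h1).le (by simp)) hx.1.le),
      one_pow, mul_one, ← mul_assoc]
    refine mul_le_mul_of_nonneg_right ?_ hx.1.le
    rw [← div_eq_mul_one_div, div_le_div_iff₀ h1 (mul_pos h1 h2), one_mul, mul_comm]
    exact mul_le_mul_of_nonneg_right (hd x (Ioo_subset_Icc_self hx)) h1.le)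
  exact ⟨L, fun w => (hL w).trans (Eventually.of_forall fun x => one_mul _)⟩

include hC in
theorem exists_primD : ∃ L : L2eta a b →L[ℝ] L2 a b,
    ∀ w, L w =ᵐ[muI] fun x => (√(d x))⁻¹ * ∫ s in (0 : ℝ)..x, w s := by
  refine hC.exists_primOp hC.continuousOn_inv_sqrt_d (hC.integrable_weight_mul.congr ?_)
  filter_upwards [ae_restrict_mem measurableSet_Ioo] with x hx
  rw [hC.inv_sqrt_d_sq hx, one_div_mul_one_div]

include hC in
theorem exists_mulX : ∃ L : L2eta a b →L[ℝ] L2 a b, (∀ w, L w =ᵐ[muI] fun x => x * w x) ∧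
    ∀ w, ‖L w‖ ^ 2 ≤ 1 / a 1 * ‖w‖ ^ 2 := by
  refine hC.exists_mulOp continuousOn_id fun x hx => ?_
  have h1 := hC.a_pos ⟨hx.1, hx.2.le⟩
  have h2 := eta_pos (a := a) (b := b) x
  have h3 := hC.sq_le_a hx
  rw [sigma, id, div_mul_eq_mul_div, one_mul, div_le_iff₀ (by positivity)]
  calc x ^ 2 ≤ 1 / a 1 * a x := h3
    _ = _ := by field_simp

include hC in
theorem exists_mulXD : ∃ L : L2eta a b →L[ℝ] L2 a b,
    ∀ w, L w =ᵐ[muI] fun x => x * (√(d x))⁻¹ * w x := by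
  obtain ⟨L, hL, -⟩ := hC.exists_mulOp (ρ := fun x => x * (√(d x))⁻¹) (C := 1 / (a 1 * d 1))
    (continuousOn_id.mul hC.continuousOn_inv_sqrt_d) fun x hx => by
    have h1 := hC.a_pos ⟨hx.1, hx.2.le⟩
    have h4 := hC.d_pos ⟨hx.1, hx.2.le⟩
    have h2 := eta_pos (a := a) (b := b) x
    have h3 := hC.sq_le_mul hx
    rw [mul_pow, hC.inv_sqrt_d_sq hx, sigma, mul_one_div, div_mul_div_comm, one_mul,
      div_le_iff₀ (by positivity)]
    calc x ^ 2 ≤ 1 / (a 1 * d 1) * (a x * d x) := h3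
      _ = _ := by field_simp
  exact ⟨L, hL⟩

/-- The primitive `w ↦ ∫₀ˣ w`. -/
def primL2 : L2eta a b →L[ℝ] L2 a b := Classical.choose hC.exists_primL2

/-- The weighted primitive `w ↦ d^{-1/2} ∫₀ˣ w`. -/
def primD : L2eta a b →L[ℝ] L2 a b := Classical.choose hC.exists_primD

/-- The multiplier `w ↦ x w`. -/
def mulX : L2eta a b →L[ℝ] L2 a b := Classical.choose hC.exists_mulX

/-- The weighted multiplier `w ↦ x d^{-1/2} w`. -/
def mulXD : L2eta a b →L[ℝ] L2 a b := Classical.choose hC.exists_mulXD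

theorem coeFn_primL2 (w : L2eta a b) : hC.primL2 w =ᵐ[muI] fun x => ∫ s in (0 : ℝ)..x, w s :=
  Classical.choose_spec hC.exists_primL2 w

theorem coeFn_primD (w : L2eta a b) :
    hC.primD w =ᵐ[muI] fun x => (√(d x))⁻¹ * ∫ s in (0 : ℝ)..x, w s :=
  Classical.choose_spec hC.exists_primD w

theorem coeFn_mulX (w : L2eta a b) : hC.mulX w =ᵐ[muI] fun x => x * w x :=
  (Classical.choose_spec hC.exists_mulX).1 w

theorem norm_mulX_sq_le (w : L2eta a b) : ‖hC.mulX w‖ ^ 2 ≤ 1 / a 1 * ‖w‖ ^ 2 :=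
  (Classical.choose_spec hC.exists_mulX).2 w

theorem coeFn_mulXD (w : L2eta a b) : hC.mulXD w =ᵐ[muI] fun x => x * (√(d x))⁻¹ * w x :=
  Classical.choose_spec hC.exists_mulXD w

theorem mem_H1_iff (z : WithLp 2 (L2 a b × L2eta a b)) :
    z ∈ H1 a b ↔ z.fst = hC.primL2 z.snd ∧ ∫ s in (0 : ℝ)..1, z.snd s = 0 := by
  constructor
  · rintro ⟨-, h2, h3⟩
    rw [hC.ae_muSigma] at h2
    exact ⟨hC.ext_L2 (EventuallyEq.trans h2 (hC.coeFn_primL2 z.snd).symm), h3⟩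
  · rintro ⟨h1, h3⟩
    refine ⟨hC.integrableOn_L2eta _, ?_, h3⟩
    rw [hC.ae_muSigma, h1]
    exact hC.coeFn_primL2 z.snd

include hC in
theorem exists_total : ∃ e : L2eta a b, ∀ w : L2eta a b,
    inner ℝ e w = ∫ s in (0 : ℝ)..1, w s := by
  obtain ⟨C, -, h⟩ := hC.exists_increment
  obtain ⟨e, -, he⟩ := h 0 1 le_rfl zero_le_one le_rfl
  exact ⟨e, he⟩

include hC in
theorem completeSpace_H1 : CompleteSpace (H1 a b) := by
  obtain ⟨e, he⟩ := hC.exists_total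
  have h1 : IsClosed ((H1 a b : Submodule ℝ _) : Set (WithLp 2 (L2 a b × L2eta a b))) := by
    have h2 : ((H1 a b : Submodule ℝ _) : Set (WithLp 2 (L2 a b × L2eta a b))) =
        {z | WithLp.fstL 2 ℝ (L2 a b) (L2eta a b) z =
          hC.primL2 (WithLp.sndL 2 ℝ (L2 a b) (L2eta a b) z)} ∩
        {z | inner ℝ e (WithLp.sndL 2 ℝ (L2 a b) (L2eta a b) z) = 0} := by
      ext z
      rw [SetLike.mem_coe, hC.mem_H1_iff, ← he]
      rfl
    rw [h2]
    exact (isClosed_eq (by fun_prop) (by fun_prop)).inter (isClosed_eq (by fun_prop) (by fun_prop))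
  exact h1.completeSpace_coe

theorem val_eq (u : H1 a b) : val a b u = hC.primL2 (der a b u) := ((hC.mem_H1_iff _).1 u.2).1

theorem integral_der (u : H1 a b) : ∫ s in (0 : ℝ)..1, der a b u s = 0 := u.2.2.2

/-- The element of `H¹_{1/σ}` with a given derivative. -/
def ofDer (w : L2eta a b) (hw : ∫ s in (0 : ℝ)..1, w s = 0) : H1 a b :=
  ⟨WithLp.toLp 2 (hC.primL2 w, w), (hC.mem_H1_iff _).2 ⟨rfl, hw⟩⟩

include hC in
theorem ext_H1 {u v : H1 a b} (h : der a b u = der a b v) : u = v := by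
  refine Subtype.ext ((WithLp.equiv 2 _).injective (Prod.ext ?_ h))
  change val a b u = val a b v
  rw [hC.val_eq, hC.val_eq, h]

theorem norm_sq_H1 (u : H1 a b) : ‖u‖ ^ 2 = ‖val a b u‖ ^ 2 + ‖der a b u‖ ^ 2 := by
  rw [← real_inner_self_eq_norm_sq, Submodule.coe_inner, WithLp.prod_inner_apply]
  change inner ℝ (val a b u) (val a b u) + inner ℝ (der a b u) (der a b u) = _
  rw [real_inner_self_eq_norm_sq, real_inner_self_eq_norm_sq]

include hC in
/-- The Poincaré inequality. -/
theorem exists_norm_le_der : ∃ C, 0 < C ∧ ∀ u : H1 a b, ‖u‖ ^ 2 ≤ C * ‖der a b u‖ ^ 2 := by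
  refine ⟨‖hC.primL2‖ ^ 2 + 1, by positivity, fun u => ?_⟩
  rw [norm_sq_H1, hC.val_eq, add_mul, one_mul, ← mul_pow]
  gcongr
  exact hC.primL2.le_opNorm _

include hC in
/-- The value determines the derivative: the continuous representative vanishes if it vanishes almost
everywhere, and so does its derivative. -/
theorem val_injective : Function.Injective (val a b) := by
  refine (injective_iff_map_eq_zero _).2 fun u hu => ?_
  set w := der a b u with hw
  have hcont := hC.continuousOn_primitive w
  have h0 : (fun x => ∫ s in (0 : ℝ)..x, w s) =ᵐ[muI] fun _ => 0 := by
    have h1 := hC.coeFn_primL2 w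
    rw [hw, ← hC.val_eq, hu] at h1
    refine h1.symm.trans ?_
    rw [← hC.ae_muSigma]
    exact Lp.coeFn_zero ℝ 2 (muSigma a b)
  have h1 : EqOn (fun x => ∫ s in (0 : ℝ)..x, w s) (fun _ => 0) (Ioo 0 1) :=
    Measure.eqOn_open_of_ae_eq h0 isOpen_Ioo (hcont.mono Ioo_subset_Icc_self) continuousOn_const
  have h2 := (hC.intervalIntegrable_L2eta w (left_mem_Icc.2 zero_le_one)
    (right_mem_Icc.2 zero_le_one)).ae_hasDerivAt_integral
  refine hC.ext_H1 (hC.ext_L2eta ?_)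
  have h3 : ((der a b 0 : L2eta a b) : ℝ → ℝ) =ᵐ[muI] fun _ => 0 := by
    rw [map_zero, ← hC.ae_muEta]
    exact Lp.coeFn_zero ℝ 2 (muEta a b)
  refine EventuallyEq.trans ?_ h3.symm
  rw [Filter.EventuallyEq, ae_restrict_iff' measurableSet_Ioo]
  filter_upwards [h2] with x hx hx'
  have hx'' : x ∈ uIcc (0 : ℝ) 1 := by
    rw [uIcc_of_le zero_le_one]
    exact Ioo_subset_Icc_self hx'
  have h4 := hx hx'' 0 (by simp)
  have h5 : (fun x => ∫ s in (0 : ℝ)..x, w s) =ᶠ[𝓝 x] fun _ => 0 := by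
    filter_upwards [isOpen_Ioo.mem_nhds hx'] with y hy using h1 hy
  exact h4.unique ((hasDerivAt_const x (0 : ℝ)).congr_of_eventuallyEq h5)

end Sobolev

end Coeffs

/-! ### Density and compactness in `H¹_{1/σ}` -/

namespace Coeffs

section Density

variable {a b d : ℝ → ℝ} {Ka Kd m : ℝ} (hC : Coeffs a b d Ka Kd m)

include hC in
theorem memLp_deriv {φ : ℝ → ℝ} (hφ : IsTest φ) : MemLp (deriv φ) 2 (muEta a b) := by
  obtain ⟨M, hM⟩ := hφ.deriv.compact.exists_bound_of_continuous hφ.deriv.smooth.continuous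
  exact hC.memLp_muEta_of_bounded hφ.deriv.smooth.continuous.aestronglyMeasurable
    (M := M) fun x _ => hM x

theorem integral_toLp_deriv {φ : ℝ → ℝ} (hφ : IsTest φ) {x : ℝ} (hx : x ∈ Icc (0 : ℝ) 1) :
    ∫ s in (0 : ℝ)..x, (hC.memLp_deriv hφ).toLp (deriv φ) s = φ x := by
  rw [integral_congr_of_ae (hC.coeFn_toLp_L2eta _) hx, hφ.integral_deriv]

/-- Test functions as elements of `H¹_{1/σ}`. -/
def test {φ : ℝ → ℝ} (hφ : IsTest φ) : H1 a b :=
  hC.ofDer ((hC.memLp_deriv hφ).toLp (deriv φ)) (by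
    rw [hC.integral_toLp_deriv hφ (right_mem_Icc.2 zero_le_one), hφ.eq_zero (by simp)])

theorem coeFn_der_test {φ : ℝ → ℝ} (hφ : IsTest φ) :
    der a b (hC.test hφ) =ᵐ[muI] deriv φ := hC.coeFn_toLp_L2eta (hC.memLp_deriv hφ)

theorem integral_der_test {φ : ℝ → ℝ} (hφ : IsTest φ) {x : ℝ} (hx : x ∈ Icc (0 : ℝ) 1) :
    ∫ s in (0 : ℝ)..x, der a b (hC.test hφ) s = φ x := hC.integral_toLp_deriv hφ hx

include hC in
theorem coeFn_val (u : H1 a b) : val a b u =ᵐ[muI] fun x => ∫ s in (0 : ℝ)..x, der a b u s := by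
  rw [hC.val_eq]
  exact hC.coeFn_primL2 _

theorem coeFn_val_test {φ : ℝ → ℝ} (hφ : IsTest φ) : val a b (hC.test hφ) =ᵐ[muI] φ := by
  filter_upwards [hC.coeFn_val (hC.test hφ), ae_restrict_mem measurableSet_Ioo] with x hx hx'
  rw [hx, hC.integral_der_test hφ (Ioo_subset_Icc_self hx')]

theorem coeFn_primD_test {φ : ℝ → ℝ} (hφ : IsTest φ) :
    hC.primD (der a b (hC.test hφ)) =ᵐ[muI] fun x => (√(d x))⁻¹ * φ x := by
  filter_upwards [hC.coeFn_primD (der a b (hC.test hφ)), ae_restrict_mem measurableSet_Ioo]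
    with x hx hx'
  rw [hx, hC.integral_der_test hφ (Ioo_subset_Icc_self hx')]

/-- The subspace of test functions. -/
def tests : Submodule ℝ (H1 a b) where
  carrier := {u | ∃ φ, IsTest φ ∧ der a b u =ᵐ[muI] deriv φ}
  zero_mem' := by
    refine ⟨fun _ => 0, ⟨contDiff_const, HasCompactSupport.zero, by simp [tsupport]⟩, ?_⟩
    rw [map_zero, ← hC.ae_muEta]
    filter_upwards [Lp.coeFn_zero ℝ 2 (muEta a b)] with x hx
    rw [hx]
    simp
  add_mem' := by
    rintro u v ⟨φ, hφ, hu⟩ ⟨ψ, hψ, hv⟩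
    refine ⟨fun x => φ x + ψ x, ⟨hφ.smooth.add hψ.smooth, hφ.compact.add hψ.compact,
      (tsupport_add φ ψ).trans (union_subset hφ.supp hψ.supp)⟩, ?_⟩
    rw [map_add]
    filter_upwards [hC.coeFn_L2eta_add (der a b u) (der a b v), hu, hv] with x h1 h2 h3
    rw [h1, h2, h3]
    exact ((hφ.hasDerivAt x).add (hψ.hasDerivAt x)).deriv.symm
  smul_mem' := by
    rintro c u ⟨φ, hφ, hu⟩
    refine ⟨fun x => c * φ x, ⟨contDiff_const.mul hφ.smooth, hφ.compact.mul_left,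
      tsupport_mul_subset_right.trans hφ.supp⟩, ?_⟩
    rw [map_smul]
    filter_upwards [hC.coeFn_L2eta_smul c (der a b u), hu] with x h1 h2
    rw [h1, h2]
    exact ((hφ.hasDerivAt x).const_mul c).deriv.symm

theorem test_mem_tests {φ : ℝ → ℝ} (hφ : IsTest φ) : hC.test hφ ∈ hC.tests :=
  ⟨φ, hφ, hC.coeFn_der_test hφ⟩

theorem exists_eq_test {u : H1 a b} (hu : u ∈ hC.tests) :
    ∃ (φ : ℝ → ℝ) (hφ : IsTest φ), u = hC.test hφ := by
  obtain ⟨φ, hφ, h⟩ := hu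
  exact ⟨φ, hφ, hC.ext_H1 (hC.ext_L2eta (h.trans (hC.coeFn_der_test hφ).symm))⟩

/-- A bounded functional on `H¹_{1/σ}` that vanishes on test functions is zero: it is represented
by some `y ∈ L²_η` with `(η y)' = 0`. -/
theorem functional_eq_zero_of_test (ℓ : H1 a b →L[ℝ] ℝ)
    (h : ∀ φ (hφ : IsTest φ), ℓ (hC.test hφ) = 0) (u : H1 a b) : ℓ u = 0 := by
  obtain ⟨C, hC0, hle⟩ := hC.exists_norm_le_der
  obtain ⟨y, -, hy⟩ := exists_inner_eq_of_le (der a b : H1 a b →ₗ[ℝ] L2eta a b)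
    (ℓ : H1 a b →ₗ[ℝ] ℝ) (C := ‖ℓ‖ * √C) (by positivity) fun q => by
    refine (ℓ.le_opNorm q).trans ?_
    rw [mul_assoc]
    refine mul_le_mul_of_nonneg_left ?_ ℓ.opNorm_nonneg
    change ‖q‖ ≤ √C * ‖der a b q‖
    rw [← Real.sqrt_sq (norm_nonneg (der a b q)), ← Real.sqrt_mul hC0.le]
    exact Real.le_sqrt_of_sq_le (hle q)
  have hy' : ∀ v : H1 a b, ℓ v = ∫ x in Ioo (0 : ℝ) 1, eta a b x * (y x * der a b v x) :=
    fun v => (hy v).trans (hC.inner_L2eta _ _)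
  have hI : IntegrableOn (fun x => eta a b x * y x) (Ioo 0 1) := by
    rw [← integrableOn_Icc_iff_integrableOn_Ioo]
    refine IntegrableOn.continuousOn_mul hC.continuousOn_eta ?_ isCompact_Icc
    rw [integrableOn_Icc_iff_integrableOn_Ioo]
    exact hC.integrableOn_L2eta y
  obtain ⟨k, hk⟩ := exists_ae_eq_const hI.locallyIntegrableOn fun φ hφ => by
    refine Eq.trans (integral_congr_ae ?_) ((hy' _).symm.trans (h φ hφ))
    filter_upwards [hC.coeFn_der_test hφ] with x hx
    rw [hx, mul_assoc]
  rw [hy']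
  have h1 : ∫ x in Ioo (0 : ℝ) 1, eta a b x * (y x * der a b u x) =
      ∫ x in Ioo (0 : ℝ) 1, k * der a b u x := by
    refine integral_congr_ae ?_
    filter_upwards [hk] with x hx
    rw [← mul_assoc, hx]
  have h2 := integral_der u
  rw [intervalIntegral.integral_of_le zero_le_one, integral_Ioc_eq_integral_Ioo] at h2
  rw [h1, integral_const_mul, h2, mul_zero]

theorem dense_tests : Dense (hC.tests : Set (H1 a b)) := by
  have := hC.completeSpace_H1
  rw [Submodule.dense_iff_topologicalClosure_eq_top, Submodule.topologicalClosure_eq_top_iff,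
    Submodule.eq_bot_iff]
  intro v hv
  have h1 := hC.functional_eq_zero_of_test (innerSL ℝ v) (fun φ hφ => by
    rw [innerSL_apply_apply]
    exact (Submodule.mem_orthogonal' _ _).1 hv _ (hC.test_mem_tests hφ)) v
  rwa [innerSL_apply_apply, inner_self_eq_zero] at h1

/-- Closed conditions on `H¹_{1/σ}` need only be checked on test functions. -/
theorem test_induction {P : H1 a b → Prop} (hP : IsClosed {u | P u})
    (h : ∀ φ (hφ : IsTest φ), P (hC.test hφ)) (u : H1 a b) : P u := by
  refine hP.closure_subset_iff.2 (fun v hv => ?_) (hC.dense_tests u)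
  obtain ⟨φ, hφ, rfl⟩ := hC.exists_eq_test hv
  exact h φ hφ

include hC in
theorem integrableOn_weight_mul (g : L2 a b) {ρ : ℝ → ℝ} (hρ : ContinuousOn ρ (Ioc 0 1))
    {δ : ℝ} (hδ : 0 < δ) : IntegrableOn (fun x => ρ x * (1 / sigma a b x * g x)) (Icc δ 1) := by
  have hsub : Icc δ 1 ⊆ Ioc (0 : ℝ) 1 := fun x hx => ⟨hδ.trans_le hx.1, hx.2⟩
  refine IntegrableOn.continuousOn_mul (hρ.mono hsub) ?_ isCompact_Icc
  have hw : ContinuousOn (fun x => 1 / sigma a b x) (Icc δ 1) :=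
    continuousOn_const.div (hC.continuousOn_sigma.mono (hsub.trans Ioc_subset_Icc_self))
      fun x hx => (hC.sigma_pos (hsub hx)).ne'
  rw [integrableOn_Icc_iff_integrableOn_Ioo]
  have hsub' : Ioo δ 1 ⊆ Ioo 0 1 := Ioo_subset_Ioo_left hδ.le
  have h1 : IntegrableOn (fun x => 1 / sigma a b x * (g x * g x) + 1 / sigma a b x) (Ioo δ 1) :=
    (IntegrableOn.mono_set (hC.integrable_L2_mul g g) hsub').add
      ((hw.integrableOn_compact isCompact_Icc).mono_set Ioo_subset_Icc_self)
  refine Integrable.mono' h1 ?_ ?_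
  · exact ((hw.mono Ioo_subset_Icc_self).aestronglyMeasurable measurableSet_Ioo).mul
      ((hC.aestronglyMeasurable_L2 g).mono_measure (Measure.restrict_mono hsub' le_rfl))
  · filter_upwards [ae_restrict_mem measurableSet_Ioo] with x hx
    have hp := hC.weight_pos x (hsub' hx)
    rw [Real.norm_eq_abs, abs_mul, abs_of_pos hp]
    have h2 : |g x| ≤ g x * g x + 1 := by
      rw [← abs_mul_abs_self]
      nlinarith [sq_nonneg (|g x| - 1), abs_nonneg (g x)]
    nlinarith

include hC in
theorem locallyIntegrableOn_weight_mul (g : L2 a b) {ρ : ℝ → ℝ} (hρ : ContinuousOn ρ (Ioc 0 1)) :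
    LocallyIntegrableOn (fun x => ρ x * (1 / sigma a b x * g x)) (Ioo 0 1) := fun x hx =>
  ⟨Icc (x / 2) 1, mem_nhdsWithin_of_mem_nhds (Icc_mem_nhds (half_lt_self hx.1) hx.2),
    hC.integrableOn_weight_mul g hρ (half_pos hx.1)⟩

include hC in
theorem denseRange_val : DenseRange (val a b) := by
  refine denseRange_of_inner_eq_zero _ fun g hg => ?_
  have hloc : LocallyIntegrableOn (fun x => 1 / sigma a b x * g x) (Ioo 0 1) := by
    simpa only [one_mul] using hC.locallyIntegrableOn_weight_mul g (ρ := fun _ => 1)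
      continuousOn_const
  have h1 := isOpen_Ioo.ae_eq_zero_of_integral_contDiff_smul_eq_zero hloc fun φ h1 h2 h3 => by
    have hφ : IsTest φ := ⟨h1, h2, h3⟩
    have h4 := hg (hC.test hφ)
    rw [hC.inner_L2] at h4
    simp only [smul_eq_mul]
    simp only [mul_comm (φ _)]
    rw [← hφ.setIntegral_mul]
    refine Eq.trans (integral_congr_ae ?_) h4
    filter_upwards [hC.coeFn_val_test hφ] with x hx
    rw [hx]
    ring
  have h2 : (g : ℝ → ℝ) =ᵐ[muI] fun _ => 0 := by
    rw [Filter.EventuallyEq, ae_restrict_iff' measurableSet_Ioo]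
    filter_upwards [h1] with x hx hx'
    exact (mul_eq_zero.1 (hx hx')).resolve_left (hC.weight_pos x hx').ne'
  refine hC.ext_L2 (h2.trans ?_)
  rw [← hC.ae_muSigma]
  exact (Lp.coeFn_zero ℝ 2 (muSigma a b)).symm

end Density

section Compactness

variable {a b d : ℝ → ℝ} {Ka Kd m : ℝ} (hC : Coeffs a b d Ka Kd m)

theorem exists_setIntegral_lt {h : ℝ → ℝ} (hh : Integrable h muI) {ε : ℝ} (hε : 0 < ε) :
    ∃ δ ∈ Ioo (0 : ℝ) 1, ∫ x in Ioo (0 : ℝ) δ, h x < ε := by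
  have h1 : IntervalIntegrable h volume 0 1 := intervalIntegrable_of_Ioo hh (by simp)
  have h2 := intervalIntegral.continuousOn_primitive_interval' (a := 0) h1 (by simp)
  rw [uIcc_of_le zero_le_one] at h2
  have h3 := (h2 0 (by simp)).tendsto
  simp only [intervalIntegral.integral_same] at h3
  have h4 := (h3.mono_left (nhdsWithin_mono 0 Ioo_subset_Icc_self)).eventually_lt_const hε
  have : NeBot (𝓝[Ioo (0 : ℝ) 1] 0) := by
    rw [← mem_closure_iff_nhdsWithin_neBot, closure_Ioo zero_ne_one]
    simp
  obtain ⟨δ, h5, h6⟩ := (h4.and self_mem_nhdsWithin).exists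
  refine ⟨δ, h6, ?_⟩
  rwa [intervalIntegral.integral_of_le h6.1.le, integral_Ioc_eq_integral_Ioo] at h5

include hC in
/-- Near the degenerate endpoint, the contribution of a primitive to a weighted norm is small
compared with the norm of its derivative. -/
theorem exists_near_zero {p : ℝ → ℝ} (hp : ContinuousOn p (Ioo 0 1))
    (hp0 : ∀ x ∈ Ioo (0 : ℝ) 1, 0 ≤ p x) (hi : Integrable (fun x => p x * x) muI)
    {ε : ℝ} (hε : 0 < ε) : ∃ δ ∈ Ioo (0 : ℝ) 1, ∀ w : L2eta a b,
      ∫ x in Ioo (0 : ℝ) δ, p x * (∫ s in (0 : ℝ)..x, w s) ^ 2 ≤ ε * ‖w‖ ^ 2 := by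
  obtain ⟨C, hC0, hinc⟩ := hC.exists_increment_bound
  obtain ⟨δ, hδ, hlt⟩ := exists_setIntegral_lt hi (div_pos hε hC0)
  refine ⟨δ, hδ, fun w => ?_⟩
  have hsub : Ioo 0 δ ⊆ Ioo (0 : ℝ) 1 := Ioo_subset_Ioo_right hδ.2.le
  have hi' : IntegrableOn (fun x => C * ‖w‖ ^ 2 * (p x * x)) (Ioo 0 δ) :=
    (IntegrableOn.mono_set hi hsub).const_mul _
  have hle : ∀ x ∈ Ioo (0 : ℝ) δ, p x * (∫ s in (0 : ℝ)..x, w s) ^ 2 ≤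
      C * ‖w‖ ^ 2 * (p x * x) := fun x hx => by
    have h1 := hinc 0 x le_rfl hx.1.le (hsub hx).2.le w
    rw [sub_zero] at h1
    calc _ ≤ p x * (C * x * ‖w‖ ^ 2) := mul_le_mul_of_nonneg_left h1 (hp0 x (hsub hx))
      _ = _ := by ring
  calc _ ≤ ∫ x in Ioo (0 : ℝ) δ, C * ‖w‖ ^ 2 * (p x * x) := by
        refine integral_mono_ae (hi'.mono' ?_ ?_) hi' ?_
        · exact ((hp.mul (((hC.continuousOn_primitive w).mono Ioo_subset_Icc_self).pow 2)).mono
            hsub).aestronglyMeasurable measurableSet_Ioo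
        · filter_upwards [ae_restrict_mem measurableSet_Ioo] with x hx
          rw [Real.norm_of_nonneg (mul_nonneg (hp0 x (hsub hx)) (sq_nonneg _))]
          exact hle x hx
        · filter_upwards [ae_restrict_mem measurableSet_Ioo] with x hx using hle x hx
    _ = C * ‖w‖ ^ 2 * ∫ x in Ioo (0 : ℝ) δ, p x * x := integral_const_mul _ _
    _ ≤ C * ‖w‖ ^ 2 * (ε / C) := mul_le_mul_of_nonneg_left hlt.le (by positivity)
    _ = ε * ‖w‖ ^ 2 := by field_simp

theorem setIntegral_split {f : ℝ → ℝ} (hf : Integrable f muI) {δ : ℝ} (hδ : δ ∈ Ioo (0 : ℝ) 1) :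
    ∫ x in Ioo (0 : ℝ) 1, f x = (∫ x in Ioo (0 : ℝ) δ, f x) + ∫ x in Ico δ 1, f x := by
  rw [← Ioo_union_Ico_eq_Ioo hδ.1 hδ.2.le]
  refine setIntegral_union ?_ measurableSet_Ico ?_ ?_
  · exact Set.disjoint_left.2 fun x hx hx' => not_lt.2 hx'.1 hx.2
  · exact IntegrableOn.mono_set hf (Ioo_subset_Ioo_right hδ.2.le)
  · exact IntegrableOn.mono_set hf fun x hx => ⟨hδ.1.trans_le hx.1, hx.2⟩

theorem norm_primD_sq (w : L2eta a b) : ‖hC.primD w‖ ^ 2 =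
    ∫ x in Ioo (0 : ℝ) 1, 1 / (sigma a b x * d x) * (∫ s in (0 : ℝ)..x, w s) ^ 2 := by
  rw [hC.norm_sq_L2]
  refine integral_congr_ae ?_
  filter_upwards [hC.coeFn_primD w, ae_restrict_mem measurableSet_Ioo] with x hx hx'
  rw [hx, mul_pow, hC.inv_sqrt_d_sq hx', ← mul_assoc, one_div_mul_one_div]

include hC in
theorem integrable_primD_sq (w : L2eta a b) :
    Integrable (fun x => 1 / (sigma a b x * d x) * (∫ s in (0 : ℝ)..x, w s) ^ 2) muI := by
  refine (hC.integrable_L2_mul (hC.primD w) (hC.primD w)).congr ?_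
  filter_upwards [hC.coeFn_primD w, ae_restrict_mem measurableSet_Ioo] with x hx hx'
  rw [hx, ← sq, mul_pow, hC.inv_sqrt_d_sq hx', ← mul_assoc, one_div_mul_one_div]

theorem norm_primL2_sq (w : L2eta a b) : ‖hC.primL2 w‖ ^ 2 =
    ∫ x in Ioo (0 : ℝ) 1, 1 / sigma a b x * (∫ s in (0 : ℝ)..x, w s) ^ 2 := by
  rw [hC.norm_sq_L2]
  refine integral_congr_ae ?_
  filter_upwards [hC.coeFn_primL2 w] with x hx
  rw [hx]

include hC in
theorem integrable_primL2_sq (w : L2eta a b) :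
    Integrable (fun x => 1 / sigma a b x * (∫ s in (0 : ℝ)..x, w s) ^ 2) muI := by
  refine (hC.integrable_L2_mul (hC.primL2 w) (hC.primL2 w)).congr ?_
  filter_upwards [hC.coeFn_primL2 w] with x hx
  rw [hx, sq]

/-- The singular potential energy is an infinitesimal perturbation of the elastic energy. -/
theorem primD_interpolation {ε : ℝ} (hε : 0 < ε) : ∃ C, 0 ≤ C ∧ ∀ w : L2eta a b,
    ‖hC.primD w‖ ^ 2 ≤ ε * ‖w‖ ^ 2 + C * ‖hC.primL2 w‖ ^ 2 := by
  have hcont : ContinuousOn (fun x => 1 / (sigma a b x * d x)) (Ioc 0 1) :=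
    continuousOn_const.div ((hC.continuousOn_sigma.mul hC.deg_d.cont).mono Ioc_subset_Icc_self)
      fun x hx => (mul_pos (hC.sigma_pos hx) (hC.d_pos hx)).ne'
  obtain ⟨δ, hδ, hnear⟩ := hC.exists_near_zero (hcont.mono Ioo_subset_Ioc_self) (fun x hx =>
    (one_div_pos.2 (mul_pos (hC.sigma_pos ⟨hx.1, hx.2.le⟩) (hC.d_pos ⟨hx.1, hx.2.le⟩))).le)
    hC.integrable_weight_mul hε
  have hsub : Icc δ 1 ⊆ Ioc (0 : ℝ) 1 := fun x hx => ⟨hδ.1.trans_le hx.1, hx.2⟩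
  obtain ⟨x₀, hx₀, hmin⟩ := isCompact_Icc.exists_isMinOn (nonempty_Icc.2 hδ.2.le)
    (hC.deg_d.cont.mono (hsub.trans Ioc_subset_Icc_self))
  have hd0 := hC.d_pos (hsub hx₀)
  refine ⟨(d x₀)⁻¹, (inv_pos.2 hd0).le, fun w => ?_⟩
  have hsub' : Ico δ 1 ⊆ Ioo (0 : ℝ) 1 := fun x hx => ⟨hδ.1.trans_le hx.1, hx.2⟩
  rw [hC.norm_primD_sq, setIntegral_split (hC.integrable_primD_sq w) hδ]
  refine add_le_add (hnear w) ?_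
  rw [hC.norm_primL2_sq, ← integral_const_mul]
  have hI2 := (hC.integrable_primL2_sq w).const_mul (d x₀)⁻¹
  refine le_trans (setIntegral_mono_on
    (IntegrableOn.mono_set (hC.integrable_primD_sq w) hsub')
    (IntegrableOn.mono_set hI2 hsub') measurableSet_Ico fun x hx => ?_)
    (setIntegral_mono_set hI2 ?_ hsub'.eventuallyLE)
  · have h1 := hmin (Ico_subset_Icc_self hx)
    have h2 := hC.sigma_pos (hsub (Ico_subset_Icc_self hx))
    rw [← mul_assoc]
    refine mul_le_mul_of_nonneg_right ?_ (sq_nonneg _)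
    rw [← one_div_mul_one_div, mul_comm, one_div (d x)]
    exact mul_le_mul_of_nonneg_right (inv_anti₀ hd0 h1) (one_div_pos.2 h2).le
  · filter_upwards [ae_restrict_mem measurableSet_Ioo] with x hx
    exact mul_nonneg (inv_pos.2 hd0).le (mul_nonneg (hC.weight_pos x hx).le (sq_nonneg _))

include hC in
/-- Finitely many values control a primitive uniformly, up to a small multiple of the norm of its
derivative. -/
theorem exists_values {ε : ℝ} (hε : 0 < ε) : ∃ (k : ℕ) (ℓ : Fin k → L2eta a b →L[ℝ] ℝ),
    ∀ w : L2eta a b, ∀ x ∈ Ioo (0 : ℝ) 1,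
      (∫ s in (0 : ℝ)..x, w s) ^ 2 ≤ ε * ‖w‖ ^ 2 + ∑ i, ℓ i w ^ 2 := by
  obtain ⟨C, hC0, hinc⟩ := hC.exists_increment
  obtain ⟨C', hC0', hbd⟩ := hC.exists_increment_bound
  -- the values on a grid of mesh `1 / N`; the primitive is Hölder continuous of exponent `1 / 2`
  obtain ⟨N, hN⟩ := exists_nat_gt (2 * C' / ε)
  have hN0 : (0 : ℝ) < N := lt_trans (by positivity) hN
  have hgrid : ∀ i : Fin N, (0 : ℝ) ≤ i / N ∧ (i : ℝ) / N ≤ 1 := fun i => by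
    refine ⟨by positivity, (div_le_one hN0).2 ?_⟩
    exact_mod_cast i.2.le
  choose e _ he using fun i : Fin N => hinc 0 (i / N) le_rfl (hgrid i).1 (hgrid i).2
  refine ⟨N, fun i => √2 • innerSL ℝ (e i), fun w x hx => ?_⟩
  have hfl : ⌊x * N⌋₊ < N := by
    rw [Nat.floor_lt (by nlinarith [hx.1])]
    nlinarith [hx.2]
  set i : Fin N := ⟨⌊x * N⌋₊, hfl⟩ with hi
  have h1 : (i : ℝ) / N ≤ x := by
    rw [div_le_iff₀ hN0]
    exact Nat.floor_le (by nlinarith [hx.1])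
  have h2 : x - (i : ℝ) / N ≤ 1 / N := by
    have := Nat.lt_floor_add_one (x * N)
    rw [← sub_nonneg]
    have h3 : 1 / (N : ℝ) - (x - (i : ℝ) / N) = ((⌊x * N⌋₊ : ℝ) + 1 - x * N) / N := by
      rw [hi]
      field_simp
      ring
    rw [h3]
    exact div_nonneg (by linarith) hN0.le
  have h3 := hbd _ x (hgrid i).1 h1 hx.2.le w
  have h4 : C' * (x - (i : ℝ) / N) ≤ ε / 2 := by
    have h5 : C' * (1 / N) ≤ ε / 2 := by
      rw [mul_one_div, div_le_iff₀ hN0]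
      rw [div_lt_iff₀ hε] at hN
      linarith
    exact (mul_le_mul_of_nonneg_left h2 hC0'.le).trans h5
  have hx0 : x ∈ Icc (0 : ℝ) 1 := Ioo_subset_Icc_self hx
  have h5 : ∫ s in (0 : ℝ)..x, w s =
      (∫ s in (0 : ℝ)..(i / N), w s) + ∫ s in ((i : ℝ) / N)..x, w s :=
    (intervalIntegral.integral_add_adjacent_intervals
      (hC.intervalIntegrable_L2eta w (left_mem_Icc.2 zero_le_one) (hgrid i))
      (hC.intervalIntegrable_L2eta w (hgrid i) hx0)).symm
  have h6 : (√2 • innerSL ℝ (e i) : L2eta a b →L[ℝ] ℝ) w ^ 2 ≤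
      ∑ j, (√2 • innerSL ℝ (e j) : L2eta a b →L[ℝ] ℝ) w ^ 2 :=
    Finset.single_le_sum (f := fun j => (√2 • innerSL ℝ (e j) : L2eta a b →L[ℝ] ℝ) w ^ 2)
      (fun j _ => sq_nonneg _) (Finset.mem_univ i)
  have h7 : (√2 • innerSL ℝ (e i) : L2eta a b →L[ℝ] ℝ) w ^ 2 =
      2 * (∫ s in (0 : ℝ)..(i / N), w s) ^ 2 := by
    rw [← he i w]
    change (√2 * inner ℝ (e i) w) ^ 2 = _
    rw [mul_pow, Real.sq_sqrt (by norm_num)]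
  rw [h7] at h6
  rw [h5]
  nlinarith [sq_nonneg ((∫ s in (0 : ℝ)..(i / N), w s) - ∫ s in ((i : ℝ) / N)..x, w s),
    sq_nonneg ‖w‖]

/-- The primitive is a compact operator, in a quantitative form. -/
theorem primL2_compact {ε : ℝ} (hε : 0 < ε) : ∃ (k : ℕ) (ℓ : Fin k → L2eta a b →L[ℝ] ℝ),
    ∀ w : L2eta a b, ‖hC.primL2 w‖ ^ 2 ≤ ε * ‖w‖ ^ 2 + ∑ i, ℓ i w ^ 2 := by
  obtain ⟨Cd, hCd, hd⟩ := hC.exists_d_le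
  have hi : Integrable (fun x => 1 / sigma a b x * x) muI := by
    refine (hC.integrable_weight_mul.const_mul Cd).mono'
      ((hC.cont_weight.mul continuousOn_id).aestronglyMeasurable measurableSet_Ioo) ?_
    filter_upwards [ae_restrict_mem measurableSet_Ioo] with x hx
    have h1 := hC.sigma_pos ⟨hx.1, hx.2.le⟩
    have h2 := hC.d_pos ⟨hx.1, hx.2.le⟩
    rw [Real.norm_of_nonneg (mul_nonneg (one_div_pos.2 h1).le hx.1.le), ← mul_assoc]
    refine mul_le_mul_of_nonneg_right ?_ hx.1.le
    rw [← div_eq_mul_one_div, div_le_div_iff₀ h1 (mul_pos h1 h2), one_mul, mul_comm]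
    exact mul_le_mul_of_nonneg_right (hd x (Ioo_subset_Icc_self hx)) h1.le
  obtain ⟨δ, hδ, hnear⟩ := hC.exists_near_zero hC.cont_weight
    (fun x hx => (hC.weight_pos x hx).le) hi (half_pos hε)
  have hsub : Icc δ 1 ⊆ Ioc (0 : ℝ) 1 := fun x hx => ⟨hδ.1.trans_le hx.1, hx.2⟩
  have hsub' : Ico δ 1 ⊆ Ioo (0 : ℝ) 1 := fun x hx => ⟨hδ.1.trans_le hx.1, hx.2⟩
  have hw : ContinuousOn (fun x => 1 / sigma a b x) (Icc δ 1) :=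
    continuousOn_const.div (hC.continuousOn_sigma.mono (hsub.trans Ioc_subset_Icc_self))
      fun x hx => (hC.sigma_pos (hsub hx)).ne'
  have hIw : IntegrableOn (fun x => 1 / sigma a b x) (Ico δ 1) :=
    (hw.integrableOn_compact isCompact_Icc).mono_set Ico_subset_Icc_self
  set W : ℝ := ∫ x in Ico δ 1, 1 / sigma a b x with hW
  have hW0 : 0 ≤ W := setIntegral_nonneg measurableSet_Ico
    fun x hx => (hC.weight_pos x (hsub' hx)).le
  obtain ⟨k, ℓ, hℓ⟩ := hC.exists_values (ε := ε / (2 * (W + 1))) (by positivity)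
  refine ⟨k, fun i => √W • ℓ i, fun w => ?_⟩
  -- away from `0` the weight has the finite mass `W`, and finitely many values suffice
  have hfar : ∫ x in Ico δ 1, 1 / sigma a b x * (∫ s in (0 : ℝ)..x, w s) ^ 2 ≤
      W * (ε / (2 * (W + 1)) * ‖w‖ ^ 2 + ∑ i, ℓ i w ^ 2) := by
    rw [hW, ← integral_mul_const]
    refine setIntegral_mono_on (IntegrableOn.mono_set (hC.integrable_primL2_sq w) hsub')
      (hIw.mul_const _) measurableSet_Ico fun x hx => ?_
    exact mul_le_mul_of_nonneg_left (hℓ w x (hsub' hx)) (hC.weight_pos x (hsub' hx)).le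
  have hs : ∑ i, (√W • ℓ i) w ^ 2 = W * ∑ i, ℓ i w ^ 2 := by
    rw [Finset.mul_sum]
    refine Finset.sum_congr rfl fun i _ => ?_
    change (√W * ℓ i w) ^ 2 = _
    rw [mul_pow, Real.sq_sqrt hW0]
  have hWε : W * (ε / (2 * (W + 1))) ≤ ε / 2 := by
    rw [mul_div_assoc', div_le_div_iff₀ (by positivity) two_pos]
    nlinarith
  rw [hC.norm_primL2_sq, setIntegral_split (hC.integrable_primL2_sq w) hδ, hs]
  have h8 := hnear w
  have h9 := mul_le_mul_of_nonneg_right hWε (sq_nonneg ‖w‖)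
  linarith [hfar]

end Compactness

section HardyPoincare

variable {a b d : ℝ → ℝ} {Ka Kd m : ℝ} (hC : Coeffs a b d Ka Kd m)

theorem isHPConst_iff (C : ℝ) : IsHPConst a b d C ↔
    0 < C ∧ ∀ u : H1 a b, ‖hC.primD (der a b u)‖ ^ 2 ≤ C * ‖der a b u‖ ^ 2 := by
  have h1 : ∀ u : H1 a b, (fun x => 1 / (sigma a b x * d x) *
      (∫ s in (0 : ℝ)..x, der a b u s) ^ 2) =ᵐ[muI]
      fun x => (val a b u x) ^ 2 / (sigma a b x * d x) := fun u => by
    filter_upwards [hC.coeFn_val u] with x hx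
    rw [hx]
    ring
  refine and_congr_right fun _ => forall_congr' fun u => ?_
  rw [hC.norm_primD_sq, hC.norm_sq_L2eta, integral_congr_ae (h1 u)]
  exact and_iff_right ((hC.integrable_primD_sq (der a b u)).congr (h1 u))

include hC in
theorem CHP_nonneg : 0 ≤ CHP a b d :=
  Real.sInf_nonneg fun C hC' => ((hC.isHPConst_iff C).1 hC').1.le

/-- The best constant is attained in the sense that it is itself admissible. -/
theorem norm_primD_sq_le (u : H1 a b) :
    ‖hC.primD (der a b u)‖ ^ 2 ≤ CHP a b d * ‖der a b u‖ ^ 2 := by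
  rcases eq_or_ne (der a b u) 0 with h | h
  · simp [h]
  · have h1 : 0 < ‖der a b u‖ ^ 2 := pow_pos (norm_pos_iff.2 h) 2
    rw [← div_le_iff₀ h1]
    refine le_csInf ⟨‖hC.primD‖ ^ 2 + 1, (hC.isHPConst_iff _).2 ⟨by positivity, fun v => ?_⟩⟩
      fun C hC' => ?_
    · calc ‖hC.primD (der a b v)‖ ^ 2 ≤ (‖hC.primD‖ * ‖der a b v‖) ^ 2 :=
            pow_le_pow_left₀ (norm_nonneg _) (hC.primD.le_opNorm _) 2
        _ ≤ _ := by rw [mul_pow, add_mul, one_mul]; exact le_add_of_nonneg_right (sq_nonneg _)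
    · rw [div_le_iff₀ h1]
      exact ((hC.isHPConst_iff C).1 hC').2 u

end HardyPoincare

end Coeffs

/-! ### The multiplier inequalities -/

section Multiplier

/-- Integration by parts of `p φ (x φ')` for a weight `p` with logarithmic derivative `q`, where
`|x q| ≤ K`. -/
theorem isTest_multiplier_bounds {p q φ : ℝ → ℝ} {K : ℝ} (hφ : IsTest φ)
    (hp : ∀ x ∈ Ioo (0 : ℝ) 1, 0 < p x) (hd : ∀ x ∈ Ioo (0 : ℝ) 1, HasDerivAt p (p x * q x) x)
    (hq : ContinuousOn q (Ioo 0 1)) (hK : ∀ᵐ x ∂muI, |x * q x| ≤ K) :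
    (∫ x in Ioo (0 : ℝ) 1, p x * (φ x * (x * deriv φ x)) ≤
      -(1 / 2 * (1 - K) * ∫ x in Ioo (0 : ℝ) 1, p x * φ x ^ 2)) ∧
    -(1 / 2 * (1 + K) * ∫ x in Ioo (0 : ℝ) 1, p x * φ x ^ 2) ≤
      ∫ x in Ioo (0 : ℝ) 1, p x * (φ x * (x * deriv φ x)) := by
  have hpc : ContinuousOn p (Ioo 0 1) := fun x hx => (hd x hx).continuousAt.continuousWithinAt
  have hc : Continuous φ := hφ.smooth.continuous
  have hc' : Continuous (deriv φ) := hφ.deriv.smooth.continuous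
  set F' : ℝ → ℝ := fun x => p x * (φ x * (x * deriv φ x)) +
    1 / 2 * (1 + x * q x) * (p x * φ x ^ 2) with hF'
  obtain ⟨hi, h0⟩ := integral_deriv_eq_zero_of_isTest (F := fun x => 1 / 2 * (x * p x * φ x ^ 2))
    (F' := F') hφ (fun x hx => by
      have h1 := ((((hasDerivAt_id x).mul (hd x hx)).mul ((hφ.hasDerivAt x).pow 2)).const_mul
        (1 / 2 : ℝ))
      refine h1.congr_deriv ?_
      simp only [hF', id, Nat.cast_ofNat, Pi.mul_apply, Pi.pow_apply]
      ring) (by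
      have h1 : ContinuousOn φ (Ioo 0 1) := hc.continuousOn
      have h2 : ContinuousOn (deriv φ) (Ioo 0 1) := hc'.continuousOn
      fun_prop) (fun x hx => by simp [hx]) (fun x hx hx' => by simp [hF', hx])
  have hi1 : Integrable (fun x => p x * φ x ^ 2) muI := by
    refine (hφ.integrable_mul (h := fun x => p x * φ x)
      ((hpc.mul hc.continuousOn).locallyIntegrableOn measurableSet_Ioo)).restrict.congr ?_
    exact Eventually.of_forall fun x => by ring
  have hi2 : Integrable (fun x => p x * (φ x * (x * deriv φ x))) muI := by
    refine (hφ.integrable_mul (h := fun x => p x * (x * deriv φ x)) ((hpc.mul (continuousOn_id.mul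
      hc'.continuousOn)).locallyIntegrableOn measurableSet_Ioo)).restrict.congr ?_
    exact Eventually.of_forall fun x => by ring
  have hb : ∀ᵐ x ∂muI, |x * q x * (p x * φ x ^ 2)| ≤ K * (p x * φ x ^ 2) := by
    filter_upwards [hK, ae_restrict_mem measurableSet_Ioo] with x hx hx'
    have h1 : 0 ≤ p x * φ x ^ 2 := mul_nonneg (hp x hx').le (sq_nonneg _)
    rw [abs_mul, abs_of_nonneg h1]
    exact mul_le_mul_of_nonneg_right hx h1
  constructor
  · have h1 : ∫ x in Ioo (0 : ℝ) 1, p x * (φ x * (x * deriv φ x)) ≤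
        ∫ x in Ioo (0 : ℝ) 1, (F' x - 1 / 2 * (1 - K) * (p x * φ x ^ 2)) := by
      refine integral_mono_ae hi2 (hi.sub (hi1.const_mul _)) ?_
      filter_upwards [hb] with x hx
      simp only [hF']
      linarith [(abs_le.1 hx).1]
    rwa [integral_sub hi (hi1.const_mul _), h0, integral_const_mul, zero_sub] at h1
  · have h1 : ∫ x in Ioo (0 : ℝ) 1, (F' x - 1 / 2 * (1 + K) * (p x * φ x ^ 2)) ≤
        ∫ x in Ioo (0 : ℝ) 1, p x * (φ x * (x * deriv φ x)) := by
      refine integral_mono_ae (hi.sub (hi1.const_mul _)) hi2 ?_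
      filter_upwards [hb] with x hx
      simp only [hF']
      linarith [(abs_le.1 hx).2]
    rwa [integral_sub hi (hi1.const_mul _), h0, integral_const_mul, zero_sub] at h1

end Multiplier

namespace Coeffs

section Multiplier

variable {a b d : ℝ → ℝ} {Ka Kd m : ℝ} (hC : Coeffs a b d Ka Kd m)
include hC

theorem hasDerivAt_weight {x : ℝ} (hx : x ∈ Ioo (0 : ℝ) 1) :
    HasDerivAt (fun x => 1 / sigma a b x)
      (1 / sigma a b x * (b x / a x - deriv a x / a x)) x := by
  have ha := hC.a_pos ⟨hx.1, hx.2.le⟩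
  have hη := eta_pos (a := a) (b := b) x
  have h1 := (hC.hasDerivAt_eta hx).div (hC.deg_a.hasDerivAt x hx) ha.ne'
  have h2 : (fun x => 1 / sigma a b x) = fun x => eta a b x / a x := by
    funext y
    rw [sigma, one_div, mul_inv, inv_inv]
    ring
  rw [h2]
  refine h1.congr_deriv ?_
  rw [sigma]
  field_simp

/-- The multiplier identity for a velocity: `⟨u, x u'⟩ = -½ ∫ (x / σ)' u²`, with
`(x / σ)' = (1 + x b / a - x a' / a) / σ`. -/
theorem inner_val_mulX_bounds (u : H1 a b) :
    inner ℝ (val a b u) (hC.mulX (der a b u)) ≤ -(1 / 2 * (1 - (m + Ka)) * ‖val a b u‖ ^ 2) ∧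
    -(1 / 2 * (1 + (m + Ka)) * ‖val a b u‖ ^ 2) ≤
      inner ℝ (val a b u) (hC.mulX (der a b u)) := by
  refine hC.test_induction (P := fun u => inner ℝ (val a b u) (hC.mulX (der a b u)) ≤
      -(1 / 2 * (1 - (m + Ka)) * ‖val a b u‖ ^ 2) ∧
    -(1 / 2 * (1 + (m + Ka)) * ‖val a b u‖ ^ 2) ≤
      inner ℝ (val a b u) (hC.mulX (der a b u))) ?_ (fun φ hφ => ?_) u
  · rw [ofPred_and]
    exact (isClosed_le (by fun_prop) (by fun_prop)).inter (isClosed_le (by fun_prop) (by fun_prop))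
  · have h1 := isTest_multiplier_bounds hφ hC.weight_pos (fun x hx => hC.hasDerivAt_weight hx)
      (K := m + Ka) ?_ ?_
    · have h2 : inner ℝ (val a b (hC.test hφ)) (hC.mulX (der a b (hC.test hφ))) =
          ∫ x in Ioo (0 : ℝ) 1, 1 / sigma a b x * (φ x * (x * deriv φ x)) := by
        rw [hC.inner_L2]
        refine integral_congr_ae ?_
        filter_upwards [hC.coeFn_val_test hφ, hC.coeFn_mulX (der a b (hC.test hφ)),
          hC.coeFn_der_test hφ] with x e1 e2 e3
        rw [e1, e2, e3]
      have h3 : ‖val a b (hC.test hφ)‖ ^ 2 =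
          ∫ x in Ioo (0 : ℝ) 1, 1 / sigma a b x * φ x ^ 2 := by
        rw [hC.norm_sq_L2]
        refine integral_congr_ae ?_
        filter_upwards [hC.coeFn_val_test hφ] with x e1
        rw [e1]
      rw [h2, h3]
      exact h1
    · exact ((hC.cont_drift.mono Ioo_subset_Ioc_self).sub (hC.deg_a.cont_deriv.div
        (hC.deg_a.cont.mono Ioo_subset_Icc_self) fun x hx => (hC.a_pos ⟨hx.1, hx.2.le⟩).ne'))
    · filter_upwards [hC.drift, ae_restrict_mem measurableSet_Ioo] with x hx hx'
      have h4 := hC.deg_a.deriv_le x hx'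
      rw [mul_sub, ← mul_div_assoc, ← mul_div_assoc]
      exact (abs_sub _ _).trans (add_le_add hx h4)

/-- The multiplier applied to the singular term: `∫ u x u' / (σ d) = -½ ∫ (x / (σ d))' u²`. -/
theorem inner_primD_mulXD_bounds (u : H1 a b) :
    inner ℝ (hC.primD (der a b u)) (hC.mulXD (der a b u)) ≤
      -(1 / 2 * (1 - (m + Ka + Kd)) * ‖hC.primD (der a b u)‖ ^ 2) ∧
    -(1 / 2 * (1 + (m + Ka + Kd)) * ‖hC.primD (der a b u)‖ ^ 2) ≤
      inner ℝ (hC.primD (der a b u)) (hC.mulXD (der a b u)) := by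
  refine hC.test_induction (P := fun u => inner ℝ (hC.primD (der a b u)) (hC.mulXD (der a b u)) ≤
      -(1 / 2 * (1 - (m + Ka + Kd)) * ‖hC.primD (der a b u)‖ ^ 2) ∧
    -(1 / 2 * (1 + (m + Ka + Kd)) * ‖hC.primD (der a b u)‖ ^ 2) ≤
      inner ℝ (hC.primD (der a b u)) (hC.mulXD (der a b u))) ?_ (fun φ hφ => ?_) u
  · rw [ofPred_and]
    exact (isClosed_le (by fun_prop) (by fun_prop)).inter (isClosed_le (by fun_prop) (by fun_prop))
  · have h1 := isTest_multiplier_bounds hφ (p := fun x => 1 / (sigma a b x * d x))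
      (q := fun x => b x / a x - deriv a x / a x - deriv d x / d x) (K := m + Ka + Kd)
      (fun x hx => one_div_pos.2 (mul_pos (hC.sigma_pos ⟨hx.1, hx.2.le⟩)
        (hC.d_pos ⟨hx.1, hx.2.le⟩))) (fun x hx => ?_) ?_ ?_
    · have h2 : inner ℝ (hC.primD (der a b (hC.test hφ))) (hC.mulXD (der a b (hC.test hφ))) =
          ∫ x in Ioo (0 : ℝ) 1, 1 / (sigma a b x * d x) * (φ x * (x * deriv φ x)) := by
        rw [hC.inner_L2]
        refine integral_congr_ae ?_
        filter_upwards [hC.coeFn_primD_test hφ, hC.coeFn_mulXD (der a b (hC.test hφ)),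
          hC.coeFn_der_test hφ, ae_restrict_mem measurableSet_Ioo] with x e1 e2 e3 hx
        rw [e1, e2, e3, ← one_div_mul_one_div, ← hC.inv_sqrt_d_sq hx]
        ring
      have h3 : ‖hC.primD (der a b (hC.test hφ))‖ ^ 2 =
          ∫ x in Ioo (0 : ℝ) 1, 1 / (sigma a b x * d x) * φ x ^ 2 := by
        rw [hC.norm_sq_L2]
        refine integral_congr_ae ?_
        filter_upwards [hC.coeFn_primD_test hφ, ae_restrict_mem measurableSet_Ioo] with x e1 hx
        rw [e1, ← one_div_mul_one_div, ← hC.inv_sqrt_d_sq hx]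
        ring
      rw [h2, h3]
      exact h1
    · have h4 := hC.d_pos ⟨hx.1, hx.2.le⟩
      have h5 := hC.sigma_pos ⟨hx.1, hx.2.le⟩
      have h6 := (hC.hasDerivAt_weight hx).div (hC.deg_d.hasDerivAt x hx) h4.ne'
      have h7 : (fun x => 1 / (sigma a b x * d x)) = fun x => 1 / sigma a b x / d x := by
        funext y
        rw [div_div]
      rw [h7]
      refine h6.congr_deriv ?_
      field_simp
    · exact ((hC.cont_drift.mono Ioo_subset_Ioc_self).sub (hC.deg_a.cont_deriv.div
        (hC.deg_a.cont.mono Ioo_subset_Icc_self) fun x hx => (hC.a_pos ⟨hx.1, hx.2.le⟩).ne')).sub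
        (hC.deg_d.cont_deriv.div (hC.deg_d.cont.mono Ioo_subset_Icc_self)
          fun x hx => (hC.d_pos ⟨hx.1, hx.2.le⟩).ne')
    · filter_upwards [hC.drift, ae_restrict_mem measurableSet_Ioo] with x hx hx'
      have h4 := hC.deg_a.deriv_le x hx'
      have h5 := hC.deg_d.deriv_le x hx'
      rw [mul_sub, mul_sub, ← mul_div_assoc, ← mul_div_assoc, ← mul_div_assoc]
      exact (abs_sub _ _).trans (add_le_add ((abs_sub _ _).trans (add_le_add hx h4)) h5)

end Multiplier

end Coeffs

/-! ### The energy inner product -/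

section Energy

/-- A copy of a vector space, to carry another norm. -/
def EnergyCopy (E : Type*) := E

instance {E : Type*} [h : AddCommGroup E] : AddCommGroup (EnergyCopy E) := h

instance {E : Type*} [AddCommGroup E] [h : Module ℝ E] : Module ℝ (EnergyCopy E) := h

/-- A bounded coercive symmetric bilinear form on a Hilbert space is the inner product of a
Hilbert space with the same elements and the same topology. -/
theorem exists_energySpace {E : Type} [NormedAddCommGroup E] [InnerProductSpace ℝ E]
    [CompleteSpace E] (B : E →ₗ[ℝ] E →ₗ[ℝ] ℝ) (hs : ∀ u v, B u v = B v u) {c C : ℝ} (hc : 0 < c)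
    (hl : ∀ u, c * ‖u‖ ^ 2 ≤ B u u) (hu : ∀ u, B u u ≤ C * ‖u‖ ^ 2) :
    ∃ (V : Type) (_ : NormedAddCommGroup V) (_ : InnerProductSpace ℝ V) (_ : CompleteSpace V)
      (e : E ≃L[ℝ] V), ∀ u v, inner ℝ (e u) (e v) = B u v := by
  let core : InnerProductSpace.Core ℝ (EnergyCopy E) :=
    { inner := fun u v => B u v
      conj_inner_symm := fun u v => hs v u
      re_inner_nonneg := fun u => (mul_nonneg hc.le (sq_nonneg _)).trans (hl u)
      add_left := fun u v w => LinearMap.congr_fun (B.map_add u v) w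
      smul_left := fun u v r => LinearMap.congr_fun (B.map_smul r u) v
      definite := fun u hu => by
        have h1 : c * ‖id (α := E) u‖ ^ 2 ≤ 0 := (hl u).trans_eq hu
        have h2 : ‖id (α := E) u‖ ^ 2 ≤ 0 := by
          by_contra h
          exact absurd h1 (not_le.2 (mul_pos hc (not_le.1 h)))
        exact norm_eq_zero.1 (pow_eq_zero_iff two_ne_zero |>.1 (le_antisymm h2 (sq_nonneg _))) }
  let _ : NormedAddCommGroup (EnergyCopy E) := core.toNormedAddCommGroup
  let _ : InnerProductSpace ℝ (EnergyCopy E) := InnerProductSpace.ofCore core.toCore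
  let e₀ : E ≃ₗ[ℝ] EnergyCopy E := LinearEquiv.refl ℝ E
  have hin : ∀ u v, inner ℝ (e₀ u) (e₀ v) = B u v := fun u v => rfl
  have hn : ∀ u, ‖e₀ u‖ ^ 2 = B u u := fun u => by rw [← real_inner_self_eq_norm_sq, hin]
  let e : E ≃L[ℝ] EnergyCopy E := e₀.toContinuousLinearEquivOfBounds (√(max C 0)) (√(c⁻¹))
    (fun u => by
      rw [← Real.sqrt_sq (norm_nonneg u), ← Real.sqrt_mul (le_max_right _ _)]
      refine Real.le_sqrt_of_sq_le ?_
      rw [hn]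
      exact (hu u).trans (mul_le_mul_of_nonneg_right (le_max_left _ _) (sq_nonneg _)))
    (fun v => by
      obtain ⟨u, rfl⟩ := e₀.surjective v
      rw [LinearEquiv.symm_apply_apply, ← Real.sqrt_sq (norm_nonneg (e₀ u)),
        ← Real.sqrt_mul (inv_pos.2 hc).le]
      refine Real.le_sqrt_of_sq_le ?_
      rw [hn, le_inv_mul_iff₀ hc]
      exact hl u)
  exact ⟨EnergyCopy E, inferInstance, inferInstance,
    (completeSpace_congr (e := e.toEquiv) e.isUniformEmbedding).1 inferInstance, e, hin⟩

end Energy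

/-! ### Regularity of the domain, and the multiplier identity -/

section AbsolutelyContinuous

/-- Integration by parts for absolutely continuous functions, with prescribed derivatives. -/
theorem integral_mul_add_mul_of_ae_hasDerivAt {f g f' g' : ℝ → ℝ} {α β : ℝ} (h : α ≤ β)
    (hf : AbsolutelyContinuousOnInterval f α β) (hg : AbsolutelyContinuousOnInterval g α β)
    (hf' : ∀ᵐ x, x ∈ Ioo α β → HasDerivAt f (f' x) x)
    (hg' : ∀ᵐ x, x ∈ Ioo α β → HasDerivAt g (g' x) x) :
    ∫ x in α..β, (f' x * g x + f x * g' x) = f β * g β - f α * g α := by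
  rw [← hf.integral_deriv_mul_eq_sub hg, intervalIntegral.integral_of_le h,
    intervalIntegral.integral_of_le h, integral_Ioc_eq_integral_Ioo, integral_Ioc_eq_integral_Ioo]
  refine integral_congr_ae ?_
  rw [Filter.EventuallyEq, ae_restrict_iff' measurableSet_Ioo]
  filter_upwards [hf', hg'] with x h1 h2 hx
  rw [(h1 hx).deriv, (h2 hx).deriv]

/-- A primitive on `(0,1]` of a function that is integrable away from `0`. -/
theorem primitive_from_one {G : ℝ → ℝ} (hG : ∀ δ > 0, IntegrableOn G (Icc δ 1)) :
    (∀ δ ∈ Ioo (0 : ℝ) 1, AbsolutelyContinuousOnInterval (fun x => ∫ s in (1 : ℝ)..x, G s) δ 1) ∧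
    ∀ᵐ x, x ∈ Ioo (0 : ℝ) 1 → HasDerivAt (fun x => ∫ s in (1 : ℝ)..x, G s) (G x) x := by
  have hI : ∀ δ ∈ Ioo (0 : ℝ) 1, IntervalIntegrable G volume δ 1 := fun δ hδ => by
    rw [intervalIntegrable_iff_integrableOn_Icc_of_le hδ.2.le]
    exact hG δ hδ.1
  refine ⟨fun δ hδ => (hI δ hδ).absolutelyContinuousOnInterval_intervalIntegral right_mem_uIcc, ?_⟩
  have hn : ∀ n : ℕ, (1 / ((n : ℝ) + 2)) ∈ Ioo (0 : ℝ) 1 := fun n => by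
    refine ⟨by positivity, (div_lt_one (by positivity)).2 ?_⟩
    have := n.cast_nonneg (α := ℝ)
    linarith
  have h1 := ae_all_iff.2 fun n : ℕ => (hI _ (hn n)).ae_hasDerivAt_integral
  filter_upwards [h1] with x hx hx'
  obtain ⟨n, h2⟩ := exists_nat_one_div_lt hx'.1
  have h3 : 1 / ((n : ℝ) + 2) ≤ x := by
    refine le_trans ?_ h2.le
    exact one_div_le_one_div_of_le (by positivity) (by linarith)
  refine hx n ?_ 1 right_mem_uIcc
  rw [uIcc_of_le (hn n).2.le]
  exact ⟨h3, hx'.2.le⟩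

end AbsolutelyContinuous

namespace Coeffs

section Regularity

variable {a b d : ℝ → ℝ} {Ka Kd m : ℝ} (hC : Coeffs a b d Ka Kd m)

/-- The right-hand side `(g - λ w / d) / σ` of the equation `(η w')' = (g - λ w / d) / σ`. -/
def source (_ : Coeffs a b d Ka Kd m) (lam : ℝ) (w : H1 a b) (g : L2 a b) (x : ℝ) : ℝ :=
  1 / sigma a b x * g x - lam * (1 / (sigma a b x * d x) * ∫ s in (0 : ℝ)..x, der a b w s)

theorem integrableOn_source (lam : ℝ) (w : H1 a b) (g : L2 a b) {δ : ℝ} (hδ : δ > 0) :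
    IntegrableOn (hC.source lam w g) (Icc δ 1) := by
  have hsub : Icc δ 1 ⊆ Ioc (0 : ℝ) 1 := fun x hx => ⟨hδ.trans_le hx.1, hx.2⟩
  have h1 := hC.integrableOn_weight_mul g (ρ := fun _ => 1) continuousOn_const hδ
  simp only [one_mul] at h1
  refine h1.sub (ContinuousOn.integrableOn_compact isCompact_Icc ?_)
  refine continuousOn_const.mul (ContinuousOn.mul (continuousOn_const.div
    ((hC.continuousOn_sigma.mul hC.deg_d.cont).mono (hsub.trans Ioc_subset_Icc_self))
    fun x hx => (mul_pos (hC.sigma_pos (hsub hx)) (hC.d_pos (hsub hx))).ne') ?_)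
  exact (hC.continuousOn_primitive _).mono (hsub.trans Ioc_subset_Icc_self)

/-- The equation in the sense of distributions, with the source term as a function. -/
theorem integral_flux_mul_deriv {lam : ℝ} {w : H1 a b} {g : L2 a b}
    (h : IsALambda a b d lam w g) {φ : ℝ → ℝ} (hφ : IsTest φ) :
    ∫ x in Ioo (0 : ℝ) 1, eta a b x * der a b w x * deriv φ x =
      -∫ x in Ioo (0 : ℝ) 1, hC.source lam w g x * φ x := by
  have h1 := h φ hφ.smooth hφ.compact hφ.supp
  have hI1 : Integrable (fun x => g x * φ x / sigma a b x) muI := by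
    have h2 := hC.locallyIntegrableOn_weight_mul g (ρ := fun _ => 1) continuousOn_const
    refine (hφ.integrable_mul h2).restrict.congr (Eventually.of_forall fun x => ?_)
    simp only
    ring
  have hI2 : Integrable (fun x => val a b w x * φ x / (sigma a b x * d x)) muI := by
    have h2 : ContinuousOn (fun x => 1 / (sigma a b x * d x) * ∫ s in (0 : ℝ)..x, der a b w s)
        (Ioo 0 1) := (continuousOn_const.div
      ((hC.continuousOn_sigma.mul hC.deg_d.cont).mono Ioo_subset_Icc_self)
      fun x hx => (mul_pos (hC.sigma_pos ⟨hx.1, hx.2.le⟩) (hC.d_pos ⟨hx.1, hx.2.le⟩)).ne').mul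
      ((hC.continuousOn_primitive _).mono Ioo_subset_Icc_self)
    refine (hφ.integrable_mul (h2.locallyIntegrableOn measurableSet_Ioo)).restrict.congr ?_
    filter_upwards [hC.coeFn_val w] with x hx
    rw [hx]
    ring
  have h2 : ∫ x in Ioo (0 : ℝ) 1, hC.source lam w g x * φ x =
      (∫ x in Ioo (0 : ℝ) 1, g x * φ x / sigma a b x) -
        lam * ∫ x in Ioo (0 : ℝ) 1, val a b w x * φ x / (sigma a b x * d x) := by
    rw [← integral_const_mul, ← integral_sub hI1 (hI2.const_mul lam)]
    refine integral_congr_ae ?_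
    filter_upwards [hC.coeFn_val w] with x hx
    rw [source, hx]
    ring
  rw [h2, ← h1]
  ring

/-- The flux `η w'` of an element of the domain is absolutely continuous on `(0,1]`, and its
derivative is the source term. -/
theorem exists_flux {lam : ℝ} {w : H1 a b} {g : L2 a b} (h : IsALambda a b d lam w g) :
    ∃ P : ℝ → ℝ, (∀ δ ∈ Ioo (0 : ℝ) 1, AbsolutelyContinuousOnInterval P δ 1) ∧
      (∀ᵐ x, x ∈ Ioo (0 : ℝ) 1 → HasDerivAt P (hC.source lam w g x) x) ∧
      (fun x => eta a b x * der a b w x) =ᵐ[muI] P := by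
  obtain ⟨hac, hder⟩ := primitive_from_one (G := hC.source lam w g)
    fun δ hδ => hC.integrableOn_source lam w g hδ
  set Q : ℝ → ℝ := fun x => ∫ s in (1 : ℝ)..x, hC.source lam w g s with hQ
  have hQc : ContinuousOn Q (Ioo 0 1) := fun x hx => by
    have h1 := (hac (x / 2) ⟨half_pos hx.1, by linarith [hx.1, hx.2]⟩).continuousOn
    rw [uIcc_of_le (by linarith [hx.1, hx.2])] at h1
    exact (h1.continuousAt (Icc_mem_nhds (half_lt_self hx.1) hx.2)).continuousWithinAt
  have hI : IntegrableOn (fun x => eta a b x * der a b w x) (Ioo 0 1) := by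
    rw [← integrableOn_Icc_iff_integrableOn_Ioo]
    refine IntegrableOn.continuousOn_mul hC.continuousOn_eta ?_ isCompact_Icc
    rw [integrableOn_Icc_iff_integrableOn_Ioo]
    exact hC.integrableOn_L2eta _
  have hQl : LocallyIntegrableOn Q (Ioo 0 1) := hQc.locallyIntegrableOn measurableSet_Ioo
  obtain ⟨k, hk⟩ := exists_ae_eq_const (hI.locallyIntegrableOn.sub hQl) fun φ hφ => by
    have h1 : ∫ x in Ioo (0 : ℝ) 1, Q x * deriv φ x =
        -∫ x in Ioo (0 : ℝ) 1, hC.source lam w g x * φ x := by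
      obtain ⟨α, β, hα, hαβ, hβ, hz⟩ := hφ.exists_Icc
      have hδ : α / 2 ∈ Ioo (0 : ℝ) 1 := ⟨by linarith, by linarith⟩
      have hz' : ∀ x, x ∉ Icc α β → deriv φ x = 0 := fun x hx => by
        have : φ =ᶠ[𝓝 x] fun _ => 0 := by
          filter_upwards [isClosed_Icc.isOpen_compl.mem_nhds hx] with y hy using hz y hy
        rw [this.deriv_eq, deriv_const]
      have hsub : Ioo (α / 2) 1 ⊆ Ioo (0 : ℝ) 1 := Ioo_subset_Ioo_left hδ.1.le
      have h2 := integral_mul_add_mul_of_ae_hasDerivAt hδ.2.le (hac _ hδ)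
        (hφ.smooth.of_le (by norm_cast)).contDiffOn.absolutelyContinuousOnInterval
        (hder.mono fun x hx hx' => hx (hsub hx')) (Eventually.of_forall fun x _ => hφ.hasDerivAt x)
      rw [hz 1 fun h => by linarith [h.2], hz (α / 2) fun h => by linarith [h.1], mul_zero,
        mul_zero, sub_zero, intervalIntegral.integral_of_le hδ.2.le,
        integral_Ioc_eq_integral_Ioo] at h2
      have hres : ∀ f : ℝ → ℝ, (∀ x, x ∉ Icc α β → f x = 0) →
          ∫ x in Ioo (0 : ℝ) 1, f x = ∫ x in Ioo (α / 2) 1, f x := fun f hf =>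
        setIntegral_eq_of_subset_of_forall_sdiff_eq_zero measurableSet_Ioo hsub fun x hx =>
          hf x fun h => hx.2 ⟨by linarith [h.1], hx.1.2⟩
      rw [eq_neg_iff_add_eq_zero, add_comm, ← integral_add, hres, h2]
      · exact fun x hx => by rw [hz x hx, hz' x hx]; ring
      · refine (hφ.integrable_mul fun x hx => ?_).restrict
        exact ⟨Icc (x / 2) 1, mem_nhdsWithin_of_mem_nhds (Icc_mem_nhds (half_lt_self hx.1) hx.2),
          hC.integrableOn_source lam w g (half_pos hx.1)⟩
      · exact (hφ.deriv.integrable_mul hQl).restrict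
    have h3 : ∫ x in Ioo (0 : ℝ) 1, (eta a b x * der a b w x - Q x) * deriv φ x =
        (∫ x in Ioo (0 : ℝ) 1, eta a b x * der a b w x * deriv φ x) -
          ∫ x in Ioo (0 : ℝ) 1, Q x * deriv φ x := by
      rw [← integral_sub (hφ.deriv.integrable_mul hI.locallyIntegrableOn).restrict
        (hφ.deriv.integrable_mul hQl).restrict]
      exact integral_congr_ae (Eventually.of_forall fun x => by ring)
    refine h3.trans ?_
    rw [h1, hC.integral_flux_mul_deriv h hφ, sub_self]
  refine ⟨fun x => k + Q x, fun δ hδ => ?_, ?_, ?_⟩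
  · have hconst : AbsolutelyContinuousOnInterval (fun _ : ℝ => k) δ 1 :=
      contDiffOn_const.absolutelyContinuousOnInterval
    exact hconst.add (hac δ hδ)
  · filter_upwards [hder] with x hx hx' using (hx hx').const_add k
  · filter_upwards [hk] with x hx
    have hx' : eta a b x * der a b w x - Q x = k := hx
    linarith

theorem continuousOn_Ioc_of_absolutelyContinuous {P : ℝ → ℝ}
    (hP : ∀ δ ∈ Ioo (0 : ℝ) 1, AbsolutelyContinuousOnInterval P δ 1) :
    ContinuousOn P (Ioc 0 1) := fun x hx => by
  have hδ : x / 2 ∈ Ioo (0 : ℝ) 1 := ⟨half_pos hx.1, by linarith [hx.1, hx.2]⟩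
  have h1 := (hP _ hδ).continuousOn
  rw [uIcc_of_le hδ.2.le] at h1
  refine (h1 x ⟨by linarith [hx.1], hx.2⟩).mono_of_mem_nhdsWithin ?_
  filter_upwards [self_mem_nhdsWithin, mem_nhdsWithin_of_mem_nhds (Ioi_mem_nhds
    (half_lt_self hx.1))] with y h2 h3 using ⟨le_of_lt h3, h2.2⟩

include hC in
/-- The normal derivative at `1` is the boundary value of the flux. -/
theorem hasDerivWithinAt_one {w : H1 a b} {P : ℝ → ℝ} (hP : ContinuousOn P (Ioc 0 1))
    (h : (fun x => eta a b x * der a b w x) =ᵐ[muI] P) :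
    HasDerivWithinAt (fun x => ∫ s in (0 : ℝ)..x, der a b w s) (P 1 / eta a b 1) (Icc 0 1) 1 := by
  set f : ℝ → ℝ := fun x => P x / eta a b x with hf
  have h1 : (der a b w : ℝ → ℝ) =ᵐ[muI] f := by
    filter_upwards [h] with x hx
    rw [hf]
    simp only
    rw [← hx, mul_div_cancel_left₀ _ (eta_pos x).ne']
  have hfc : ContinuousOn f (Ioc 0 1) :=
    hP.div (hC.continuousOn_eta.mono Ioc_subset_Icc_self) fun x _ => (eta_pos x).ne'
  have hI : IntervalIntegrable f volume 0 1 :=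
    intervalIntegrable_of_Ioo ((hC.integrableOn_L2eta _).congr_fun_ae h1) (by simp)
  have hmem : Ioc (0 : ℝ) 1 ∈ 𝓝[Iic 1] 1 := by
    filter_upwards [self_mem_nhdsWithin, mem_nhdsWithin_of_mem_nhds (Ioi_mem_nhds one_pos)]
      with y h2 h3 using ⟨h3, h2⟩
  have h2 := intervalIntegral.integral_hasDerivWithinAt_right hI (s := Iic 1) (t := Iic 1)
    ⟨Ioc 0 1, hmem, hfc.aestronglyMeasurable measurableSet_Ioc⟩
    ((hfc 1 (by simp)).mono_of_mem_nhdsWithin hmem)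
  refine (h2.mono Icc_subset_Iic_self).congr (fun x hx => ?_) ?_
  · exact integral_congr_of_ae h1 hx
  · exact integral_congr_of_ae h1 (right_mem_Icc.2 zero_le_one)

theorem dxAtOne_eq {w : H1 a b} {τ : ℝ}
    (h : HasDerivWithinAt (fun x => ∫ s in (0 : ℝ)..x, der a b w s) τ (Icc 0 1) 1) :
    dxAtOne a b w = τ :=
  h.derivWithin (uniqueDiffOn_Icc zero_lt_one 1 (right_mem_Icc.2 zero_le_one))

/-- A nonnegative function `f` on `(0,1)` is not integrable if `x f(x)` has a positive limit at
`0`. -/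
theorem le_zero_of_tendsto_mul {f : ℝ → ℝ} (hf : IntegrableOn f (Ioo 0 1)) {L : ℝ}
    (h : Tendsto (fun x => x * f x) (𝓝[>] 0) (𝓝 L)) : L ≤ 0 := by
  by_contra hL
  rw [not_le] at hL
  have h1 := h.eventually_const_lt (half_lt_self hL)
  obtain ⟨δ, hδ, h2⟩ := mem_nhdsGT_iff_exists_Ioo_subset.1 (h1.and (Ioo_mem_nhdsGT one_pos))
  have h3 : IntegrableOn (fun x : ℝ => x ^ (-1 : ℝ)) (Ioo 0 δ) := by
    have hsub : Ioo 0 δ ⊆ Ioo (0 : ℝ) 1 := fun x hx => (h2 hx).2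
    refine ((hf.mono_set hsub).const_mul (2 / L)).mono' ?_ ?_
    · refine ContinuousOn.aestronglyMeasurable ?_ measurableSet_Ioo
      exact ContinuousOn.rpow_const continuousOn_id fun x hx => Or.inl hx.1.ne'
    · filter_upwards [ae_restrict_mem measurableSet_Ioo] with x hx
      have h4 : L / 2 < x * f x := (h2 hx).1
      rw [Real.rpow_neg_one, Real.norm_of_nonneg (inv_pos.2 hx.1).le, inv_le_iff_one_le_mul₀ hx.1]
      calc (1 : ℝ) = 2 / L * (L / 2) := by field_simp
        _ ≤ 2 / L * (x * f x) := mul_le_mul_of_nonneg_left h4.le (by positivity)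
        _ = _ := by ring
  rw [intervalIntegral.integrableOn_Ioo_rpow_iff hδ] at h3
  exact lt_irrefl _ h3

include hC in
theorem integrable_drift (w : H1 a b) : Integrable
    (fun x => (1 - x * (b x / a x)) * (eta a b x * der a b w x ^ 2)) muI := by
  have hE : Integrable (fun x => eta a b x * der a b w x ^ 2) muI := by
    simpa only [sq] using hC.integrable_L2eta_mul (der a b w) (der a b w)
  refine hE.bdd_mul (c := 1 + m) ?_ ?_
  · exact (continuousOn_const.sub (continuousOn_id.mul (hC.cont_drift.mono
      Ioo_subset_Ioc_self))).aestronglyMeasurable measurableSet_Ioo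
  · filter_upwards [hC.drift] with x hx
    rw [← mul_div_assoc]
    exact (norm_sub_le _ _).trans (add_le_add (by simp) hx)

/-- The multiplier identity for an element `w` of the domain:
`½ η(1) w'(1)² = ⟨A w, x w'⟩ - λ ⟨w / d, x w'⟩ + ½ ∫ η (1 - x b / a) (w')²`. -/
theorem multiplier_identity {lam : ℝ} {w : H1 a b} {g : L2 a b} (h : IsALambda a b d lam w g) :
    ∃ τ, HasDerivWithinAt (fun x => ∫ s in (0 : ℝ)..x, der a b w s) τ (Icc 0 1) 1 ∧
      eta a b 1 / 2 * τ ^ 2 = inner ℝ g (hC.mulX (der a b w)) -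
        lam * inner ℝ (hC.primD (der a b w)) (hC.mulXD (der a b w)) +
        1 / 2 * ∫ x in Ioo (0 : ℝ) 1, (1 - x * (b x / a x)) * (eta a b x * der a b w x ^ 2) := by
  obtain ⟨P, hP, hP', hPe⟩ := hC.exists_flux h
  have hPc := continuousOn_Ioc_of_absolutelyContinuous hP
  refine ⟨P 1 / eta a b 1, hC.hasDerivWithinAt_one hPc hPe, ?_⟩
  -- The multiplier `R = x / η` is written as a primitive of its derivative `q`, which is continuous
  -- on `(0, 1]` only; this makes it absolutely continuous there.
  set q : ℝ → ℝ := fun x => (1 - x * (b x / a x)) / eta a b x with hq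
  have hqc : ContinuousOn q (Ioc 0 1) :=
    (continuousOn_const.sub (continuousOn_id.mul hC.cont_drift)).div
      (hC.continuousOn_eta.mono Ioc_subset_Icc_self) fun x _ => (eta_pos x).ne'
  obtain ⟨hR0, hR0'⟩ := primitive_from_one (G := q) fun δ hδ =>
    (hqc.mono fun x hx => ⟨lt_of_lt_of_le hδ hx.1, hx.2⟩).integrableOn_compact isCompact_Icc
  set R : ℝ → ℝ := fun x => 1 / eta a b 1 + ∫ s in (1 : ℝ)..x, q s with hR
  have hRac : ∀ δ ∈ Ioo (0 : ℝ) 1, AbsolutelyContinuousOnInterval R δ 1 := fun δ hδ => by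
    have hconst : AbsolutelyContinuousOnInterval (fun _ : ℝ => 1 / eta a b 1) δ 1 :=
      contDiffOn_const.absolutelyContinuousOnInterval
    exact hconst.add (hR0 δ hδ)
  have hRd : ∀ᵐ x, x ∈ Ioo (0 : ℝ) 1 → HasDerivAt R (q x) x := by
    filter_upwards [hR0'] with x hx hx' using (hx hx').const_add _
  have hReq : ∀ x ∈ Ioc (0 : ℝ) 1, R x = x / eta a b x := fun x hx => by
    have h1 := intervalIntegral.integral_eq_sub_of_hasDerivAt_of_le (f := fun x => x / eta a b x)
      (f' := q) hx.2 ?_ ?_ ?_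
    · rw [hR]
      simp only
      rw [intervalIntegral.integral_symm, h1]
      ring
    · exact continuousOn_id.div (hC.continuousOn_eta.mono fun y hy => ⟨hx.1.le.trans hy.1, hy.2⟩)
        fun y _ => (eta_pos y).ne'
    · intro y hy
      have hy' : y ∈ Ioo (0 : ℝ) 1 := ⟨hx.1.trans hy.1, hy.2⟩
      refine ((hasDerivAt_id y).div (hC.hasDerivAt_eta hy') (eta_pos y).ne').congr_deriv ?_
      have := (eta_pos (a := a) (b := b) y).ne'
      rw [hq]
      simp only [id]
      field_simp
    · rw [intervalIntegrable_iff_integrableOn_Icc_of_le hx.2]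
      exact (hqc.mono fun y hy => ⟨hx.1.trans_le hy.1, hy.2⟩).integrableOn_compact isCompact_Icc
  -- `F = (P² R)'` almost everywhere; its integral is twice the interior part of the identity
  set F : ℝ → ℝ := fun x => 2 * (1 / sigma a b x * (g x * (hC.mulX (der a b w)) x) -
    lam * (1 / sigma a b x * ((hC.primD (der a b w)) x * (hC.mulXD (der a b w)) x))) +
    (1 - x * (b x / a x)) * (eta a b x * der a b w x ^ 2) with hF
  have hE : Integrable (fun x => eta a b x * der a b w x ^ 2) muI := by
    simpa only [sq] using hC.integrable_L2eta_mul (der a b w) (der a b w)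
  have hI3 := hC.integrable_drift w
  have hI1 := hC.integrable_L2_mul g (hC.mulX (der a b w))
  have hI2 := hC.integrable_L2_mul (hC.primD (der a b w)) (hC.mulXD (der a b w))
  have hFI : Integrable F muI := ((hI1.sub (hI2.const_mul lam)).const_mul 2).add hI3
  have hFint : ∫ x in Ioo (0 : ℝ) 1, F x = 2 * (inner ℝ g (hC.mulX (der a b w)) -
      lam * inner ℝ (hC.primD (der a b w)) (hC.mulXD (der a b w))) +
      ∫ x in Ioo (0 : ℝ) 1, (1 - x * (b x / a x)) * (eta a b x * der a b w x ^ 2) := by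
    refine (integral_add ((hI1.sub (hI2.const_mul lam)).const_mul 2) hI3).trans ?_
    congr 1
    refine (integral_const_mul 2 _).trans ?_
    congr 1
    refine (integral_sub hI1 (hI2.const_mul lam)).trans ?_
    rw [integral_const_mul, hC.inner_L2, hC.inner_L2]
  have hFeq : ∀ᵐ x ∂muI, F x = (hC.source lam w g x * P x + P x * hC.source lam w g x) * R x +
      P x * P x * q x := by
    filter_upwards [hPe, hC.coeFn_mulX (der a b w), hC.coeFn_primD (der a b w),
      hC.coeFn_mulXD (der a b w), ae_restrict_mem measurableSet_Ioo] with x h1 h2 h3 h4 hx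
    have hη := (eta_pos (a := a) (b := b) x).ne'
    have hd := hC.inv_sqrt_d_sq hx
    rw [hReq x ⟨hx.1, hx.2.le⟩, ← h1, hF, hq, source]
    simp only
    rw [h2, h3, h4, ← one_div_mul_one_div, ← hd]
    field_simp
    ring
  -- the identity on `(δ, 1)`
  have hδ : ∀ δ ∈ Ioo (0 : ℝ) 1, P 1 ^ 2 / eta a b 1 - δ * (P δ ^ 2 / eta a b δ) =
      ∫ x in δ..1, F x := fun δ hδ => by
    have hsub : Ioo δ 1 ⊆ Ioo (0 : ℝ) 1 := Ioo_subset_Ioo_left hδ.1.le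
    have hPd : ∀ᵐ x, x ∈ Ioo δ 1 → HasDerivAt P (hC.source lam w g x) x :=
      hP'.mono fun x hx hx' => hx (hsub hx')
    have h1 := integral_mul_add_mul_of_ae_hasDerivAt hδ.2.le ((hP δ hδ).mul (hP δ hδ)) (hRac δ hδ)
      (hPd.mono fun x hx hx' => (hx hx').mul (hx hx'))
      (hRd.mono fun x hx hx' => hx (hsub hx'))
    have h2 : P 1 ^ 2 / eta a b 1 - δ * (P δ ^ 2 / eta a b δ) =
        (P * P) 1 * R 1 - (P * P) δ * R δ := by
      rw [hReq 1 (by simp), hReq δ ⟨hδ.1, hδ.2.le⟩]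
      simp only [Pi.mul_apply]
      ring
    rw [h2, ← h1, intervalIntegral.integral_of_le hδ.2.le, intervalIntegral.integral_of_le hδ.2.le,
      integral_Ioc_eq_integral_Ioo, integral_Ioc_eq_integral_Ioo]
    refine integral_congr_ae (EventuallyEq.symm ?_)
    filter_upwards [ae_mono (Measure.restrict_mono hsub le_rfl) hFeq] with x hx
    rw [hx]
    rfl
  -- The limit `δ → 0`: the boundary term at `δ` converges, to a nonnegative limit; the limit is not
  -- positive, as `P² / η = η (w')²` is integrable.
  have hlim : Tendsto (fun δ => ∫ x in δ..1, F x) (𝓝[>] 0) (𝓝 (∫ x in Ioo (0 : ℝ) 1, F x)) := by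
    have hFI' : IntervalIntegrable F volume 0 1 := intervalIntegrable_of_Ioo hFI (by simp)
    have h1 := intervalIntegral.continuousOn_primitive_interval' (a := 1) hFI' (by simp)
    rw [uIcc_of_le zero_le_one] at h1
    have h2 := (h1 0 (by simp)).tendsto.neg
    simp only [← intervalIntegral.integral_symm] at h2
    rw [intervalIntegral.integral_of_le zero_le_one, integral_Ioc_eq_integral_Ioo] at h2
    refine h2.mono_left ?_
    rw [← nhdsWithin_Ioo_eq_nhdsGT one_pos]
    exact nhdsWithin_mono 0 Ioo_subset_Icc_self
  have hlim' : Tendsto (fun δ => δ * (P δ ^ 2 / eta a b δ)) (𝓝[>] 0)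
      (𝓝 (P 1 ^ 2 / eta a b 1 - ∫ x in Ioo (0 : ℝ) 1, F x)) := by
    refine (tendsto_const_nhds.sub hlim).congr' ?_
    filter_upwards [Ioo_mem_nhdsGT one_pos] with δ h1
    rw [← hδ δ h1]
    ring
  have hPI : IntegrableOn (fun x => P x ^ 2 / eta a b x) (Ioo 0 1) := by
    refine hE.congr ?_
    filter_upwards [hPe] with x hx
    have hη := (eta_pos (a := a) (b := b) x).ne'
    rw [← hx]
    field_simp
  have h5 := le_zero_of_tendsto_mul hPI hlim'
  have h6 : 0 ≤ P 1 ^ 2 / eta a b 1 - ∫ x in Ioo (0 : ℝ) 1, F x := by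
    refine ge_of_tendsto hlim' ?_
    filter_upwards [self_mem_nhdsWithin] with δ h1
    have h1' : 0 < δ := h1
    exact mul_nonneg h1'.le (div_nonneg (sq_nonneg _) (eta_pos δ).le)
  have h7 : P 1 ^ 2 / eta a b 1 = ∫ x in Ioo (0 : ℝ) 1, F x := by linarith
  have h8 : eta a b 1 / 2 * (P 1 / eta a b 1) ^ 2 = 1 / 2 * (P 1 ^ 2 / eta a b 1) := by
    have hη := (eta_pos (a := a) (b := b) 1).ne'
    field_simp
  rw [h8, h7, hFint]
  ring

/-- The two sides of the multiplier identity, with the drift estimated. -/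
theorem multiplier_identity_bounds {lam : ℝ} {w : H1 a b} {g : L2 a b}
    (h : IsALambda a b d lam w g) :
    ∃ τ, HasDerivWithinAt (fun x => ∫ s in (0 : ℝ)..x, der a b w s) τ (Icc 0 1) 1 ∧
      inner ℝ g (hC.mulX (der a b w)) -
          lam * inner ℝ (hC.primD (der a b w)) (hC.mulXD (der a b w)) +
          1 / 2 * (1 - m) * ‖der a b w‖ ^ 2 ≤ eta a b 1 / 2 * τ ^ 2 ∧
      eta a b 1 / 2 * τ ^ 2 ≤ inner ℝ g (hC.mulX (der a b w)) -
          lam * inner ℝ (hC.primD (der a b w)) (hC.mulXD (der a b w)) +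
          1 / 2 * (1 + m) * ‖der a b w‖ ^ 2 := by
  obtain ⟨τ, hτ, hid⟩ := hC.multiplier_identity h
  have hE : Integrable (fun x => eta a b x * der a b w x ^ 2) muI := by
    simpa only [sq] using hC.integrable_L2eta_mul (der a b w) (der a b w)
  have hI3 := hC.integrable_drift w
  have hpos : ∀ x, 0 ≤ eta a b x * der a b w x ^ 2 := fun x =>
    mul_nonneg (eta_pos x).le (sq_nonneg _)
  refine ⟨τ, hτ, ?_, ?_⟩
  · have h1 : (1 - m) * ‖der a b w‖ ^ 2 ≤
        ∫ x in Ioo (0 : ℝ) 1, (1 - x * (b x / a x)) * (eta a b x * der a b w x ^ 2) := by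
      rw [hC.norm_sq_L2eta, ← integral_const_mul]
      refine integral_mono_ae (hE.const_mul _) hI3 ?_
      filter_upwards [hC.drift] with x hx
      rw [mul_div_assoc] at hx
      exact mul_le_mul_of_nonneg_right (by linarith [(abs_le.1 hx).2]) (hpos x)
    rw [hid]
    linarith
  · have h1 : ∫ x in Ioo (0 : ℝ) 1, (1 - x * (b x / a x)) * (eta a b x * der a b w x ^ 2) ≤
        (1 + m) * ‖der a b w‖ ^ 2 := by
      rw [hC.norm_sq_L2eta, ← integral_const_mul]
      refine integral_mono_ae hI3 (hE.const_mul _) ?_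
      filter_upwards [hC.drift] with x hx
      rw [mul_div_assoc] at hx
      exact mul_le_mul_of_nonneg_right (by linarith [(abs_le.1 hx).1]) (hpos x)
    rw [hid]
    linarith

end Regularity

end Coeffs

/-! ### The energy space of the degenerate operator -/

namespace Coeffs

section EnergyForm

variable {a b d : ℝ → ℝ} {Ka Kd m : ℝ} (hC : Coeffs a b d Ka Kd m)

/-- The energy form `∫ η u' v' - λ ∫ u v / (σ d)`. -/
def energyForm (lam : ℝ) : H1 a b →ₗ[ℝ] H1 a b →ₗ[ℝ] ℝ :=
  (innerₗ (L2eta a b)).compl₁₂ (der a b : H1 a b →ₗ[ℝ] L2eta a b)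
    (der a b : H1 a b →ₗ[ℝ] L2eta a b) -
  lam • (innerₗ (L2 a b)).compl₁₂ ((hC.primD.comp (der a b) : H1 a b →L[ℝ] L2 a b) :
      H1 a b →ₗ[ℝ] L2 a b)
    ((hC.primD.comp (der a b) : H1 a b →L[ℝ] L2 a b) : H1 a b →ₗ[ℝ] L2 a b)

theorem energyForm_apply (lam : ℝ) (u v : H1 a b) : hC.energyForm lam u v =
    inner ℝ (der a b u) (der a b v) -
      lam * inner ℝ (hC.primD (der a b u)) (hC.primD (der a b v)) := rfl

theorem energyForm_self (lam : ℝ) (u : H1 a b) : hC.energyForm lam u u =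
    ‖der a b u‖ ^ 2 - lam * ‖hC.primD (der a b u)‖ ^ 2 := by
  rw [energyForm_apply, real_inner_self_eq_norm_sq, real_inner_self_eq_norm_sq]

theorem energyForm_le (lam : ℝ) (u : H1 a b) :
    hC.energyForm lam u u ≤ (1 + |lam| * CHP a b d) * ‖der a b u‖ ^ 2 := by
  rw [energyForm_self]
  have h1 := hC.norm_primD_sq_le u
  have h2 := mul_le_mul_of_nonneg_left h1 (abs_nonneg lam)
  have h3 : -lam * ‖hC.primD (der a b u)‖ ^ 2 ≤ |lam| * ‖hC.primD (der a b u)‖ ^ 2 :=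
    mul_le_mul_of_nonneg_right (neg_le_abs lam) (sq_nonneg _)
  linarith

/-- The energy form is coercive as long as `λ C_HP < 1`. -/
theorem le_energyForm {lam : ℝ} (u : H1 a b) :
    (1 - max lam 0 * CHP a b d) * ‖der a b u‖ ^ 2 ≤ hC.energyForm lam u u := by
  rw [energyForm_self]
  have h1 := hC.norm_primD_sq_le u
  have h2 := mul_le_mul_of_nonneg_left h1 (le_max_right lam 0)
  have h3 : lam * ‖hC.primD (der a b u)‖ ^ 2 ≤ max lam 0 * ‖hC.primD (der a b u)‖ ^ 2 :=
    mul_le_mul_of_nonneg_right (le_max_left _ _) (sq_nonneg _)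
  linarith

/-- `H¹_{1/σ}` carries a Hilbert space structure with the energy form as its inner product, and with
its own topology. -/
theorem exists_energyNorm {lam : ℝ} (h : max lam 0 * CHP a b d < 1) :
    ∃ (V : Type) (_ : NormedAddCommGroup V) (_ : InnerProductSpace ℝ V) (_ : CompleteSpace V)
      (e : H1 a b ≃L[ℝ] V), ∀ u v, inner ℝ (e u) (e v) = hC.energyForm lam u v := by
  have := hC.completeSpace_H1
  obtain ⟨C, hC0, hle⟩ := hC.exists_norm_le_der
  refine exists_energySpace (hC.energyForm lam) (fun u v => ?_)
    (c := (1 - max lam 0 * CHP a b d) / C) (C := 1 + |lam| * CHP a b d)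
    (div_pos (by linarith) hC0) (fun u => ?_) fun u => ?_
  · rw [energyForm_apply, energyForm_apply, real_inner_comm, real_inner_comm (hC.primD _)]
  · refine le_trans ?_ (hC.le_energyForm u)
    rw [div_mul_eq_mul_div, mul_div_assoc]
    refine mul_le_mul_of_nonneg_left ?_ (by linarith)
    rw [div_le_iff₀ hC0, mul_comm]
    exact hle u
  · refine (hC.energyForm_le lam u).trans ?_
    have h1 := hC.CHP_nonneg
    refine mul_le_mul_of_nonneg_left ?_ (by positivity)
    rw [norm_sq_H1]
    exact le_add_of_nonneg_left (sq_nonneg _)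

/-- The weak form of `A_λ w = g`. -/
theorem isALambda_iff (lam : ℝ) (w : H1 a b) (g : L2 a b) : IsALambda a b d lam w g ↔
    ∀ v, hC.energyForm lam w v = -inner ℝ g (val a b v) := by
  have key : ∀ φ (hφ : IsTest φ), (-(∫ x in Ioo (0 : ℝ) 1, eta a b x * der a b w x * deriv φ x) +
        lam * ∫ x in Ioo (0 : ℝ) 1, val a b w x * φ x / (sigma a b x * d x) =
      -hC.energyForm lam w (hC.test hφ)) ∧
      ∫ x in Ioo (0 : ℝ) 1, g x * φ x / sigma a b x = inner ℝ g (val a b (hC.test hφ)) :=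
    fun φ hφ => by
    have h1 : ∫ x in Ioo (0 : ℝ) 1, eta a b x * der a b w x * deriv φ x =
        inner ℝ (der a b w) (der a b (hC.test hφ)) := by
      rw [hC.inner_L2eta]
      refine integral_congr_ae ?_
      filter_upwards [hC.coeFn_der_test hφ] with x hx
      rw [hx, mul_assoc]
    have h2 : ∫ x in Ioo (0 : ℝ) 1, val a b w x * φ x / (sigma a b x * d x) =
        inner ℝ (hC.primD (der a b w)) (hC.primD (der a b (hC.test hφ))) := by
      rw [hC.inner_L2]
      refine integral_congr_ae ?_
      filter_upwards [hC.coeFn_primD_test hφ, hC.coeFn_primD (der a b w), hC.coeFn_val w,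
        ae_restrict_mem measurableSet_Ioo] with x e1 e2 e3 hx
      have hd := hC.inv_sqrt_d_sq hx
      rw [e1, e2, e3, div_eq_mul_one_div, ← one_div_mul_one_div, ← hd]
      ring
    have h3 : ∫ x in Ioo (0 : ℝ) 1, g x * φ x / sigma a b x =
        inner ℝ g (val a b (hC.test hφ)) := by
      rw [hC.inner_L2]
      refine integral_congr_ae ?_
      filter_upwards [hC.coeFn_val_test hφ] with x hx
      rw [hx]
      ring
    refine ⟨?_, h3⟩
    rw [h1, h2, energyForm_apply]
    ring
  constructor
  · intro h v
    let ℓ : H1 a b →L[ℝ] ℝ := (innerSL ℝ (der a b w)).comp (der a b) -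
      lam • (innerSL ℝ (hC.primD (der a b w))).comp (hC.primD.comp (der a b)) +
      (innerSL ℝ g).comp (val a b)
    have hℓ : ∀ v, ℓ v = hC.energyForm lam w v + inner ℝ g (val a b v) := fun v => rfl
    have h1 := hC.functional_eq_zero_of_test ℓ (fun φ hφ => by
      have h2 := h φ hφ.smooth hφ.compact hφ.supp
      rw [(key φ hφ).1, (key φ hφ).2] at h2
      rw [hℓ]
      linarith) v
    rw [hℓ] at h1
    linarith
  · intro h φ h1 h2 h3
    rw [(key φ ⟨h1, h2, h3⟩).1, (key φ ⟨h1, h2, h3⟩).2, h, neg_neg]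

end EnergyForm

section EnergySpace

variable {a b d : ℝ → ℝ} {Ka Kd m : ℝ} (hC : Coeffs a b d Ka Kd m)
variable {V : Type} [NormedAddCommGroup V] [InnerProductSpace ℝ V] [CompleteSpace V]

/-- The embedding of the energy space in `L²_{1/σ}`. -/
def emb (e : H1 a b ≃L[ℝ] V) : V →L[ℝ] L2 a b := (val a b).comp (e.symm : V →L[ℝ] H1 a b)

/-- The derivative of an element of the energy space. -/
def derE (e : H1 a b ≃L[ℝ] V) : V →L[ℝ] L2eta a b := (der a b).comp (e.symm : V →L[ℝ] H1 a b)

/-- The solution `w = -ι† g` of `A_λ w = g`. -/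
def solve (e : H1 a b ≃L[ℝ] V) : L2 a b →L[ℝ] H1 a b :=
  (e.symm : V →L[ℝ] H1 a b).comp (-(emb e).adjoint)

variable {lam : ℝ} {e : H1 a b ≃L[ℝ] V}
  (he : ∀ u v, inner ℝ (e u) (e v) = hC.energyForm lam u v)
include he

/-- In the energy space, `A_λ` is the inverse of `-ι†` for the embedding `ι`. -/
theorem isALambda_iff_eq (w : H1 a b) (g : L2 a b) :
    IsALambda a b d lam w g ↔ e w = -(emb e).adjoint g := by
  rw [hC.isALambda_iff]
  have h1 : ∀ v, hC.energyForm lam w v + inner ℝ g (val a b v) =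
      inner ℝ (e w + (emb e).adjoint g) (e v) := fun v => by
    rw [inner_add_left, he, ContinuousLinearMap.adjoint_inner_left, emb]
    simp
  constructor
  · intro h
    rw [← add_eq_zero_iff_eq_neg, ← inner_self_eq_zero (𝕜 := ℝ)]
    obtain ⟨v, hv⟩ := e.surjective (e w + (emb e).adjoint g)
    nth_rw 2 [← hv]
    rw [← h1, h, neg_add_cancel]
  · intro h v
    have h2 := h1 v
    rw [h, neg_add_cancel, inner_zero_left] at h2
    linarith

theorem isALambda_solve (g : L2 a b) : IsALambda a b d lam (solve e g) g := by
  rw [hC.isALambda_iff_eq he]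
  exact e.apply_symm_apply _

omit [CompleteSpace V] in
theorem norm_sq_energy (v : V) :
    ‖v‖ ^ 2 = ‖derE e v‖ ^ 2 - lam * ‖hC.primD (derE e v)‖ ^ 2 := by
  have h1 := he (e.symm v) (e.symm v)
  rw [e.apply_symm_apply, real_inner_self_eq_norm_sq, energyForm_self] at h1
  exact h1

/-- The boundary observation `g ↦ w'(1)`, where `A_λ w = g`, is bounded on `L²_{1/σ}`. -/
theorem exists_trace : ∃ ν : L2 a b →L[ℝ] ℝ, (∀ g, ν g = dxAtOne a b (solve e g)) ∧
    ∀ g, inner ℝ g (hC.mulX (der a b (solve e g))) -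
          lam * inner ℝ (hC.primD (der a b (solve e g))) (hC.mulXD (der a b (solve e g))) +
          1 / 2 * (1 - m) * ‖der a b (solve e g)‖ ^ 2 ≤ eta a b 1 / 2 * ν g ^ 2 ∧
      eta a b 1 / 2 * ν g ^ 2 ≤ inner ℝ g (hC.mulX (der a b (solve e g))) -
          lam * inner ℝ (hC.primD (der a b (solve e g))) (hC.mulXD (der a b (solve e g))) +
          1 / 2 * (1 + m) * ‖der a b (solve e g)‖ ^ 2 := by
  choose τ hτ hτ' using fun g => hC.multiplier_identity_bounds (hC.isALambda_solve he g)
  have hdx : ∀ g, dxAtOne a b (solve e g) = τ g := fun g => dxAtOne_eq (hτ g)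
  have hu := uniqueDiffOn_Icc zero_lt_one 1 (right_mem_Icc.2 (zero_le_one (α := ℝ)))
  let ν₀ : L2 a b →ₗ[ℝ] ℝ :=
    { toFun := τ
      map_add' := fun f g => by
        refine hu.eq_deriv _ (hτ (f + g)) (((hτ f).add (hτ g)).congr (fun x hx => ?_) ?_)
        · rw [map_add, map_add]
          exact hC.primitive_add _ _ hx
        · rw [map_add, map_add]
          exact hC.primitive_add _ _ (right_mem_Icc.2 zero_le_one)
      map_smul' := fun c g => by
        refine hu.eq_deriv _ (hτ (c • g)) (((hτ g).const_mul c).congr (fun x hx => ?_) ?_)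
        · rw [map_smul, map_smul]
          exact hC.primitive_smul _ _ hx
        · rw [map_smul, map_smul]
          exact hC.primitive_smul _ _ (right_mem_Icc.2 zero_le_one) }
  set L : L2 a b →L[ℝ] L2eta a b := (der a b).comp (solve e) with hL
  -- Each term of the upper bound for `w'(1)²` is quadratic in a bounded linear function of `g`.
  set C : ℝ := ‖hC.mulX.comp L‖ + |lam| * (‖hC.primD.comp L‖ * ‖hC.mulXD.comp L‖) +
    |1 / 2 * (1 + m)| * ‖L‖ ^ 2 with hCdef
  have hC0 : 0 ≤ C := by positivity
  have hη := eta_pos (a := a) (b := b) 1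
  have hbound : ∀ g, eta a b 1 / 2 * τ g ^ 2 ≤ C * ‖g‖ ^ 2 := fun g => by
    refine (hτ' g).2.trans ?_
    have h1 : inner ℝ g (hC.mulX (der a b (solve e g))) ≤ ‖hC.mulX.comp L‖ * ‖g‖ ^ 2 := by
      refine (real_inner_le_norm _ _).trans ?_
      have := (hC.mulX.comp L).le_opNorm g
      calc _ ≤ ‖g‖ * (‖hC.mulX.comp L‖ * ‖g‖) := mul_le_mul_of_nonneg_left this (norm_nonneg _)
        _ = _ := by ring
    have h2 : -(lam * inner ℝ (hC.primD (der a b (solve e g)))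
        (hC.mulXD (der a b (solve e g)))) ≤
        |lam| * (‖hC.primD.comp L‖ * ‖hC.mulXD.comp L‖) * ‖g‖ ^ 2 := by
      refine (neg_le_abs _).trans ?_
      rw [abs_mul, mul_assoc]
      refine mul_le_mul_of_nonneg_left ?_ (abs_nonneg _)
      refine (abs_real_inner_le_norm _ _).trans ?_
      have e1 := (hC.primD.comp L).le_opNorm g
      have e2 := (hC.mulXD.comp L).le_opNorm g
      calc _ ≤ (‖hC.primD.comp L‖ * ‖g‖) * (‖hC.mulXD.comp L‖ * ‖g‖) :=
            mul_le_mul e1 e2 (norm_nonneg _) (by positivity)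
        _ = _ := by ring
    have h3 : 1 / 2 * (1 + m) * ‖der a b (solve e g)‖ ^ 2 ≤
        |1 / 2 * (1 + m)| * ‖L‖ ^ 2 * ‖g‖ ^ 2 := by
      have e1 : ‖der a b (solve e g)‖ ^ 2 ≤ (‖L‖ * ‖g‖) ^ 2 :=
        pow_le_pow_left₀ (norm_nonneg _) (L.le_opNorm g) 2
      rw [mul_pow] at e1
      calc _ ≤ |1 / 2 * (1 + m)| * ‖der a b (solve e g)‖ ^ 2 :=
            mul_le_mul_of_nonneg_right (le_abs_self _) (sq_nonneg _)
        _ ≤ |1 / 2 * (1 + m)| * (‖L‖ ^ 2 * ‖g‖ ^ 2) :=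
            mul_le_mul_of_nonneg_left e1 (abs_nonneg _)
        _ = _ := by ring
    rw [hCdef]
    linarith
  refine ⟨ν₀.mkContinuous (√(C / (eta a b 1 / 2))) fun g => ?_, fun g => (hdx g).symm, hτ'⟩
  change ‖τ g‖ ≤ _
  rw [← Real.sqrt_sq (norm_nonneg g), ← Real.sqrt_mul (by positivity)]
  refine Real.le_sqrt_of_sq_le ?_
  rw [Real.norm_eq_abs, sq_abs, div_mul_eq_mul_div, le_div_iff₀ (by positivity), mul_comm]
  exact hbound g

end EnergySpace

end Coeffs

/-! ### The multiplier method for the degenerate operator -/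

namespace Coeffs

section MultiplierMethod

variable {a b d : ℝ → ℝ} {Ka Kd m : ℝ} (hC : Coeffs a b d Ka Kd m)

include hC in
theorem drift_nonneg : 0 ≤ m := by
  have : (ae muI).NeBot := by
    rw [ae_neBot, Ne, Measure.restrict_eq_zero, Real.volume_Ioo]
    simp
  obtain ⟨x, hx⟩ := hC.drift.exists
  exact (abs_nonneg _).trans hx

variable {V : Type} [NormedAddCommGroup V] [InnerProductSpace ℝ V] [CompleteSpace V]
variable {lam : ℝ} {e : H1 a b ≃L[ℝ] V}
  (he : ∀ u v, inner ℝ (e u) (e v) = hC.energyForm lam u v)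

omit [CompleteSpace V] in
theorem norm_derE_sq_le (v : V) : ‖derE e v‖ ^ 2 ≤ ‖derE e‖ ^ 2 * ‖v‖ ^ 2 := by
  rw [← mul_pow]
  exact pow_le_pow_left₀ (norm_nonneg _) ((derE e).le_opNorm v) 2

omit [CompleteSpace V] in
theorem emb_eq (v : V) : emb e v = hC.primL2 (derE e v) := hC.val_eq _

include he in
omit [CompleteSpace V] in
/-- The potential energy can be absorbed: this is where the range of `λ` enters. -/
theorem exists_absorb
    (hlam : (lam < 0 ∧ |lam| * CHP a b d * (1 + 3 * Ka / 2 + Kd + m) < 2 - Ka - 2 * m) ∨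
      (0 ≤ lam ∧ Ka + 2 * Kd ≤ 2 - 2 * m)) :
    ∃ θ κ₁ : ℝ, 0 < κ₁ ∧
      (∀ v : V, θ * ‖hC.primD (derE e v)‖ ^ 2 ≤ 1 / 2 * (1 - m) * lam *
        ‖hC.primD (derE e v)‖ ^ 2 -
        lam * inner ℝ (hC.primD (derE e v)) (hC.mulXD (derE e v))) ∧
      ∀ v : V, κ₁ * ‖v‖ ^ 2 ≤ (1 / 2 * (1 - m) + 1 / 2 * (1 - Ka - m)) * ‖v‖ ^ 2 +
        θ * ‖hC.primD (derE e v)‖ ^ 2 := by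
  have hm := hC.drift_nonneg
  have hKa := hC.deg_a.exp_pos
  have hKd := hC.deg_d.exp_pos
  have hCHP := hC.CHP_nonneg
  rcases hlam with ⟨hneg, hlt⟩ | ⟨hpos, hle⟩
  · have habs : |lam| = -lam := abs_of_neg hneg
    have hk : 0 ≤ |lam| * CHP a b d * (1 + 3 * Ka / 2 + Kd + m) := by positivity
    set s : ℝ := (1 - m - Ka / 2) - |lam| * CHP a b d * (Ka + Kd / 2 + m) with hs
    have hs0 : 0 < s := by
      -- half of the hypothesis on `λ`, as `Ka + Kd / 2 + m ≤ (1 + 3 Ka / 2 + Kd + m) / 2`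
      have h1 : |lam| * CHP a b d * (Ka + Kd / 2 + m) ≤
          |lam| * CHP a b d * ((1 + 3 * Ka / 2 + Kd + m) / 2) :=
        mul_le_mul_of_nonneg_left (by linarith) (by positivity)
      linarith
    -- For `λ < 0` the lower bound for `⟨u / d, x u'⟩` counts, and `θ < 0` is absorbed with the help of
    -- the Hardy-Poincaré inequality.
    refine ⟨lam / 2 * (2 + Ka + Kd), s / (1 + |lam| * CHP a b d), by positivity, fun v => ?_,
      fun v => ?_⟩
    · have h1 := (hC.inner_primD_mulXD_bounds (e.symm v)).2
      have h2 := mul_le_mul_of_nonneg_left h1 (neg_nonneg.2 hneg.le)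
      change -lam * (-(1 / 2 * (1 + (m + Ka + Kd)) * ‖hC.primD (derE e v)‖ ^ 2)) ≤
        -lam * inner ℝ (hC.primD (derE e v)) (hC.mulXD (derE e v)) at h2
      linarith
    · have h1 := hC.norm_sq_energy he v
      have h2 : ‖hC.primD (derE e v)‖ ^ 2 ≤ CHP a b d * ‖derE e v‖ ^ 2 :=
        hC.norm_primD_sq_le (e.symm v)
      have h3 := mul_le_mul_of_nonneg_left h2 (abs_nonneg lam)
      have h4 : ‖v‖ ^ 2 ≤ (1 + |lam| * CHP a b d) * ‖derE e v‖ ^ 2 := by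
        rw [habs] at h3 ⊢
        linarith
      have h5 : s / (1 + |lam| * CHP a b d) * ‖v‖ ^ 2 ≤ s * ‖derE e v‖ ^ 2 := by
        rw [div_mul_eq_mul_div, div_le_iff₀ (by positivity), mul_assoc]
        refine mul_le_mul_of_nonneg_left (h4.trans_eq (mul_comm _ _)) hs0.le
      refine h5.trans ?_
      have h6 := mul_le_mul_of_nonneg_right h3 (show 0 ≤ Ka + Kd / 2 + m by positivity)
      rw [h1, hs, habs]
      rw [habs] at h6
      nlinarith
  -- For `λ ≥ 0` the upper bound for `⟨u / d, x u'⟩` counts, and `θ ≥ 0` as `K_a + K_d ≤ 2 - 2 m`.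
  · refine ⟨lam / 2 * (2 - 2 * m - Ka - Kd), 1 / 2 * (1 - m) + 1 / 2 * (1 - Ka - m),
      by linarith, fun v => ?_, fun v => ?_⟩
    · have h1 := (hC.inner_primD_mulXD_bounds (e.symm v)).1
      have h2 := mul_le_mul_of_nonneg_left h1 hpos
      change lam * inner ℝ (hC.primD (derE e v)) (hC.mulXD (derE e v)) ≤
        lam * (-(1 / 2 * (1 - (m + Ka + Kd)) * ‖hC.primD (derE e v)‖ ^ 2)) at h2
      linarith
    · have h1 : 0 ≤ lam / 2 * (2 - 2 * m - Ka - Kd) :=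
        mul_nonneg (by linarith) (by linarith)
      have h2 := mul_nonneg h1 (sq_nonneg ‖hC.primD (derE e v)‖)
      linarith

include he in
/-- The degenerate wave equation satisfies the hypotheses of the multiplier method. -/
theorem exists_multiplierData (hK : Ka < 2 - 2 * m)
    (hlam : (lam < 0 ∧ |lam| * CHP a b d * (1 + 3 * Ka / 2 + Kd + m) < 2 - Ka - 2 * m) ∨
      (0 ≤ lam ∧ Ka + 2 * Kd ≤ 2 - 2 * m)) :
    ∃ (ν : L2 a b →L[ℝ] ℝ) (κ θ κ₁ C₁ : ℝ), (∀ g, ν g = dxAtOne a b (solve e g)) ∧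
      MultiplierData (emb e) (hC.mulX.comp (derE e)) (hC.primD.comp (derE e)) ν lam κ
        (1 / 2 * (1 - m)) (1 / 2 * (1 - Ka - m)) θ (max 1 (1 / a 1)) κ₁ C₁ := by
  have hm := hC.drift_nonneg
  have hKa := hC.deg_a.exp_pos
  obtain ⟨ν, hν, hνb⟩ := hC.exists_trace he
  obtain ⟨θ, κ₁, hκ₁, hθ, habs⟩ := hC.exists_absorb he hlam
  set N : ℝ := |lam| * (‖hC.primD‖ * ‖hC.mulXD‖) + 1 / 2 * (1 + m) with hN
  have hN0 : 0 ≤ N := by positivity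
  have hN1 : 0 ≤ N * ‖derE e‖ ^ 2 := by positivity
  set C₁ : ℝ := 1 / 2 * (1 + (m + Ka)) + N * ‖derE e‖ ^ 2 with hC₁
  refine ⟨ν, eta a b 1 / 2, θ, κ₁, C₁, hν, ⟨half_pos (eta_pos 1), by linarith, hκ₁,
    le_max_left _ _, fun g => ?_, fun g => ?_, fun z => ?_, fun z => ?_, fun v => ?_, habs,
    fun ε hε => ?_, fun ε hε => ?_⟩⟩
  · refine le_trans ?_ (hνb g).1
    set v : V := -(emb e).adjoint g with hv
    have e1 : ‖(emb e).adjoint g‖ = ‖v‖ := by rw [hv, norm_neg]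
    have e2 : ‖(hC.primD.comp (derE e)) ((emb e).adjoint g)‖ = ‖hC.primD (derE e v)‖ := by
      rw [hv, map_neg, map_neg, norm_neg]
      rfl
    have h1 := hθ v
    have h2 := hC.norm_sq_energy he v
    rw [e1, e2, h2]
    change inner ℝ g (hC.mulX (derE e v)) + _ + _ ≤ inner ℝ g (hC.mulX (derE e v)) -
      lam * inner ℝ (hC.primD (derE e v)) (hC.mulXD (derE e v)) +
      1 / 2 * (1 - m) * ‖derE e v‖ ^ 2
    linarith
  · refine (hνb g).2.trans ?_
    set v : V := -(emb e).adjoint g with hv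
    have e1 : ‖(emb e).adjoint g‖ = ‖v‖ := by rw [hv, norm_neg]
    rw [e1]
    change inner ℝ g (hC.mulX (derE e v)) -
      lam * inner ℝ (hC.primD (derE e v)) (hC.mulXD (derE e v)) +
      1 / 2 * (1 + m) * ‖derE e v‖ ^ 2 ≤ inner ℝ g (hC.mulX (derE e v)) + C₁ * ‖v‖ ^ 2
    have h2 : -(lam * inner ℝ (hC.primD (derE e v)) (hC.mulXD (derE e v))) ≤
        |lam| * (‖hC.primD‖ * ‖hC.mulXD‖) * ‖derE e v‖ ^ 2 := by
      refine (neg_le_abs _).trans ?_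
      rw [abs_mul, mul_assoc]
      refine mul_le_mul_of_nonneg_left ?_ (abs_nonneg _)
      refine (abs_real_inner_le_norm _ _).trans ?_
      calc _ ≤ (‖hC.primD‖ * ‖derE e v‖) * (‖hC.mulXD‖ * ‖derE e v‖) :=
            mul_le_mul (hC.primD.le_opNorm _) (hC.mulXD.le_opNorm _) (norm_nonneg _)
              (by positivity)
        _ = _ := by ring
    have h3 := mul_le_mul_of_nonneg_left (norm_derE_sq_le (e := e) v) hN0
    have h4 : 0 ≤ 1 / 2 * (1 + (m + Ka)) * ‖v‖ ^ 2 := by positivity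
    rw [hC₁]
    rw [hN] at h3 ⊢
    linarith
  · have h1 := (hC.inner_val_mulX_bounds (e.symm z)).1
    change inner ℝ (emb e z) (hC.mulX (derE e z)) ≤
      -(1 / 2 * (1 - (m + Ka)) * ‖emb e z‖ ^ 2) at h1
    change inner ℝ (emb e z) (hC.mulX (derE e z)) ≤ _
    linarith
  · have h1 := (hC.inner_val_mulX_bounds (e.symm z)).2
    change -(1 / 2 * (1 + (m + Ka)) * ‖emb e z‖ ^ 2) ≤
      inner ℝ (emb e z) (hC.mulX (derE e z)) at h1
    refine le_trans ?_ h1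
    rw [hC₁]
    have := mul_nonneg hN1 (sq_nonneg ‖emb e z‖)
    linarith
  · have h2 := hC.norm_sq_energy he v
    have h3 : ‖v‖ ^ 2 + lam * ‖(hC.primD.comp (derE e)) v‖ ^ 2 = ‖derE e v‖ ^ 2 := by
      rw [h2]
      change _ + lam * ‖hC.primD (derE e v)‖ ^ 2 = _
      ring
    rw [h3]
    exact (hC.norm_mulX_sq_le _).trans
      (mul_le_mul_of_nonneg_right (le_max_right _ _) (sq_nonneg _))
  · obtain ⟨C, hC0, h⟩ := hC.primD_interpolation
      (ε := ε / (‖derE e‖ ^ 2 + 1)) (by positivity)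
    refine ⟨C, hC0, fun v => ?_⟩
    rw [hC.emb_eq]
    refine (h (derE e v)).trans (add_le_add_left ?_ _)
    rw [div_mul_eq_mul_div, mul_div_assoc]
    refine mul_le_mul_of_nonneg_left ?_ hε.le
    rw [div_le_iff₀ (by positivity)]
    linarith [norm_derE_sq_le (e := e) v, sq_nonneg ‖v‖]
  · obtain ⟨k, ℓ, h⟩ := hC.primL2_compact (ε := ε / (‖derE e‖ ^ 2 + 1)) (by positivity)
    refine ⟨k, fun i => (ℓ i).comp (derE e), fun v => ?_⟩
    rw [hC.emb_eq]
    refine (h (derE e v)).trans (add_le_add_left ?_ _)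
    rw [div_mul_eq_mul_div, mul_div_assoc]
    refine mul_le_mul_of_nonneg_left ?_ hε.le
    rw [div_le_iff₀ (by positivity)]
    linarith [norm_derE_sq_le (e := e) v, sq_nonneg ‖v‖]

end MultiplierMethod

end Coeffs

/-! ### Controlled trajectories -/

section Curves

variable {E : Type*} [NormedAddCommGroup E] [NormedSpace ℝ E] [CompleteSpace E]

/-- The primitive of a function that is continuous on `[0, ∞)` extends to a `C¹` function on the line. -/
theorem exists_contDiff_integral {D : ℝ → E} (hD : ContinuousOn D (Ici 0)) :
    ∃ F : ℝ → E, ContDiff ℝ 1 F ∧ (∀ t ∈ Ici (0 : ℝ), F t = ∫ s in (0 : ℝ)..t, D s) ∧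
      ∀ t ∈ Ici (0 : ℝ), HasDerivAt F (D t) t := by
  set D' : ℝ → E := fun t => D (max t 0) with hD'
  have hc : Continuous D' := hD.comp_continuous (by fun_prop) fun t => mem_Ici.2 (le_max_right _ _)
  have hd : ∀ t, HasDerivAt (fun t => ∫ s in (0 : ℝ)..t, D' s) (D' t) t := fun t =>
    intervalIntegral.integral_hasDerivAt_right (hc.intervalIntegrable _ _)
      (hc.stronglyMeasurableAtFilter _ _) hc.continuousAt
  have heq : ∀ t ∈ Ici (0 : ℝ), D' t = D t := fun t ht => by
    simp only [hD', max_eq_left (mem_Ici.1 ht)]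
  refine ⟨fun t => ∫ s in (0 : ℝ)..t, D' s, ?_, fun t ht => ?_, fun t ht => ?_⟩
  · refine contDiff_one_iff_deriv.2 ⟨fun t => (hd t).differentiableAt, ?_⟩
    have : deriv (fun t => ∫ s in (0 : ℝ)..t, D' s) = D' := funext fun t => (hd t).deriv
    rw [this]
    exact hc
  · refine intervalIntegral.integral_congr fun s hs => heq s ?_
    rw [uIcc_of_le ht] at hs
    exact hs.1
  · rw [← heq t ht]
    exact hd t

omit [NormedSpace ℝ E] [CompleteSpace E] in
theorem intervalIntegrable_of_continuousOn_Ici {D : ℝ → E} (hD : ContinuousOn D (Ici 0))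
    {s t : ℝ} (hs : 0 ≤ s) (ht : 0 ≤ t) : IntervalIntegrable D volume s t :=
  (hD.mono fun _ hr => (le_min hs ht).trans hr.1).intervalIntegrable

theorem contDiffOn_comp_integral {G : Type*} [NormedAddCommGroup G] [NormedSpace ℝ G]
    (L : E →L[ℝ] G) {D : ℝ → E} (hD : ContinuousOn D (Ici 0)) {w : ℝ → G} {x : E}
    (hw : ∀ t ∈ Ici (0 : ℝ), w t = L (x + ∫ s in (0 : ℝ)..t, D s)) :
    ContDiffOn ℝ 1 w (Ici 0) ∧ ∀ t ∈ Ici (0 : ℝ), derivWithin w (Ici 0) t = L (D t) := by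
  obtain ⟨F, hF, hF1, hF2⟩ := exists_contDiff_integral hD
  have heq : ∀ t ∈ Ici (0 : ℝ), w t = L (x + F t) := fun t ht => by rw [hw t ht, hF1 t ht]
  refine ⟨ContDiffOn.congr ?_ heq, fun t ht => ?_⟩
  · exact (L.contDiff.comp (contDiff_const.add hF)).contDiffOn
  · have h1 : HasDerivAt (fun t => L (x + F t)) (L (D t)) t :=
      L.hasFDerivAt.comp_hasDerivAt t ((hF2 t ht).const_add _)
    exact (h1.hasDerivWithinAt.congr heq (heq t ht)).derivWithin (uniqueDiffOn_Ici 0 t ht)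

end Curves

theorem phase_ext {V H : Type*} {p q : WithLp 2 (V × H)} (h1 : p.fst = q.fst)
    (h2 : p.snd = q.snd) : p = q :=
  (WithLp.equiv 2 (V × H)).injective (Prod.ext h1 h2)

section Control

variable {V H : Type*} [NormedAddCommGroup V] [InnerProductSpace ℝ V] [CompleteSpace V]
  [NormedAddCommGroup H] [InnerProductSpace ℝ H] [CompleteSpace H]
  {ι : V →L[ℝ] H} {ν : H →L[ℝ] ℝ} {S : ℝ → WithLp 2 (V × H) →L[ℝ] WithLp 2 (V × H)}

theorem denseRange_waveInv (hι : Function.Injective ι) (hd : DenseRange ι) :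
    DenseRange (waveInv ι) := (isSkew_waveInv ι).denseRange (injective_waveInv hι hd)

theorem fst_integral {W : ℝ → WithLp 2 (V × H)} (hW : ContinuousOn W (Ici 0)) {s t : ℝ}
    (hs : 0 ≤ s) (ht : 0 ≤ t) : (∫ r in s..t, W r).fst = ∫ r in s..t, (W r).fst :=
  ((WithLp.fstL 2 ℝ V H).intervalIntegral_comp_comm
    (intervalIntegrable_of_continuousOn_Ici hW hs ht)).symm

theorem snd_integral {W : ℝ → WithLp 2 (V × H)} (hW : ContinuousOn W (Ici 0)) {s t : ℝ}
    (hs : 0 ≤ s) (ht : 0 ≤ t) : (∫ r in s..t, W r).snd = ∫ r in s..t, (W r).snd :=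
  ((WithLp.sndL 2 ℝ V H).intervalIntegral_comp_comm
    (intervalIntegrable_of_continuousOn_Ici hW hs ht)).symm

omit [CompleteSpace V] [CompleteSpace H] in
theorem phase_inner (p q : WithLp 2 (V × H)) :
    inner ℝ p q = inner ℝ p.fst q.fst + inner ℝ p.snd q.snd := WithLp.prod_inner_apply p q

/-- The trajectory of the controlled system in the dual variables `ζ = (A⁻¹ u_t, -u)`. It is
characterized by duality with the trajectories of the homogeneous problem, and its second component
is differentiable in the dual of `V`. -/
theorem exists_controlled_curve (hι : Function.Injective ι) (hd : DenseRange ι)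
    (hS : IsUnitaryGroup (waveInv ι) S)
    (ha : hS.Admissible (ν.comp (WithLp.sndL 2 ℝ V H))) {f : ℝ → ℝ} (hf : MemLp f 2 volume)
    (hf0 : ∀ s ≤ 0, f s = 0) (z₀ : WithLp 2 (V × H)) (c : ℝ) :
    ∃ ζ : ℝ → WithLp 2 (V × H), ContinuousOn ζ (Ici 0) ∧
      (∀ t, 0 ≤ t → ∀ q, inner ℝ (ζ t) (waveInv ι q) = inner ℝ z₀ (S (-t) (waveInv ι q)) -
        c * ∫ s in (0 : ℝ)..t, f s * ν (S (s - t) q).snd) ∧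
      ∀ t, 0 ≤ t → ι.adjoint (ζ t).snd = ι.adjoint z₀.snd - ∫ s in (0 : ℝ)..t, (ζ s).fst := by
  have hJd := denseRange_waveInv hι hd
  set n : WithLp 2 (V × H) :=
    (InnerProductSpace.toDual ℝ _).symm (ν.comp (WithLp.sndL 2 ℝ V H)) with hn
  have hn' : innerSL ℝ n = ν.comp (WithLp.sndL 2 ℝ V H) := by
    refine ContinuousLinearMap.ext fun p => ?_
    rw [innerSL_apply_apply, hn, InnerProductSpace.toDual_symm_apply]
  -- the boundary input acts on the second component only, so it is absent from the equation for the first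
  have hnf : n.fst = 0 := by
    have h1 : inner ℝ n (WithLp.toLp 2 (n.fst, (0 : H))) = 0 := by
      rw [← innerSL_apply_apply ℝ, hn']
      exact map_zero ν
    rw [phase_inner] at h1
    change inner ℝ n.fst n.fst + inner ℝ n.snd (0 : H) = 0 at h1
    rwa [inner_zero_right, add_zero, inner_self_eq_zero] at h1
  obtain ⟨Z, hZc, hZ⟩ := ha.exists_response hJd hf hf0
  have hSc : Continuous fun t => S t z₀ := hS.cont z₀
  have hζc : ContinuousOn (fun t => S t z₀ + c • Z t) (Ici 0) :=
    hSc.continuousOn.add (hZc.const_smul c)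
  refine ⟨fun t => S t z₀ + c • Z t, hζc, fun t ht q => ?_, fun t ht => ?_⟩
  · rw [inner_add_left, hS.inner_apply, real_inner_smul_left, hZ t ht q, mul_neg, ← sub_eq_add_neg]
    rfl
  · have h1 := hS.response_eq (isSkew_waveInv ι) hJd hf hZc (n := n) (by rw [hn']; exact hZ) ht
    have h2 := hS.integral_eq z₀ 0 t
    rw [hS.zero, one_apply_eq_self] at h2
    have hZi : IntervalIntegrable (fun s => c • Z s) volume 0 t :=
      (intervalIntegrable_of_continuousOn_Ici hZc le_rfl ht).smul c
    have h3 : waveInv ι (S t z₀ + c • Z t) = waveInv ι z₀ +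
        (∫ s in (0 : ℝ)..t, (S s z₀ + c • Z s)) + (c * ∫ s in (0 : ℝ)..t, f s) • n := by
      rw [intervalIntegral.integral_add (hSc.intervalIntegrable _ _) hZi,
        intervalIntegral.integral_smul, h2, map_add, map_smul, h1, hS.comm, smul_add, smul_smul]
      abel
    have h4 := congrArg (fun p : WithLp 2 (V × H) => p.fst) h3
    have h5 := fst_integral hζc le_rfl ht
    change -ι.adjoint (S t z₀ + c • Z t).snd = -ι.adjoint z₀.snd +
      (∫ s in (0 : ℝ)..t, (S s z₀ + c • Z s)).fst + (c * ∫ s in (0 : ℝ)..t, f s) • n.fst at h4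
    rw [h5, hnf, smul_zero, add_zero] at h4
    rw [← neg_inj, h4]
    abel

/-- Observability yields a control that steers the dual variable to zero. -/
theorem exists_control (hι : Function.Injective ι) (hd : DenseRange ι)
    (hS : IsUnitaryGroup (waveInv ι) S) {T C : ℝ} (hT : 0 ≤ T) (hC : 0 ≤ C)
    (hobs : ∀ q, ‖waveInv ι q‖ ≤ C * ‖hS.obs (ν.comp (WithLp.sndL 2 ℝ V H)) 0 T q‖)
    (z₀ : WithLp 2 (V × H)) {c : ℝ} (hc : c ≠ 0) :
    ∃ f : Lp ℝ 2 (volume : Measure ℝ), ∀ ζ : WithLp 2 (V × H),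
      (∀ q, inner ℝ ζ (waveInv ι q) = inner ℝ z₀ (S (-T) (waveInv ι q)) -
        c * ∫ s in (0 : ℝ)..T, f s * ν (S (s - T) q).snd) → ζ = 0 := by
  obtain ⟨f, hf⟩ := hS.exists_input hT hC hobs (-(c⁻¹ • S T z₀))
  refine ⟨f, fun ζ hζ => ?_⟩
  have h1 : ∀ q, inner ℝ ζ (waveInv ι q) = 0 := fun q => by
    have h2 := hf q
    rw [inner_neg_left, neg_inj, real_inner_smul_left, hS.inner_apply] at h2
    have h3 : ∫ s in (0 : ℝ)..T, f s * ν (S (s - T) q).snd =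
        c⁻¹ * inner ℝ z₀ (S (-T) (waveInv ι q)) := h2.symm
    rw [hζ q, h3, mul_inv_cancel_left₀ hc, sub_self]
  have h4 : ∀ p, inner ℝ ζ p = 0 := fun p =>
    (denseRange_waveInv hι hd).induction (P := fun p => inner ℝ ζ p = 0) (by
      rintro _ ⟨q, rfl⟩
      exact h1 q) (isClosed_eq (by fun_prop) (by fun_prop)) p
  exact inner_self_eq_zero.1 (h4 ζ)

/-- Every state is the limit of states of classical trajectories, whose observations converge in
`L²`. -/
theorem exists_trace_limit (hι : Function.Injective ι) (hd : DenseRange ι)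
    (hS : IsUnitaryGroup (waveInv ι) S)
    (ha : hS.Admissible (ν.comp (WithLp.sndL 2 ℝ V H))) {T : ℝ} (hT : 0 ≤ T)
    (p : WithLp 2 (V × H)) :
    ∃ (q : ℕ → WithLp 2 (V × H)) (g : ℝ → ℝ), MemLp g 2 (volume.restrict (Ioo 0 T)) ∧
      Tendsto (fun n => waveInv ι (q n)) atTop (𝓝 p) ∧
      Tendsto (fun n => eLpNorm (fun t => ν (S (t - T) (q n)).snd - g t) 2
        (volume.restrict (Ioo 0 T))) atTop (𝓝 0) := by
  obtain ⟨C, hC0, hC⟩ := ha T hT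
  obtain ⟨x, hx, hxp⟩ := mem_closure_iff_seq_limit.1 (denseRange_waveInv hι hd p)
  choose q hq using hx
  have hq' : Tendsto (fun n => waveInv ι (q n)) atTop (𝓝 p) := by simpa only [hq] using hxp
  set G : ℕ → Lp ℝ 2 (volume : Measure ℝ) := fun n =>
    hS.obs (ν.comp (WithLp.sndL 2 ℝ V H)) 0 T (S (-T) (q n)) with hG
  have hGC : CauchySeq G := by
    have h1 := hq'.cauchySeq
    rw [Metric.cauchySeq_iff] at h1 ⊢
    intro ε hε
    obtain ⟨N, hN⟩ := h1 (ε / (C + 1)) (by positivity)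
    refine ⟨N, fun k hk l hl => ?_⟩
    have h2 := hN k hk l hl
    rw [dist_eq_norm, ← map_sub] at h2
    rw [dist_eq_norm, hG]
    simp only
    rw [← map_sub, ← map_sub]
    refine (hC _).trans_lt ?_
    rw [← hS.comm, hS.norm]
    calc C * ‖waveInv ι (q k - q l)‖ ≤ C * (ε / (C + 1)) := mul_le_mul_of_nonneg_left h2.le hC0
      _ < (C + 1) * (ε / (C + 1)) := mul_lt_mul_of_pos_right (by linarith) (by positivity)
      _ = ε := by field_simp
  obtain ⟨g, hg⟩ := cauchySeq_tendsto_of_complete hGC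
  refine ⟨q, g, (Lp.memLp g).restrict _, hq', ?_⟩
  have h3 := (Lp.tendsto_Lp_iff_tendsto_eLpNorm' G g).1 hg
  refine tendsto_of_tendsto_of_tendsto_of_le_of_le tendsto_const_nhds h3 (fun _ => zero_le)
    fun n => ?_
  refine le_trans (le_of_eq (eLpNorm_congr_ae ?_))
    (eLpNorm_mono_measure _ (Measure.restrict_le_self (s := Ioo 0 T)))
  have h4 : (G n : ℝ → ℝ) =ᵐ[volume] (Ioc 0 T).indicator
      fun s => ν (S s (S (-T) (q n))).snd :=
    (memLp_indicator_Ioc_of_continuous (hS.continuous_observation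
      (ν.comp (WithLp.sndL 2 ℝ V H)) (S (-T) (q n))) 0 T).coeFn_toLp
  filter_upwards [ae_restrict_of_ae h4, ae_restrict_mem measurableSet_Ioo] with t h5 h6
  rw [Pi.sub_apply, h5, indicator_of_mem (Ioo_subset_Ioc_self h6), ← hS.add_apply, ← sub_eq_add_neg]

/-- Pairing with a square integrable function passes to the limit of the observations. -/
theorem tendsto_integral_mul_of_eLpNorm {f g : ℝ → ℝ} {G : ℕ → ℝ → ℝ} {T : ℝ} (hT : 0 ≤ T)
    (hf : MemLp f 2 (volume.restrict (Ioo 0 T))) (hg : MemLp g 2 (volume.restrict (Ioo 0 T)))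
    (hG : ∀ n, MemLp (G n) 2 (volume.restrict (Ioo 0 T)))
    (h : Tendsto (fun n => eLpNorm (fun t => G n t - g t) 2 (volume.restrict (Ioo 0 T)))
      atTop (𝓝 0)) :
    Tendsto (fun n => ∫ t in (0 : ℝ)..T, f t * G n t) atTop (𝓝 (∫ t in (0 : ℝ)..T, f t * g t)) := by
  have key : ∀ k : ℝ → ℝ, ∀ hk : MemLp k 2 (volume.restrict (Ioo 0 T)),
      inner ℝ (hf.toLp f) (hk.toLp k) = ∫ t in (0 : ℝ)..T, f t * k t := fun k hk => by
    rw [L2.inner_def, intervalIntegral.integral_of_le hT, integral_Ioc_eq_integral_Ioo]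
    refine integral_congr_ae ?_
    filter_upwards [hf.coeFn_toLp, hk.coeFn_toLp] with t h1 h2
    rw [h1, h2]
    exact mul_comm _ _
  have h1 := (Lp.tendsto_Lp_iff_tendsto_eLpNorm'' G hG g hg).2 h
  have h2 : Tendsto (fun n => inner ℝ (hf.toLp f) ((hG n).toLp (G n))) atTop
      (𝓝 (inner ℝ (hf.toLp f) (hg.toLp g))) := tendsto_const_nhds.inner h1
  simpa only [key] using h2

end Control

/-! ### Solutions of the degenerate equation in phase space -/

namespace Coeffs

variable {a b d : ℝ → ℝ} {V : Type} [NormedAddCommGroup V] [InnerProductSpace ℝ V]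

/-- The state `(y, z) ∈ H¹_{1/σ} × L²_{1/σ}`, with `y` measured in the energy norm. -/
def phase (e : H1 a b ≃L[ℝ] V) (y : H1 a b) (z : L2 a b) : WithLp 2 (V × L2 a b) :=
  WithLp.toLp 2 (e y, z)

theorem phase_snd (e : H1 a b ≃L[ℝ] V) (y : H1 a b) (z : L2 a b) : (phase e y z).snd = z := rfl

theorem phase_symm (e : H1 a b ≃L[ℝ] V) (p : WithLp 2 (V × L2 a b)) :
    phase e (e.symm p.fst) p.snd = p := phase_ext (e.apply_symm_apply _) rfl

theorem tendsto_phase {α : Type*} {l : Filter α} (e : H1 a b ≃L[ℝ] V) {y : α → H1 a b}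
    {z : α → L2 a b} {y₀ : H1 a b} {z₀ : L2 a b} (hy : Tendsto y l (𝓝 y₀))
    (hz : Tendsto z l (𝓝 z₀)) :
    Tendsto (fun n => phase e (y n) (z n)) l (𝓝 (phase e y₀ z₀)) :=
  ((WithLp.prod_continuous_toLp 2 V (L2 a b)).tendsto (e y₀, z₀)).comp
    (((e.continuous.tendsto y₀).comp hy).prodMk_nhds hz)

theorem emb_apply (e : H1 a b ≃L[ℝ] V) (y : H1 a b) : emb e (e y) = val a b y :=
  congrArg (val a b) (e.symm_apply_apply y)

variable {Ka Kd m : ℝ} (hC : Coeffs a b d Ka Kd m)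

include hC in
theorem injective_emb (e : H1 a b ≃L[ℝ] V) : Function.Injective (emb e) :=
  hC.val_injective.comp e.symm.injective

include hC in
theorem denseRange_emb (e : H1 a b ≃L[ℝ] V) : DenseRange (emb e) :=
  hC.denseRange_val.comp e.symm.surjective.denseRange (val a b).continuous

variable [CompleteSpace V] {lam : ℝ} {e : H1 a b ≃L[ℝ] V}
  (he : ∀ u v, inner ℝ (e u) (e v) = hC.energyForm lam u v)
  {S : ℝ → WithLp 2 (V × L2 a b) →L[ℝ] WithLp 2 (V × L2 a b)}
  (hS : IsUnitaryGroup (waveInv (emb e)) S)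
include he hS

/-- Mild solutions are the trajectories of the group. -/
theorem phase_eq_of_isMildSol {T : ℝ} (hT : 0 < T) {v0 : H1 a b} {v1 : L2 a b}
    {v : ℝ → H1 a b} {vt : ℝ → L2 a b} (h : IsMildSol a b d lam T v0 v1 v vt) :
    ∀ t ∈ Ici (0 : ℝ), phase e (v t) (vt t) = S (t - T) (phase e v0 v1) := by
  have hc := hC.completeSpace_H1
  have hcont : ContinuousOn (fun t => phase e (v t) (vt t)) (Ici 0) := fun t ht =>
    tendsto_phase e (h.cont t ht) (h.cont_t t ht)
  refine hS.eq_of_mild (isSkew_waveInv _)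
    (injective_waveInv (hC.injective_emb e) (hC.denseRange_emb e)) hcont hT fun t ht => ?_
  refine phase_ext ?_ ?_
  · rw [fst_integral hcont hT.le ht, waveInv_fst]
    have h1 := (hC.isALambda_iff_eq he _ _).1 (h.eq_snd t ht)
    have h2 := (e : H1 a b →L[ℝ] V).intervalIntegral_comp_comm
      (intervalIntegrable_of_continuousOn_Ici h.cont hT.le ht)
    exact h1.symm.trans h2.symm
  · rw [snd_integral hcont hT.le ht, waveInv_snd]
    change emb e (e (v t) - e v0) = ∫ s in T..t, vt s
    rw [map_sub, emb_apply, emb_apply, h.eq_fst t ht, add_sub_cancel_left]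

theorem isMildSol_group {T : ℝ} (v0 : H1 a b) (v1 : L2 a b) :
    IsMildSol a b d lam T v0 v1 (fun t => e.symm (S (t - T) (phase e v0 v1)).fst)
      fun t => (S (t - T) (phase e v0 v1)).snd := by
  have hc := hC.completeSpace_H1
  set P := phase e v0 v1 with hP
  have hcont : Continuous fun t => S (t - T) P := (hS.cont P).comp (by fun_prop)
  have h1 : Continuous fun t => (S (t - T) P).fst :=
    (WithLp.fstL 2 ℝ V (L2 a b)).continuous.comp hcont
  have h2 : Continuous fun t => (S (t - T) P).snd :=
    (WithLp.sndL 2 ℝ V (L2 a b)).continuous.comp hcont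
  have hint : ∀ t, ∫ s in T..t, S (s - T) P = waveInv (emb e) (S (t - T) P - P) := fun t => by
    rw [intervalIntegral.integral_comp_sub_right (fun r => S r P), sub_self, hS.integral_eq,
      hS.comm, hS.zero, one_apply_eq_self, map_sub]
  have hf : ∀ t, ∫ s in T..t, (S (s - T) P).fst = (∫ s in T..t, S (s - T) P).fst := fun t =>
    (WithLp.fstL 2 ℝ V (L2 a b)).intervalIntegral_comp_comm (hcont.intervalIntegrable _ _)
  have hs : ∀ t, ∫ s in T..t, (S (s - T) P).snd = (∫ s in T..t, S (s - T) P).snd := fun t =>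
    (WithLp.sndL 2 ℝ V (L2 a b)).intervalIntegral_comp_comm (hcont.intervalIntegrable _ _)
  refine ⟨(e.symm.continuous.comp h1).continuousOn, h2.continuousOn, fun t _ => ?_, fun t _ => ?_⟩
  · rw [hs, hint, waveInv_snd]
    change emb e (S (t - T) P).fst = _ + emb e ((S (t - T) P).fst - e v0)
    rw [map_sub, emb_apply, add_sub_cancel]
  · rw [hC.isALambda_iff_eq he]
    have h3 := (e.symm : V →L[ℝ] H1 a b).intervalIntegral_comp_comm
      (h1.intervalIntegrable (μ := volume) T t)
    change e (∫ s in T..t, (e.symm : V →L[ℝ] H1 a b) (S (s - T) P).fst) = _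
    rw [h3, hf, hint, waveInv_fst]
    exact e.apply_symm_apply _

/-- The states `S(t) J q` of the group form a classical solution. -/
theorem isClassicalSol_group (T : ℝ) (q : WithLp 2 (V × L2 a b)) :
    IsClassicalSol a b d lam (fun t => e.symm (S (t - T) (waveInv (emb e) q)).fst)
      (fun t => e.symm (S (t - T) q).fst) fun t => (S (t - T) q).snd := by
  have hcont : Continuous fun t => S (t - T) q := (hS.cont q).comp (by fun_prop)
  have hd : ∀ t, HasDerivAt (fun t => S (t - T) (waveInv (emb e) q)) (S (t - T) q) t := fun t =>
    (hS.deriv q (t - T)).comp_sub_const t T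
  have h1 : ∀ t, HasDerivAt (fun t => (S (t - T) (waveInv (emb e) q)).fst) (S (t - T) q).fst t :=
    fun t => (WithLp.fstL 2 ℝ V (L2 a b)).hasFDerivAt.comp_hasDerivAt t (hd t)
  have h2 : ∀ t, HasDerivAt (fun t => (S (t - T) (waveInv (emb e) q)).snd) (S (t - T) q).snd t :=
    fun t => (WithLp.sndL 2 ℝ V (L2 a b)).hasFDerivAt.comp_hasDerivAt t (hd t)
  refine ⟨fun t _ => ?_, fun t _ => ?_, ?_, ?_, fun t _ => ?_⟩
  · exact ((e.symm : V →L[ℝ] H1 a b).hasFDerivAt.comp_hasDerivAt t (h1 t)).hasDerivWithinAt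
  · refine (h2 t).hasDerivWithinAt.congr_of_eventuallyEq
      (Eventually.of_forall fun s => ?_) ?_ <;> beta_reduce <;> rw [hS.comm, waveInv_snd] <;> rfl
  · exact (e.symm.continuous.comp
      ((WithLp.fstL 2 ℝ V (L2 a b)).continuous.comp hcont)).continuousOn
  · exact ((WithLp.sndL 2 ℝ V (L2 a b)).continuous.comp hcont).continuousOn
  · rw [hC.isALambda_iff_eq he, e.apply_symm_apply, hS.comm, waveInv_fst]

/-- The state of a classical solution is `J q`, where `q` is the state of its time derivative, and its
normal derivative is the observation of the trajectory of `q`. -/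
theorem exists_of_isClassicalSol {ν : L2 a b →L[ℝ] ℝ} (hν : ∀ g, ν g = dxAtOne a b (solve e g))
    {T : ℝ} (hT : 0 < T) {v vt : ℝ → H1 a b} {vtt : ℝ → L2 a b}
    (h : IsClassicalSol a b d lam v vt vtt) :
    ∃ q, waveInv (emb e) q = phase e (v T) (val a b (vt T)) ∧
      ∀ t ∈ Ici (0 : ℝ), dxAtOne a b (v t) = ν (S (t - T) q).snd := by
  have hcont : ContinuousOn (fun t => phase e (vt t) (vtt t)) (Ici 0) := fun t ht =>
    tendsto_phase e (h.cont_t t ht) (h.cont_tt t ht)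
  have hJ : ∀ t ∈ Ici (0 : ℝ),
      phase e (v t) (val a b (vt t)) = waveInv (emb e) (phase e (vt t) (vtt t)) := fun t ht => by
    refine phase_ext ?_ ?_
    · exact (hC.isALambda_iff_eq he _ _).1 (h.eqn t ht)
    · exact (emb_apply e (vt t)).symm
  have hder : ∀ t ∈ Ici (0 : ℝ), HasDerivWithinAt (fun t => phase e (v t) (val a b (vt t)))
      (phase e (vt t) (vtt t)) (Ici 0) t := fun t ht => by
    have h1 := (e : H1 a b →L[ℝ] V).hasFDerivAt.comp_hasDerivWithinAt t (h.deriv_fst t ht)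
    exact ((WithLp.prodContinuousLinearEquiv 2 ℝ V (L2 a b)).symm :
      V × L2 a b →L[ℝ] WithLp 2 (V × L2 a b)).hasFDerivAt.comp_hasDerivWithinAt t
        (h1.prodMk (h.deriv_snd t ht))
  have hW := hS.eq_of_classical (isSkew_waveInv _)
    (injective_waveInv (hC.injective_emb e) (hC.denseRange_emb e)) hcont hder hJ hT
  refine ⟨phase e (vt T) (vtt T), (hJ T hT.le).symm, fun t ht => ?_⟩
  rw [← hW t ht, phase_snd, hν]
  congr 1
  rw [solve]
  change v t = e.symm (-(emb e).adjoint (vtt t))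
  rw [← (hC.isALambda_iff_eq he _ _).1 (h.eqn t ht), e.symm_apply_apply]

/-- Every datum has a mild solution with a normal derivative. -/
theorem exists_isNormalTrace {ν : L2 a b →L[ℝ] ℝ} (hν : ∀ g, ν g = dxAtOne a b (solve e g))
    (ha : hS.Admissible (ν.comp (WithLp.sndL 2 ℝ V (L2 a b)))) {T : ℝ} (hT : 0 ≤ T)
    (v0 : H1 a b) (v1 : L2 a b) : ∃ g, IsNormalTrace a b d lam T v0 v1 g := by
  obtain ⟨q, g, hg, hq, hlim⟩ := exists_trace_limit (hC.injective_emb e) (hC.denseRange_emb e) hS ha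
    hT (phase e v0 v1)
  have h1 : Tendsto (fun n => (waveInv (emb e) (q n)).fst) atTop (𝓝 (e v0)) :=
    ((WithLp.fstL 2 ℝ V (L2 a b)).continuous.tendsto _).comp hq
  have h2 : Tendsto (fun n => (waveInv (emb e) (q n)).snd) atTop (𝓝 v1) :=
    ((WithLp.sndL 2 ℝ V (L2 a b)).continuous.tendsto _).comp hq
  refine ⟨g, hg, _, _, _, fun n => hC.isClassicalSol_group he hS T (q n), ?_, ?_, ?_⟩
  · have h3 := (e.symm.continuous.tendsto _).comp h1
    rw [e.symm_apply_apply] at h3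
    simp only [sub_self, hS.zero, one_apply_eq_self]
    exact h3
  · simp only [sub_self, hS.zero, one_apply_eq_self]
    exact h2
  · refine hlim.congr fun n => ?_
    congr 1
    funext t
    rw [hν, hS.comm, waveInv_fst]
    rfl

/-- The duality between the controlled state and classical trajectories extends to mild solutions
and their normal derivatives. -/
theorem inner_phase_of_isNormalTrace {ν : L2 a b →L[ℝ] ℝ}
    (hν : ∀ g, ν g = dxAtOne a b (solve e g)) {T c : ℝ} (hT : 0 < T) {f : ℝ → ℝ}
    (hf : MemLp f 2 (volume.restrict (Ioo 0 T))) {z₀ ζ : WithLp 2 (V × L2 a b)}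
    (hζ : ∀ q, inner ℝ ζ (waveInv (emb e) q) = inner ℝ z₀ (S (-T) (waveInv (emb e) q)) -
      c * ∫ s in (0 : ℝ)..T, f s * ν (S (s - T) q).snd)
    {v0 : H1 a b} {v1 : L2 a b} {g : ℝ → ℝ} (h : IsNormalTrace a b d lam T v0 v1 g) :
    inner ℝ ζ (phase e v0 v1) = inner ℝ z₀ (S (-T) (phase e v0 v1)) -
      c * ∫ t in (0 : ℝ)..T, f t * g t := by
  obtain ⟨hg, v, vt, vtt, hcl, h0, h1, hlim⟩ := h
  choose q hq hdx using fun n => hC.exists_of_isClassicalSol he hS hν hT (hcl n)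
  have hP : Tendsto (fun n => waveInv (emb e) (q n)) atTop (𝓝 (phase e v0 v1)) := by
    simpa only [hq] using tendsto_phase e h0 h1
  have hG : ∀ n, (fun t => dxAtOne a b (v n t)) =ᵐ[volume.restrict (Ioo 0 T)]
      fun t => ν (S (t - T) (q n)).snd := fun n => by
    filter_upwards [ae_restrict_mem measurableSet_Ioo] with t ht using hdx n t ht.1.le
  have hmem : ∀ n, MemLp (fun t => ν (S (t - T) (q n)).snd) 2 (volume.restrict (Ioo 0 T)) :=
    fun n => by
    have h2 : Continuous fun t => ν (S (t - T) (q n)).snd :=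
      (hS.continuous_observation (ν.comp (WithLp.sndL 2 ℝ V (L2 a b))) (q n)).comp (by fun_prop)
    have h3 := memLp_indicator_Ioc_of_continuous h2 0 T
    rw [memLp_indicator_iff_restrict measurableSet_Ioc] at h3
    exact h3.mono_measure (Measure.restrict_mono Ioo_subset_Ioc_self le_rfl)
  have hlim' : Tendsto (fun n => eLpNorm (fun t => ν (S (t - T) (q n)).snd - g t) 2
      (volume.restrict (Ioo 0 T))) atTop (𝓝 0) :=
    hlim.congr fun n => eLpNorm_congr_ae ((hG n).sub (EventuallyEq.refl _ g))
  have h2 := tendsto_integral_mul_of_eLpNorm hT.le hf hg hmem hlim'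
  have h3 : Tendsto (fun n => inner ℝ ζ (waveInv (emb e) (q n))) atTop
      (𝓝 (inner ℝ ζ (phase e v0 v1))) := tendsto_const_nhds.inner hP
  have h4 : Tendsto (fun n => inner ℝ z₀ (S (-T) (waveInv (emb e) (q n)))) atTop
      (𝓝 (inner ℝ z₀ (S (-T) (phase e v0 v1)))) :=
    tendsto_const_nhds.inner (((S (-T)).continuous.tendsto _).comp hP)
  refine tendsto_nhds_unique h3 ?_
  simp only [hζ]
  exact h4.sub (h2.const_mul c)

omit he hS

/-- The state `z₀` with `⟪z₀, (y, z)⟫ = ⟨u₁, y⟩ - ⟪u₀, z⟫`. -/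
def dualState (e : H1 a b ≃L[ℝ] V) (u0 : L2 a b) (u1 : Hm1 a b) : WithLp 2 (V × L2 a b) :=
  WithLp.toLp 2 ((InnerProductSpace.toDual ℝ V).symm (u1.comp (e.symm : V →L[ℝ] H1 a b)), -u0)

theorem inner_dualState (e : H1 a b ≃L[ℝ] V) (u0 : L2 a b) (u1 : Hm1 a b) (y : H1 a b)
    (z : L2 a b) : inner ℝ (dualState e u0 u1) (phase e y z) = u1 y - inner ℝ u0 z := by
  rw [phase_inner]
  change inner ℝ ((InnerProductSpace.toDual ℝ V).symm (u1.comp (e.symm : V →L[ℝ] H1 a b))) (e y) +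
    inner ℝ (-u0) z = _
  rw [InnerProductSpace.toDual_symm_apply, inner_neg_left, ← sub_eq_add_neg]
  change u1 (e.symm (e y)) - _ = _
  rw [e.symm_apply_apply]

/-- The energy space as a space of functionals on `H¹_{1/σ}`. -/
def toFunctional (e : H1 a b ≃L[ℝ] V) : V →L[ℝ] Hm1 a b :=
  LinearMap.mkContinuous
    { toFun := fun x => (innerSL ℝ x).comp (e : H1 a b →L[ℝ] V)
      map_add' := fun x y => by
        ext v
        exact inner_add_left _ _ _
      map_smul' := fun c x => by
        ext v
        exact real_inner_smul_left _ _ _ } ‖(e : H1 a b →L[ℝ] V)‖ fun x => by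
    rw [mul_comm]
    refine (ContinuousLinearMap.opNorm_comp_le _ _).trans_eq ?_
    rw [innerSL_apply_norm]

omit [CompleteSpace V] in
theorem toFunctional_apply (e : H1 a b ≃L[ℝ] V) (x : V) (y : H1 a b) :
    toFunctional e x y = inner ℝ x (e y) := rfl

theorem toHm1_eq (e : H1 a b ≃L[ℝ] V) (u : L2 a b) :
    toHm1 a b u = toFunctional e ((emb e).adjoint u) := by
  ext v
  rw [toFunctional_apply, ContinuousLinearMap.adjoint_inner_left, emb_apply]
  rfl

/-- If the second component of `ζ` has the derivative `-ζ.fst` in the dual of `H¹_{1/σ}`, then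
`u = -ζ.snd` is `C¹` there, and `u_t = ζ.fst`. -/
theorem contDiffOn_toHm1 (e : H1 a b ≃L[ℝ] V) {ζ : ℝ → WithLp 2 (V × L2 a b)}
    (hζ : ContinuousOn ζ (Ici 0)) {x : V}
    (h : ∀ t, 0 ≤ t → (emb e).adjoint (ζ t).snd = x - ∫ s in (0 : ℝ)..t, (ζ s).fst) :
    ContDiffOn ℝ 1 (fun t => toHm1 a b (-(ζ t).snd)) (Ici 0) ∧
      ∀ t ∈ Ici (0 : ℝ), timeDeriv a b (fun t => -(ζ t).snd) t = toFunctional e (ζ t).fst := by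
  refine contDiffOn_comp_integral (G := Hm1 a b) (toFunctional e) (x := -x)
    ((WithLp.fstL 2 ℝ V (L2 a b)).continuous.comp_continuousOn hζ) fun t ht => ?_
  rw [toHm1_eq e, map_neg, h t ht, neg_sub, sub_eq_neg_add]
  rfl

include he hS

/-- A curve `ζ` that satisfies the duality relation and has `ζ.snd' = -ζ.fst` yields the transposition
solution `u = -ζ.snd`. -/
theorem isTranspositionSol_of_dual {ν : L2 a b →L[ℝ] ℝ} (hν : ∀ g, ν g = dxAtOne a b (solve e g))
    {f : ℝ → ℝ} (hf : MemLp f 2 volume) {u0 : L2 a b} {u1 : Hm1 a b}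
    {ζ : ℝ → WithLp 2 (V × L2 a b)} (hζ : ContinuousOn ζ (Ici 0))
    (hdual : ∀ t, 0 ≤ t → ∀ q, inner ℝ (ζ t) (waveInv (emb e) q) =
      inner ℝ (dualState e u0 u1) (S (-t) (waveInv (emb e) q)) -
        eta a b 1 * ∫ s in (0 : ℝ)..t, f s * ν (S (s - t) q).snd)
    (hsnd : ∀ t, 0 ≤ t → (emb e).adjoint (ζ t).snd =
      (emb e).adjoint (dualState e u0 u1).snd - ∫ s in (0 : ℝ)..t, (ζ s).fst) :
    IsTranspositionSol a b d lam f u0 u1 fun t => -(ζ t).snd := by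
  obtain ⟨h1, h2⟩ := contDiffOn_toHm1 e hζ hsnd
  refine ⟨fun T _ => hf.restrict _,
    ((WithLp.sndL 2 ℝ V (L2 a b)).continuous.comp_continuousOn hζ).neg, h1, ?_⟩
  intro T hT v0 v1 v vt vx hv hvx
  have h3 := hC.inner_phase_of_isNormalTrace he hS hν hT (hf.restrict _) (hdual T hT.le) hvx
  have h4 := hC.phase_eq_of_isMildSol he hS hT hv 0 (mem_Ici.2 le_rfl)
  rw [zero_sub] at h4
  rw [← h4, inner_dualState, phase_inner] at h3
  rw [h2 T hT.le, toFunctional_apply, inner_neg_left, sub_neg_eq_add]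
  exact h3

/-- The state of a transposition solution is determined by duality. -/
theorem eq_zero_of_isTranspositionSol {ν : L2 a b →L[ℝ] ℝ}
    (hν : ∀ g, ν g = dxAtOne a b (solve e g))
    (ha : hS.Admissible (ν.comp (WithLp.sndL 2 ℝ V (L2 a b)))) {T : ℝ} (hT : 0 < T) {f : ℝ → ℝ}
    {u0 : L2 a b} {u1 : Hm1 a b}
    (hdual : ∀ q, 0 = inner ℝ (dualState e u0 u1) (S (-T) (waveInv (emb e) q)) -
        eta a b 1 * ∫ s in (0 : ℝ)..T, f s * ν (S (s - T) q).snd)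
    {u : ℝ → L2 a b} (hu : IsTranspositionSol a b d lam f u0 u1 u) :
    u T = 0 ∧ timeDeriv a b u T = 0 := by
  have key : ∀ v0 v1, timeDeriv a b u T v0 - inner ℝ (u T) v1 = 0 := fun v0 v1 => by
    obtain ⟨g, hg⟩ := hC.exists_isNormalTrace he hS hν ha hT.le v0 v1
    have h1 := hu.identity T hT v0 v1 _ _ g (hC.isMildSol_group he hS v0 v1) hg
    have h2 := hC.inner_phase_of_isNormalTrace he hS hν hT (hu.control T hT) (ζ := 0)
      (fun q => by rw [inner_zero_left]; exact hdual q) hg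
    rw [inner_zero_left, ← phase_symm e (S (-T) (phase e v0 v1)), inner_dualState] at h2
    rw [h1, zero_sub]
    exact h2.symm
  have h1 : u T = 0 := by
    have h2 := key 0 (u T)
    rwa [map_zero, zero_sub, neg_eq_zero, inner_self_eq_zero] at h2
  refine ⟨h1, ContinuousLinearMap.ext fun v0 => ?_⟩
  have h2 := key v0 0
  rwa [inner_zero_right, sub_zero] at h2

end Coeffs

/-! ### Null controllability -/

namespace Coeffs

variable {a b d : ℝ → ℝ} {Ka Kd m : ℝ} (hC : Coeffs a b d Ka Kd m)

include hC in
/-- The multiplier inequality gives observability in every time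
`T > 2 max {1, 1 / a(1)} / (1 - K_a / 2 - m)`, hence null controllability. -/
theorem exists_null_control {lam : ℝ} (hform : max lam 0 * CHP a b d < 1) (hK : Ka < 2 - 2 * m)
    (hlam : (lam < 0 ∧ |lam| * CHP a b d * (1 + 3 * Ka / 2 + Kd + m) < 2 - Ka - 2 * m) ∨
      (0 ≤ lam ∧ Ka + 2 * Kd ≤ 2 - 2 * m)) {T : ℝ}
    (hT : 2 * max 1 (1 / a 1) / (1 - Ka / 2 - m) < T) (u0 : L2 a b) (u1 : Hm1 a b) :
    ∃ f : ℝ → ℝ, MemLp f 2 (volume.restrict (Ioo 0 T)) ∧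
      (∃ u : ℝ → L2 a b, IsTranspositionSol a b d lam ((Ioo 0 T).indicator f) u0 u1 u) ∧
      ∀ u : ℝ → L2 a b, IsTranspositionSol a b d lam ((Ioo 0 T).indicator f) u0 u1 u →
        u T = 0 ∧ timeDeriv a b u T = 0 := by
  obtain ⟨V, i1, i2, i3, e, he⟩ := hC.exists_energyNorm hform
  obtain ⟨ν, κ, θ, κ₁, C₁, hν, hM⟩ := hC.exists_multiplierData he hK hlam
  have hι := hC.injective_emb e
  have hd := hC.denseRange_emb e
  obtain ⟨S, hS⟩ := (isSkew_waveInv (emb e)).exists_group (injective_waveInv hι hd)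
  have hT' : 2 * max 1 (1 / a 1) / (1 / 2 * (1 - m) + 1 / 2 * (1 - Ka - m)) < T := by
    convert hT using 2
    ring
  have hT0 : 0 < T := lt_of_le_of_lt (div_nonneg (by positivity) (by linarith)) hT
  have ha := hM.admissible hS
  obtain ⟨C, hC0, hobs⟩ := hM.exists_obs hS (denseRange_waveInv hι hd) hT'
  have hη : eta a b 1 ≠ 0 := (eta_pos 1).ne'
  obtain ⟨f, hf⟩ := exists_control hι hd hS hT0.le hC0 hobs (dualState e u0 u1) hη
  have hf2 : MemLp f 2 volume := Lp.memLp f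
  have hfi : MemLp ((Ioo 0 T).indicator f) 2 volume := hf2.indicator measurableSet_Ioo
  obtain ⟨ζ, hζc, hζ, hζs⟩ := exists_controlled_curve hι hd hS ha hfi
    (fun s hs => indicator_of_notMem (fun h => hs.not_gt h.1) _) (dualState e u0 u1) (eta a b 1)
  have hint : ∀ g : ℝ → ℝ, ∫ s in (0 : ℝ)..T, (Ioo 0 T).indicator f s * g s =
      ∫ s in (0 : ℝ)..T, f s * g s := fun g => by
    rw [intervalIntegral.integral_of_le hT0.le, intervalIntegral.integral_of_le hT0.le,
      integral_Ioc_eq_integral_Ioo, integral_Ioc_eq_integral_Ioo]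
    exact setIntegral_congr_fun measurableSet_Ioo fun s hs => by
      simp only [indicator_of_mem hs]
  have hζT : ζ T = 0 := hf _ fun q => by rw [hζ T hT0.le, hint]
  refine ⟨f, hf2.restrict _, ⟨_, hC.isTranspositionSol_of_dual he hS hν hfi hζc hζ hζs⟩,
    fun u hu => hC.eq_zero_of_isTranspositionSol he hS hν ha hT0 (fun q => ?_) hu⟩
  rw [← hζ T hT0.le, hζT, inner_zero_left]

include hC in
/-- The given time `T0` exceeds the threshold `2 max {1, 1 / a(1)} / (1 - K_a / 2 - m)`. -/
theorem exists_null_control_of_range {T0 lam : ℝ} (hlt : lam < 1 / CHP a b d)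
    (hKa : Ka = degExp a) (hKd : Kd = degExp d)
    (hr : NegRange a b d lam m T0 ∨ NonnegRange a b d lam m T0)
    {T : ℝ} (hT : T0 < T) (u0 : L2 a b) (u1 : Hm1 a b) :
    ∃ f : ℝ → ℝ, MemLp f 2 (volume.restrict (Ioo 0 T)) ∧
      (∃ u : ℝ → L2 a b, IsTranspositionSol a b d lam ((Ioo 0 T).indicator f) u0 u1 u) ∧
      ∀ u : ℝ → L2 a b, IsTranspositionSol a b d lam ((Ioo 0 T).indicator f) u0 u1 u →
        u T = 0 ∧ timeDeriv a b u T = 0 := by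
  have hCHP := hC.CHP_nonneg
  have ha := hC.deg_a.exp_pos
  have hd := hC.deg_d.exp_pos
  have hm := hC.drift_nonneg
  have hμ : (1 : ℝ) ≤ max 1 (1 / a 1) := le_max_left _ _
  have hnum : 4 * max 1 (1 / a 1) ≤ timeNum a b d := by
    rw [timeNum, ← hKa]
    have : 0 ≤ Ka * max 1 (CHP a b d * sSup (d '' Icc 0 1)) := by positivity
    linarith
  rcases hr with ⟨h1, h2, h3, h4⟩ | ⟨h1, h2, h3⟩
  · rw [← hKa, ← hKd] at h1 h4
    rw [← hKa] at h3
    set k := 1 + 3 * Ka / 2 + Kd + m with hk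
    have hk0 : 0 < k := by positivity
    have hpos : 0 < CHP a b d * k := by
      -- if `C_HP` were `0`, the lower bound for `λ` would be the junk value `0`
      refine mul_pos (hCHP.lt_of_ne fun h0 => ?_) hk0
      rw [← h0, zero_mul, div_zero, neg_zero] at h1
      exact absurd h1 h2.le.not_gt
    have hsmall : |lam| * CHP a b d * k < 2 - Ka - 2 * m := by
      rw [abs_of_neg h2, mul_assoc, ← lt_div_iff₀ hpos]
      linarith
    refine hC.exists_null_control (by rw [max_eq_right h2.le, zero_mul]; exact one_pos) h3
      (Or.inl ⟨h2, hsmall⟩) (lt_of_le_of_lt ?_ hT) u0 u1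
    rw [h4, div_le_div_iff₀ (by linarith) (by linarith)]
    have h5 : 0 ≤ |lam| * CHP a b d * k := by positivity
    have h6 := mul_le_mul_of_nonneg_right hnum (show 0 ≤ 1 - Ka / 2 - m by linarith)
    have h7 := mul_nonneg (zero_le_one.trans hμ) h5
    linarith
  · rw [← hKa, ← hKd] at h2
    rw [← hKa] at h3
    have hpos : 0 < CHP a b d := one_div_pos.1 (h1.trans_lt hlt)
    refine hC.exists_null_control (by rwa [max_eq_left h1, ← lt_div_iff₀ hpos]) (by linarith)
      (Or.inr ⟨h1, h2⟩) (lt_of_le_of_lt ?_ hT) u0 u1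
    rw [h3]
    exact div_le_div_of_nonneg_right (by linarith) (by linarith)

end Coeffs

end

end DegWave

theorem mainTheorem1 (a b d : ℝ → ℝ) (lam T0 : ℝ) (h : DegWave.ControlHyp a b d lam T0)
    (T : ℝ) (hT : T0 < T) (u0 : DegWave.L2 a b) (u1 : DegWave.Hm1 a b) :
    ∃ f : ℝ → ℝ, MemLp f 2 (volume.restrict (Ioo 0 T)) ∧
      (∃ u : ℝ → DegWave.L2 a b,
        DegWave.IsTranspositionSol a b d lam ((Ioo 0 T).indicator f) u0 u1 u) ∧
      ∀ u : ℝ → DegWave.L2 a b,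
        DegWave.IsTranspositionSol a b d lam ((Ioo 0 T).indicator f) u0 u1 u →
          u T = 0 ∧ DegWave.timeDeriv a b u T = 0 := by
  obtain ⟨hB, h | h | h | h⟩ := h
  · exact (hB.coeffs_driftM h.1).exists_null_control_of_range hB.lam_lt rfl rfl (Or.inl h.2)
      hT u0 u1
  · exact (hB.coeffs_driftM h.1).exists_null_control_of_range hB.lam_lt rfl rfl (Or.inr h.2)
      hT u0 u1
  · exact (hB.coeffs_driftMInf h.2.1).exists_null_control_of_range hB.lam_lt rfl rfl (Or.inl h.2.2)
      hT u0 u1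
  · exact (hB.coeffs_driftMInf h.2.1).exists_null_control_of_range hB.lam_lt rfl rfl (Or.inr h.2.2)
      hT u0 u1
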